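/- Let $k$ be an algebraically closed field of characteristic $11$ and let $\varepsilon\in k$. Let $X_\varepsilon$ be the K3 surface with affine Weierstrass equation $$y^2+x^3+\varepsilon x^2t_0^4+t_1^{11}t_0-t_0^{11}t_1=0,$$ where $t_0,t_1,x,y$ have weights $1,1,4,6$; precisely, $X_\varepsilon$ is the smooth projective Weierstrass model over $\mathbb{P}^1$, i.e. the quotient of $$\{(t_0,t_1,x,y,z)\in k^5 : (t_0,t_1)\ne 0,\ (x,y,z)\neq 0,\ y^2z+x^3+\varepsilon x^2zt_0^4+(t_1^{11}t_0-t_0^{11}t_1)z^3=0\}$$ by the action $(t_0,t_1,x,y,z)\mapsto(at_0,at_1,a^4bx,a^6by,bz)$ of $(a,b)\in (k^*)^2$. The projection to $[t_0:t_1]$ is the standard elliptic fibration $X_\varepsilon\to\mathbb{P}^1$, and $S_\varepsilon=\{x=z=0\}$ is its zero section. Let $V(\Delta_\varepsilon)\subset\mathbb{P}^1$ be the zero set of the discriminant $$\Delta_\varepsilon=-t_0^2(t_1^{11}-t_1t_0^{10})(5t_1^{11}-5t_1t_0^{10}+4\varepsilon^3t_0^{11}),$$ and let $\mathrm{Aut}(\mathbb{P}^1,V(\Delta_\varepsilon))$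 be the group of automorphisms $h$ of $\mathbb{P}^1$ over $k$ with $h(V(\Delta_\varepsilon))=V(\Delta_\varepsilon)$. An automorphism of $X_\varepsilon$ is called symplectic if it preserves a nonzero regular $2$-form. Write $\mathrm{GU}_2(11)=\{A\in \mathrm{GL}_2(\mathbb{F}_{121}): A^t\bar A=I\}$ with $\bar a=a^{11}$, $\mathrm{PGU}_2(11)$ for its quotient by the scalar matrices in it, $L_2(11)=\mathrm{PSL}_2(\mathbb{F}_{11})$, $A:n$ for a semidirect product $A\rtimes C_n$, and $A.2$ for a group with a normal subgroup $A$ of index $2$. Then there is a finite subgroup $K_\varepsilon$ of $\mathrm{Aut}(X_\varepsilon)$ such that: (i) every element of $K_\varepsilon$ maps fibres of the standard elliptic fibration to fibres, inducing an automorphism of $\mathbb{P}^1$, and maps $S_\varepsilon$ onto itself; (ii) $K_0\cong \mathrm{GU}_2(11)/\{\pm I\}\cong L_2(11):12$, and $K_\varepsilon\cong 11:4$, a nontrivial semidirect product of cyclic groups, if $\varepsilon\neq0$ (in particular for $\varepsilon=1$); in both cases the semidirect decomposition can be chosen so that all elements of the first factor are symplectic and no nonidentity element of the second factor is symplectic;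 (iii) the image of $K_\varepsilon$ in $\mathrm{Aut}(\mathbb{P}^1)$ is equal to $\mathrm{Aut}(\mathbb{P}^1,V(\Delta_\varepsilon))$; (iv) $\mathrm{Aut}(\mathbb{P}^1,V(\Delta_0))\cong \mathrm{PGU}_2(11)\cong L_2(11).2$, and $\mathrm{Aut}(\mathbb{P}^1,V(\Delta_\varepsilon))\cong 11:2$, a nontrivial semidirect product of cyclic groups, if $\varepsilon\ne0$. -/

import Mathlib

open MvPolynomial

noncomputable section

namespace K3Eleven

/-! ## Classical varieties as spaces with functions -/

/-- A sheaf of `k`-valued functions on a topological space, given by its stalks: `regularAt x` is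
the algebra of all functions `X → k` that are regular on some neighbourhood of `x`
(their values away from `x` are arbitrary). -/
class FunctionSheaf (k X : Type*) [Field k] [TopologicalSpace X] where
  regularAt : X → Subalgebra k (X → k)
  congr : ∀ {x : X} {f g : X → k}, f ∈ regularAt x → (∀ᶠ y in nhds x, f y = g y) →
    g ∈ regularAt x
  eventually : ∀ {x : X} {f : X → k}, f ∈ regularAt x → ∀ᶠ y in nhds x, f ∈ regularAt y

/-- Multihomogeneous coordinates on a set `X`: every point of `X` is represented by coordinate
vectors in `cone`, and whether a weighted homogeneous polynomial vanishes at a point does not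
depend on the representing vector. -/
structure HomogeneousCoordinates (k σ M X : Type*) [Field k] [AddCommMonoid M] where
  weight : σ → M
  cone : Set (σ → k)
  toPoint : cone → X
  surjective : Function.Surjective toPoint
  ne_zero : ∀ (B : MvPolynomial σ k) (d : M), IsWeightedHomogeneous weight B d →
    ∀ v w : cone, toPoint v = toPoint w → eval v.1 B ≠ 0 → eval w.1 B ≠ 0

namespace HomogeneousCoordinates

variable {k σ M X : Type*} [Field k] [AddCommMonoid M]

/-- The Zariski topology: the sets where a weighted homogeneous polynomial does not vanish form a
basis of the open sets. -/
abbrev zariski (H : HomogeneousCoordinates k σ M X) : TopologicalSpace X where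
  IsOpen U := ∀ v : H.cone, H.toPoint v ∈ U → ∃ (d : M) (B : MvPolynomial σ k),
    IsWeightedHomogeneous H.weight B d ∧ eval v.1 B ≠ 0 ∧
      ∀ w : H.cone, eval w.1 B ≠ 0 → H.toPoint w ∈ U
  isOpen_univ := fun _ _ => ⟨0, 1, isWeightedHomogeneous_one k H.weight, by simp, by simp⟩
  isOpen_inter := by
    intro U V hU hV v hv
    obtain ⟨d, B, hB, hBv, hBU⟩ := hU v hv.1
    obtain ⟨e, C, hC, hCv, hCV⟩ := hV v hv.2
    refine ⟨d + e, B * C, hB.mul hC, by simp [hBv, hCv], fun w hw => ?_⟩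
    simp only [map_mul, ne_eq, mul_eq_zero, not_or] at hw
    exact ⟨hBU w hw.1, hCV w hw.2⟩
  isOpen_sUnion := by
    rintro S hS v ⟨U, hU, hv⟩
    obtain ⟨d, B, hB, hBv, hBU⟩ := hS U hU v hv
    exact ⟨d, B, hB, hBv, fun w hw => ⟨U, hU, hBU w hw⟩⟩

/-- `f` is regular at `x` if near `x` it is a quotient `A / B` of two weighted homogeneous
polynomials of the same degree with `B` not vanishing at `x`. -/
def IsRegularAt (H : HomogeneousCoordinates k σ M X) (x : X) (f : X → k) : Prop :=
  ∀ v : H.cone, H.toPoint v = x → ∃ (d : M) (A B : MvPolynomial σ k),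
    IsWeightedHomogeneous H.weight A d ∧ IsWeightedHomogeneous H.weight B d ∧ eval v.1 B ≠ 0 ∧
      ∀ w : H.cone, eval w.1 B ≠ 0 → f (H.toPoint w) = eval w.1 A / eval w.1 B

/-- The sheaf of regular functions. -/
abbrev functionSheaf (H : HomogeneousCoordinates k σ M X) : @FunctionSheaf k X _ H.zariski :=
  letI := H.zariski
  { regularAt := fun x =>
      { carrier := {f | H.IsRegularAt x f}
        mul_mem' := by
          intro f g hf hg v hv
          obtain ⟨d, A, B, hA, hB, hBv, h⟩ := hf v hv
          obtain ⟨e, A', B', hA', hB', hBv', h'⟩ := hg v hv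
          refine ⟨d + e, A * A', B * B', hA.mul hA', hB.mul hB', by simp [hBv, hBv'],
            fun w hw => ?_⟩
          simp only [map_mul, ne_eq, mul_eq_zero, not_or] at hw
          simp [h w hw.1, h' w hw.2, div_mul_div_comm]
        add_mem' := by
          intro f g hf hg v hv
          obtain ⟨d, A, B, hA, hB, hBv, h⟩ := hf v hv
          obtain ⟨e, A', B', hA', hB', hBv', h'⟩ := hg v hv
          refine ⟨d + e, A * B' + B * A', B * B', (hA.mul hB').add (hB.mul hA'), hB.mul hB',
            by simp [hBv, hBv'], fun w hw => ?_⟩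
          simp only [map_mul, ne_eq, mul_eq_zero, not_or] at hw
          simp [h w hw.1, h' w hw.2, div_add_div _ _ hw.1 hw.2]
        algebraMap_mem' := by
          intro c v _
          exact ⟨0, C c, 1, isWeightedHomogeneous_C _ _, isWeightedHomogeneous_one k H.weight,
            by simp, by simp⟩ }
    congr := by
      intro x f g hf hfg v hv
      obtain ⟨d, A, B, hA, hB, hBv, h⟩ := hf v hv
      obtain ⟨U, hUfg, hU, hxU⟩ := eventually_nhds_iff.1 hfg
      obtain ⟨e, D, hD, hDv, hDU⟩ := hU v (hv ▸ hxU)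
      refine ⟨d + e, A * D, B * D, hA.mul hD, hB.mul hD, by simp [hBv, hDv], fun w hw => ?_⟩
      simp only [map_mul, ne_eq, mul_eq_zero, not_or] at hw
      rw [← hUfg _ (hDU w hw.2), h w hw.1, map_mul, map_mul, mul_div_mul_right _ _ hw.2]
    eventually := by
      intro x f hf
      obtain ⟨v, rfl⟩ := H.surjective x
      obtain ⟨d, A, B, hA, hB, hBv, h⟩ := hf v rfl
      refine eventually_nhds_iff.2 ⟨{y | ∃ w : H.cone, H.toPoint w = y ∧ eval w.1 B ≠ 0}, ?_, ?_, ?_⟩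
      · rintro y ⟨w, rfl, hw⟩ u hu
        exact ⟨d, A, B, hA, hB, H.ne_zero B d hB w u hu.symm hw, h⟩
      · rintro u ⟨w, hwu, hw⟩
        exact ⟨d, B, hB, H.ne_zero B d hB w u hwu hw, fun u' hu' => ⟨u', rfl, hu'⟩⟩
      · exact ⟨v, rfl, hBv⟩ }

end HomogeneousCoordinates

/-- Rescaling the coordinates through a character multiplies a weighted homogeneous polynomial by
the value of the character at its degree. -/
theorem eval_rescale {k σ M : Type*} [Field k] [AddCommMonoid M] (w : σ → M)
    (χ : Multiplicative M →* kˣ) (u v : σ → k)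
    (huv : ∀ i, u i = (χ (Multiplicative.ofAdd (w i)) : k) * v i)
    (B : MvPolynomial σ k) (d : M) (hB : IsWeightedHomogeneous w B d) :
    eval u B = (χ (Multiplicative.ofAdd d) : k) * eval v B := by
  rw [eval_eq, eval_eq, Finset.mul_sum]
  refine Finset.sum_congr rfl fun m hm => ?_
  have hd := hB (mem_support_iff.1 hm)
  have : ∏ i ∈ m.support, u i ^ m i
      = (χ (Multiplicative.ofAdd d) : k) * ∏ i ∈ m.support, v i ^ m i := by
    simp only [huv, mul_pow, Finset.prod_mul_distrib]
    congr 1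
    rw [← hd, Finsupp.weight_apply, Finsupp.sum, ofAdd_sum, map_prod, Units.coe_prod]
    exact Finset.prod_congr rfl fun i _ => by rw [ofAdd_nsmul, map_pow, Units.val_pow_eq_pow_val]
  rw [this]; ring

section Morphisms

variable (k : Type*) [Field k]

/-- Morphisms of spaces with functions: continuous maps that pull back regular functions to
regular functions. -/
structure IsMorphism {X Y : Type*} [TopologicalSpace X] [FunctionSheaf k X]
    [TopologicalSpace Y] [FunctionSheaf k Y] (φ : X → Y) : Prop where
  continuous : Continuous φ
  regular : ∀ (x : X) (f : Y → k), f ∈ FunctionSheaf.regularAt (k := k) (φ x) →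
    f ∘ φ ∈ FunctionSheaf.regularAt (k := k) x

variable (X : Type*) [TopologicalSpace X] [FunctionSheaf k X]

/-- The group of automorphisms of the variety `X` over `k`. -/
def VarietyAut : Subgroup (Equiv.Perm X) where
  carrier := {φ | IsMorphism k (φ : X → X) ∧ IsMorphism k (φ.symm : X → X)}
  mul_mem' := by
    rintro φ ψ ⟨hφ, hφ'⟩ ⟨hψ, hψ'⟩
    exact ⟨⟨hφ.continuous.comp hψ.continuous,
        fun x f hf => hψ.regular x _ (hφ.regular (ψ x) f hf)⟩,
      ⟨hψ'.continuous.comp hφ'.continuous,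
        fun x f hf => hφ'.regular x _ (hψ'.regular (φ.symm x) f hf)⟩⟩
  one_mem' := ⟨⟨continuous_id, fun _ _ hf => hf⟩, ⟨continuous_id, fun _ _ hf => hf⟩⟩
  inv_mem' := fun h => ⟨h.2, h.1⟩

variable {X}

/-- The Zariski tangent space at `x`: the `k`-derivations of the functions regular at `x` into the
residue field. (The Leibniz rule forces a derivation to depend on germs only.) -/
def tangentSpace (x : X) :
    Submodule k (Module.Dual k (FunctionSheaf.regularAt (k := k) x)) where
  carrier := {D | ∀ f g : FunctionSheaf.regularAt (k := k) x,
    D (f * g) = f.1 x * D g + g.1 x * D f}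
  add_mem' := by
    intro D E hD hE f g
    simp only [LinearMap.add_apply, hD f g, hE f g]; ring
  zero_mem' := by intro f g; simp
  smul_mem' := by
    intro c D hD f g
    simp only [LinearMap.smul_apply, hD f g, smul_eq_mul]; ring

variable {k}

/-- The tangent map of a morphism: `(dφ D)(f) = D (f ∘ φ)`. -/
def tangentMap {φ : X → X} (hφ : IsMorphism k φ) (x : X) :
    tangentSpace k x →ₗ[k] tangentSpace k (φ x) where
  toFun D :=
    ⟨{ toFun := fun f => D.1 ⟨f.1 ∘ φ, hφ.regular x f.1 f.2⟩
       map_add' := fun f g => D.1.map_add ⟨f.1 ∘ φ, hφ.regular x f.1 f.2⟩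
         ⟨g.1 ∘ φ, hφ.regular x g.1 g.2⟩
       map_smul' := fun c f => D.1.map_smul c ⟨f.1 ∘ φ, hφ.regular x f.1 f.2⟩ },
      fun f g => D.2 ⟨f.1 ∘ φ, hφ.regular x f.1 f.2⟩ ⟨g.1 ∘ φ, hφ.regular x g.1 g.2⟩⟩
  map_add' _ _ := rfl
  map_smul' _ _ := rfl

variable (k X) in
/-- A field of alternating bilinear forms on the tangent spaces of `X`. -/
abbrev TwoFormField : Type _ := (x : X) → tangentSpace k x [⋀^Fin 2]→ₗ[k] k

/-- A regular 2-form on a smooth variety: locally it is a sum of terms `f dg ∧ dh` with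
`f`, `g`, `h` regular functions. -/
def TwoFormField.IsRegular (ω : TwoFormField k X) : Prop :=
  ∀ x : X, ∃ (n : ℕ) (f g h : Fin n → X → k), ∀ᶠ y in nhds x,
    (∀ i, f i ∈ FunctionSheaf.regularAt (k := k) y) ∧
    ∃ (hg : ∀ i, g i ∈ FunctionSheaf.regularAt (k := k) y)
      (hh : ∀ i, h i ∈ FunctionSheaf.regularAt (k := k) y),
      ∀ D E : tangentSpace k y, ω y ![D, E] =
        ∑ i, f i y * (D.1 ⟨g i, hg i⟩ * E.1 ⟨h i, hh i⟩ - E.1 ⟨g i, hg i⟩ * D.1 ⟨h i, hh i⟩)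

/-- Pullback of 2-forms along an automorphism. -/
def TwoFormField.pullback (ω : TwoFormField k X) (φ : VarietyAut k X) : TwoFormField k X :=
  fun x => (ω (φ.1 x)).compLinearMap (tangentMap φ.2.1 x)

/-- An automorphism is symplectic if it preserves a nonzero regular 2-form. -/
def IsSymplectic (φ : VarietyAut k X) : Prop :=
  ∃ ω : TwoFormField k X, ω.IsRegular ∧ ω ≠ 0 ∧ ω.pullback φ = ω

end Morphisms

/-! ## The projective line -/

/-- The set of points of the projective line over `k`. -/
def P1 (k : Type*) [Field k] : Type _ := Projectivization k (Fin 2 → k)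

def P1.coordinates (k : Type*) [Field k] : HomogeneousCoordinates k (Fin 2) ℕ (P1 k) where
  weight := fun _ => 1
  cone := {v | v ≠ 0}
  toPoint := fun v => Projectivization.mk k v.1 v.2
  surjective := fun x => ⟨⟨x.rep, x.rep_nonzero⟩, x.mk_rep⟩
  ne_zero := by
    intro B d hB v w hvw hv
    obtain ⟨a, ha⟩ := (Projectivization.mk_eq_mk_iff k v.1 w.1 v.2 w.2).1 hvw
    have := eval_rescale (fun _ : Fin 2 => 1) (powersHom kˣ a) v.1 w.1
      (fun i => by rw [← ha]; simp [Units.smul_def]) B d hB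
    intro h0
    exact hv (by rw [this, h0, mul_zero])

instance (k : Type*) [Field k] : TopologicalSpace (P1 k) := (P1.coordinates k).zariski

instance (k : Type*) [Field k] : FunctionSheaf k (P1 k) := (P1.coordinates k).functionSheaf

/-! ## The surface -/

section Surface

variable {k : Type*} [Field k]

/-- The coordinate vectors `(t₀, t₁, x, y, z)` with `(t₀, t₁) ≠ 0`, `(x, y, z) ≠ 0` and
`y² z + x³ + ε x² z t₀⁴ + (t₁¹¹ t₀ - t₀¹¹ t₁) z³ = 0`. -/
def surfaceCone (ε : k) : Set (Fin 5 → k) :=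
  {v | (v 0 ≠ 0 ∨ v 1 ≠ 0) ∧ (v 2 ≠ 0 ∨ v 3 ≠ 0 ∨ v 4 ≠ 0) ∧
    v 3 ^ 2 * v 4 + v 2 ^ 3 + ε * v 2 ^ 2 * v 4 * v 0 ^ 4
      + (v 1 ^ 11 * v 0 - v 0 ^ 11 * v 1) * v 4 ^ 3 = 0}

/-- Vectors that differ by
`(t₀, t₁, x, y, z) ↦ (a t₀, a t₁, a⁴ b x, a⁶ b y, b z)` with `a, b ∈ kˣ`. -/
def surfaceSetoid (ε : k) : Setoid (surfaceCone ε) where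
  r v w := ∃ a b : kˣ, v.1 0 = a * w.1 0 ∧ v.1 1 = a * w.1 1 ∧ v.1 2 = a ^ 4 * b * w.1 2 ∧
    v.1 3 = a ^ 6 * b * w.1 3 ∧ v.1 4 = b * w.1 4
  iseqv :=
    { refl := fun v => ⟨1, 1, by simp⟩
      symm := by
        rintro v w ⟨a, b, h0, h1, h2, h3, h4⟩
        refine ⟨a⁻¹, b⁻¹, ?_, ?_, ?_, ?_, ?_⟩
        all_goals first | rw [h0] | rw [h1] | rw [h2] | rw [h3] | rw [h4]
        all_goals simp only [Units.val_inv_eq_inv_val]; field_simp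
      trans := by
        rintro u v w ⟨a, b, h0, h1, h2, h3, h4⟩ ⟨a', b', h0', h1', h2', h3', h4'⟩
        refine ⟨a * a', b * b', ?_, ?_, ?_, ?_, ?_⟩
        · rw [h0, h0']; push_cast; ring
        · rw [h1, h1']; push_cast; ring
        · rw [h2, h2']; push_cast; ring
        · rw [h3, h3']; push_cast; ring
        · rw [h4, h4']; push_cast; ring }

/-- The smooth projective Weierstrass model over the projective line of the affine surface
`y² + x³ + ε x² t₀⁴ + t₁¹¹ t₀ - t₀¹¹ t₁ = 0`: it lies in the bundle of projective planes over
the projective line in which the fibre coordinates `x, y, z` have weights `4, 6, 0`, and `z = 1`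
gives back the affine equation. -/
def Surface (ε : k) : Type _ := Quotient (surfaceSetoid ε)

def Surface.coordinates (ε : k) : HomogeneousCoordinates k (Fin 5) (ℕ × ℕ) (Surface ε) where
  weight := ![(1, 0), (1, 0), (4, 1), (6, 1), (0, 1)]
  cone := surfaceCone ε
  toPoint := fun v => Quotient.mk (surfaceSetoid ε) v
  surjective := Quotient.mk_surjective
  ne_zero := by
    intro B d hB v w hvw hv
    obtain ⟨a, b, h0, h1, h2, h3, h4⟩ := Quotient.exact hvw
    have := eval_rescale _
      ((powersHom kˣ a).comp (AddMonoidHom.toMultiplicative (AddMonoidHom.fst ℕ ℕ))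
        * (powersHom kˣ b).comp (AddMonoidHom.toMultiplicative (AddMonoidHom.snd ℕ ℕ)))
      v.1 w.1 (fun i => by fin_cases i <;> simp [h0, h1, h2, h3, h4]) B d hB
    intro h0
    exact hv (by rw [this, h0, mul_zero])

instance (ε : k) : TopologicalSpace (Surface ε) := (Surface.coordinates ε).zariski

instance (ε : k) : FunctionSheaf k (Surface ε) := (Surface.coordinates ε).functionSheaf

/-- The standard elliptic fibration: the projection to `[t₀ : t₁]`. -/
def standardFibration (ε : k) : Surface ε → P1 k :=
  Quotient.lift
    (fun v : surfaceCone ε => (P1.coordinates k).toPoint ⟨![v.1 0, v.1 1], by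
      intro h
      have h0 := congrFun h 0
      have h1 := congrFun h 1
      simp only [Matrix.cons_val_zero, Matrix.cons_val_one, Pi.zero_apply] at h0 h1
      exact v.2.1.elim (fun h => h h0) (fun h => h h1)⟩)
    (by
      rintro v w ⟨a, b, h0, h1, -⟩
      refine (Projectivization.mk_eq_mk_iff k _ _ _ _).2 ⟨a, ?_⟩
      funext i
      fin_cases i <;> simp [h0, h1, Units.smul_def])

/-- The zero section, that is the section at infinity `[x : y : z] = [0 : 1 : 0]`. -/
def zeroSection (ε : k) : Set (Surface ε) :=
  {p | ∃ v : surfaceCone ε, (Surface.coordinates ε).toPoint v = p ∧ v.1 2 = 0 ∧ v.1 4 = 0}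

/-- `g` maps fibres of the standard fibration to fibres and induces the automorphism `h` of the
base. -/
def Induces {ε : k} (g : VarietyAut k (Surface ε)) (h : VarietyAut k (P1 k)) : Prop :=
  ∀ p : Surface ε, standardFibration ε (g.1 p) = h.1 (standardFibration ε p)

/-- The discriminant of the cubic `X³ + ε t₀⁴ X² + (t₁¹¹ t₀ - t₀¹¹ t₁)`, a binary form of degree
24 in `t₀, t₁`. -/
def discriminantForm (ε : k) : MvPolynomial (Fin 2) k :=
  Cubic.discr ⟨1, C ε * X 0 ^ 4, 0, X 1 ^ 11 * X 0 - X 0 ^ 11 * X 1⟩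

theorem discriminantForm_eq [CharP k 11] (ε : k) :
    discriminantForm ε = -X 0 ^ 2 * (X 1 ^ 11 - X 1 * X 0 ^ 10) *
      (5 * X 1 ^ 11 - 5 * X 1 * X 0 ^ 10 + 4 * C ε ^ 3 * X 0 ^ 11) := by
  have h : (11 : MvPolynomial (Fin 2) k) = 0 := CharP.cast_eq_zero (MvPolynomial (Fin 2) k) 11
  simp only [discriminantForm, Cubic.discr]
  linear_combination (-2 * X 0 ^ 2 * (X 1 ^ 11 - X 1 * X 0 ^ 10) ^ 2) * h

/-- The discriminant locus, as a set of points of the projective line. -/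
def discriminantLocus (ε : k) : Set (P1 k) :=
  {p | ∃ v : (P1.coordinates k).cone, (P1.coordinates k).toPoint v = p ∧
    eval v.1 (discriminantForm ε) = 0}

/-- The automorphisms of the projective line that leave the discriminant locus invariant. -/
def discriminantStabilizer (ε : k) : Subgroup (VarietyAut k (P1 k)) where
  carrier := {h | h.1 '' discriminantLocus ε = discriminantLocus ε}
  mul_mem' := by
    intro g h hg hh
    simp only [Set.mem_ofPred_eq] at hg hh ⊢
    rw [Subgroup.coe_mul, Equiv.Perm.coe_mul, Set.image_comp, hh, hg]
  one_mem' := by simp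
  inv_mem' := by
    intro h hh
    simp only [Set.mem_ofPred_eq] at hh ⊢
    conv_lhs => rw [← hh]
    rw [← Set.image_comp]
    have : ((h⁻¹).1 : P1 k → P1 k) ∘ h.1 = id := by
      funext p; exact h.1.symm_apply_apply p
    rw [this, Set.image_id]

end Surface

/-! ## Finite groups -/

instance factPrimeEleven : Fact (Nat.Prime 11) := ⟨by norm_num⟩

/-- The conjugation `a ↦ a¹¹` of the field with 121 elements. -/
abbrev conj : GaloisField 11 2 →+* GaloisField 11 2 := frobenius (GaloisField 11 2) 11

/-- The finite unitary group: matrices `A` over the field with 121 elements with `Aᵗ Ā = 1`. -/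
def GU2 : Subgroup (GL (Fin 2) (GaloisField 11 2)) where
  carrier := {A | A.1.transpose * A.1.map conj = 1}
  mul_mem' := by
    intro A B hA hB
    simp only [Set.mem_ofPred_eq] at hA hB ⊢
    rw [Units.val_mul, Matrix.transpose_mul, Matrix.map_mul, Matrix.mul_assoc,
      ← Matrix.mul_assoc A.1.transpose, hA, Matrix.one_mul, hB]
  one_mem' := by simp
  inv_mem' := by
    intro A hA
    simp only [Set.mem_ofPred_eq] at hA ⊢
    have h1 : (A⁻¹).1.transpose * A.1.transpose = 1 := by
      rw [← Matrix.transpose_mul, ← Units.val_mul, mul_inv_cancel, Units.val_one,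
        Matrix.transpose_one]
    have h2 : A.1.map conj * (A⁻¹).1.map conj = 1 := by
      rw [← Matrix.map_mul, ← Units.val_mul, mul_inv_cancel, Units.val_one]
      simp
    calc (A⁻¹).1.transpose * (A⁻¹).1.map conj
        = (A⁻¹).1.transpose * (A.1.transpose * A.1.map conj) * (A⁻¹).1.map conj := by
          rw [hA, Matrix.mul_one]
      _ = ((A⁻¹).1.transpose * A.1.transpose) * (A.1.map conj * (A⁻¹).1.map conj) := by
          simp only [Matrix.mul_assoc]
      _ = 1 := by rw [h1, h2, Matrix.one_mul]

/-- The subgroup `{1, -1}` of the unitary group. -/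
def plusMinusOne : Subgroup GU2 where
  carrier := {A | (A : GL (Fin 2) (GaloisField 11 2)) = 1 ∨
    (A : GL (Fin 2) (GaloisField 11 2)) = -1}
  mul_mem' := by
    intro A B hA hB
    simp only [Set.mem_ofPred_eq, Subgroup.coe_mul] at hA hB ⊢
    rcases hA with hA | hA <;> rcases hB with hB | hB <;> rw [hA, hB] <;> simp
  one_mem' := Or.inl rfl
  inv_mem' := by
    intro A hA
    simp only [Set.mem_ofPred_eq, Subgroup.coe_inv] at hA ⊢
    rcases hA with hA | hA <;> rw [hA] <;> simp

instance : plusMinusOne.Normal where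
  conj_mem := by
    intro A hA g
    change (g.1 * A.1 * (g⁻¹).1 = 1) ∨ (g.1 * A.1 * (g⁻¹).1 = -1)
    rcases hA with hA | hA <;> rw [hA] <;> simp

/-- The projective unitary group, the quotient of the unitary group by its centre (the scalar
matrices in it). -/
abbrev PGU2 : Type := GU2 ⧸ Subgroup.center GU2

/-- `L₂(11) = PSL₂(𝔽₁₁)`. -/
abbrev L2 : Type := Matrix.ProjectiveSpecialLinearGroup (Fin 2) (ZMod 11)

/-- The cyclic group of order `n`, written multiplicatively. -/
abbrev Cyc (n : ℕ) : Type := Multiplicative (ZMod n)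

end K3Eleven

end

open K3Eleven

noncomputable section

namespace K3Eleven

/-! ## Weighted homogeneous polynomials -/

/-! Write H = t₁¹¹t₀ - t₀¹¹t₁ (`hermForm`) and let a bar denote the 11th power map. Then H(v) is the
determinant of the pair (v, v̄), so H is, up to a scalar, a hermitian form for 𝔽₁₂₁ over 𝔽₁₁, and it
is preserved by the matrices A with det A · Ā = A (`hermGroup`).

For ε = 0 these matrices act on the surface through t₀, t₁ alone. An orthogonal basis identifies
`hermGroup` with GU₂(11) (`exists_unitaryEquiv`), and exactly ±1 act trivially
(`hermAction_eq_one_iff`). An element is symplectic if and only if its determinant is 1; then Ā = A,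
so A lies in SL₂(𝔽₁₁), and the image of this group is L₂(11). A torus of order 12 on which the
determinant is faithful gives the complement. The discriminant locus is the set of 𝔽₁₁-points of the
line; a matrix stabilising it is proportional to its Frobenius conjugate and can be rescaled into
`hermGroup` (`range_hermGroup`).

For ε ≠ 0 choose r with r¹¹ - r = -3ε³. The locus consists of ∞, 𝔽₁₁ and r + 𝔽₁₁. Translations by
𝔽₁₁ and the reflection t ↦ r - t preserve it, and the reflection lifts to the surface with order 4
(`quarticAction`). There are no further symmetries, by counting zeros of quadratic polynomials and
comparing with Frobenius (`range_affineHom`).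

To decide which elements are symplectic one needs all regular 2-forms. In characteristic 11 the
derivative of the equation by t₁ is the unit -1 on the chart t₀ = z = 1, so x and y are local
coordinates on that whole chart and a regular form is F dx ∧ dy there. In the other charts dx ∧ dy
has neither zeros nor poles (`wedge_eq_det3_mul`, which rests on `det3_eq_of_isBasic`), so F has no
poles and is constant (`exists_eq_const`: Cayley–Hamilton makes F finite-valued, irreducibility of
the equation makes it constant). Hence an automorphism multiplies dx ∧ dy by a constant that can be
read off at one point (`isSymplectic_iff`). For the linear actions used here, a singular point of a
fibre over a point of 𝔽₁₁ makes this a short computation (`FibredAction.isSymplectic_toAut_iff`). -/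

theorem isWeightedHomogeneous_bind {k σ τ M : Type*} [Field k] [AddCommMonoid M] {w : σ → M}
    {w' : τ → M} (m : σ → MvPolynomial τ k) (hm : ∀ i, IsWeightedHomogeneous w' (m i) (w i))
    {B : MvPolynomial σ k} {d : M} (hB : IsWeightedHomogeneous w B d) :
    IsWeightedHomogeneous w' (aeval m B) d := by
  rw [aeval_def, eval₂_eq]
  refine IsWeightedHomogeneous.sum _ _ _ fun s hs => ?_
  have hd := hB (mem_support_iff.1 hs)
  have := IsWeightedHomogeneous.prod s.support (fun i => m i ^ s i) (fun i => s i • w i)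
    (w := w') fun i _ => (hm i).pow (s i)
  rw [Finsupp.weight_apply, Finsupp.sum] at hd
  rw [hd] at this
  exact this.C_mul _

theorem IsWeightedHomogeneous.map_weight {k σ M N : Type*} [Field k] [AddCommMonoid M]
    [AddCommMonoid N] {w : σ → M} (χ : M →+ N) {B : MvPolynomial σ k} {d : M}
    (hB : IsWeightedHomogeneous w B d) : IsWeightedHomogeneous (fun i => χ (w i)) B (χ d) := by
  intro s hs
  rw [← hB hs, Finsupp.weight_apply, Finsupp.weight_apply, Finsupp.sum, Finsupp.sum, map_sum]
  simp only [map_nsmul]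

/-! ## Varieties with multihomogeneous coordinates -/

namespace HomogeneousCoordinates

variable {k σ M X : Type*} [Field k] [AddCommMonoid M] (H : HomogeneousCoordinates k σ M X)

theorem eventually_iff {p : X → Prop} (v : H.cone) :
    (∀ᶠ y in @nhds X H.zariski (H.toPoint v), p y) ↔ ∃ (d : M) (B : MvPolynomial σ k),
      IsWeightedHomogeneous H.weight B d ∧ eval v.1 B ≠ 0 ∧
        ∀ w : H.cone, eval w.1 B ≠ 0 → p (H.toPoint w) := by
  let := H.zariski
  constructor
  · intro h
    obtain ⟨U, hUp, hU, hvU⟩ := eventually_nhds_iff.1 h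
    obtain ⟨d, B, hB, hBv, hBU⟩ := hU v hvU
    exact ⟨d, B, hB, hBv, fun w hw => hUp _ (hBU w hw)⟩
  · rintro ⟨d, B, hB, hBv, h⟩
    refine eventually_nhds_iff.2 ⟨{y | ∃ w : H.cone, H.toPoint w = y ∧ eval w.1 B ≠ 0}, ?_, ?_, ?_⟩
    · rintro y ⟨w, rfl, hw⟩
      exact h w hw
    · rintro u ⟨w, hwu, hw⟩
      exact ⟨d, B, hB, H.ne_zero B d hB w u hwu hw, fun u' hu' => ⟨u', rfl, hu'⟩⟩
    · exact ⟨v, rfl, hBv⟩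

/-- One representative is enough, because nonvanishing of the homogeneous denominator does not
depend on the representing vector. -/
theorem isRegularAt_iff {f : X → k} (v : H.cone) :
    H.IsRegularAt (H.toPoint v) f ↔ ∃ (d : M) (A B : MvPolynomial σ k),
      IsWeightedHomogeneous H.weight A d ∧ IsWeightedHomogeneous H.weight B d ∧ eval v.1 B ≠ 0 ∧
        ∀ w : H.cone, eval w.1 B ≠ 0 → f (H.toPoint w) = eval w.1 A / eval w.1 B := by
  constructor
  · intro h
    exact h v rfl
  · rintro ⟨d, A, B, hA, hB, hBv, h⟩ w hw
    exact ⟨d, A, B, hA, hB, H.ne_zero B d hB v w hw.symm hBv, h⟩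

theorem IsRegularAt.inv {f : X → k} {x : X} (hf : H.IsRegularAt x f) (h0 : f x ≠ 0) :
    H.IsRegularAt x (fun y => (f y)⁻¹) := by
  obtain ⟨v, rfl⟩ := H.surjective x
  obtain ⟨d, A, B, hA, hB, hBv, h⟩ := (H.isRegularAt_iff v).1 hf
  have hAv : eval v.1 A ≠ 0 := by
    intro h'
    rw [h v hBv, h', zero_div] at h0
    exact h0 rfl
  -- The extra factor B ensures that the formula for f is available wherever the new denominator is
  -- nonzero.
  refine (H.isRegularAt_iff v).2 ⟨d + d, B * B, A * B, hB.mul hB, hA.mul hB, by simp [hAv, hBv],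
    fun w hw => ?_⟩
  simp only [map_mul, ne_eq, mul_eq_zero, not_or] at hw
  rw [h w hw.2, map_mul, map_mul, inv_div, mul_div_mul_right _ _ hw.2]

/-- Substituting polynomials of the right weights preserves homogeneity, so basic open sets pull
back to basic open sets and quotients A / B to quotients of the same kind. -/
theorem isMorphism_of_polynomial (m : σ → MvPolynomial σ k)
    (hm : ∀ i, IsWeightedHomogeneous H.weight (m i) (H.weight i)) (ψ : H.cone → H.cone)
    (hψ : ∀ v i, (ψ v).1 i = eval v.1 (m i)) (φ : X → X)
    (hφ : ∀ v, φ (H.toPoint v) = H.toPoint (ψ v)) :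
    @IsMorphism k _ X X H.zariski H.functionSheaf H.zariski H.functionSheaf φ := by
  let := H.zariski
  let := H.functionSheaf
  have key : ∀ (v : H.cone) (B : MvPolynomial σ k), eval v.1 (aeval m B) = eval (ψ v).1 B := by
    intro v B
    rw [show (ψ v).1 = fun i => eval v.1 (m i) from funext (hψ v)]
    induction B using MvPolynomial.induction_on with
    | C a => simp
    | add p q hp hq => rw [map_add, map_add, map_add, hp, hq]
    | mul_X p i hp => rw [map_mul, map_mul, map_mul, hp, aeval_X, eval_X]
  refine ⟨⟨fun U hU v hv => ?_⟩, fun x f hf => ?_⟩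
  · rw [Set.mem_preimage, hφ] at hv
    obtain ⟨d, B, hB, hBv, h⟩ := hU (ψ v) hv
    refine ⟨d, aeval m B, isWeightedHomogeneous_bind m hm hB, by rwa [key], fun w hw => ?_⟩
    rw [key] at hw
    rw [Set.mem_preimage, hφ]
    exact h _ hw
  · obtain ⟨v, rfl⟩ := H.surjective x
    rw [hφ] at hf
    obtain ⟨d, A, B, hA, hB, hBv, h⟩ := (H.isRegularAt_iff (ψ v)).1 hf
    refine (H.isRegularAt_iff v).2 ⟨d, aeval m A, aeval m B, isWeightedHomogeneous_bind m hm hA,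
      isWeightedHomogeneous_bind m hm hB, by rwa [key], fun w hw => ?_⟩
    rw [key] at hw
    rw [Function.comp_apply, hφ, h _ hw, key, key]

/-- A polynomial automorphism of the cone induces an automorphism of the variety. -/
def autOfPolynomial (m m' : σ → MvPolynomial σ k)
    (hm : ∀ i, IsWeightedHomogeneous H.weight (m i) (H.weight i))
    (hm' : ∀ i, IsWeightedHomogeneous H.weight (m' i) (H.weight i)) (ψ ψ' : H.cone → H.cone)
    (hψ : ∀ v i, (ψ v).1 i = eval v.1 (m i)) (hψ' : ∀ v i, (ψ' v).1 i = eval v.1 (m' i))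
    (φ : Equiv.Perm X) (hφ : ∀ v, φ (H.toPoint v) = H.toPoint (ψ v))
    (hφ' : ∀ v, φ.symm (H.toPoint v) = H.toPoint (ψ' v)) :
    @VarietyAut k _ X H.zariski H.functionSheaf :=
  letI := H.zariski
  letI := H.functionSheaf
  ⟨φ, H.isMorphism_of_polynomial m hm ψ hψ φ hφ, H.isMorphism_of_polynomial m' hm' ψ' hψ' _ hφ'⟩

end HomogeneousCoordinates

/-! ## Tangent vectors -/

section Tangent

variable {k X : Type*} [Field k] [TopologicalSpace X] [FunctionSheaf k X] {x : X}

theorem tangent_algebraMap (D : tangentSpace k x) (c : k) :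
    D.1 (algebraMap k (FunctionSheaf.regularAt (k := k) x) c) = 0 := by
  have h1 : D.1 1 = 0 := by
    have := D.2 1 1
    simpa using this
  rw [Algebra.algebraMap_eq_smul_one, map_smul, h1, smul_zero]

/-- The indicator function of the set f ≠ g vanishes near x, so it is regular there, and f - g
equals its product with this function. Both factors vanish at x, so the Leibniz rule gives zero. -/
theorem tangent_eq_of_eventuallyEq (D : tangentSpace k x)
    (f g : FunctionSheaf.regularAt (k := k) x) (h : ∀ᶠ y in nhds x, f.1 y = g.1 y) :
    D.1 f = D.1 g := by
  classical
  have h0 : (fun y => if f.1 y = g.1 y then 0 else 1 : X → k) ∈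
      FunctionSheaf.regularAt (k := k) x := by
    refine FunctionSheaf.congr (zero_mem _) ?_
    filter_upwards [h] with y hy
    simp [hy]
  have h1 : f - g = (f - g) * ⟨_, h0⟩ := by
    apply Subtype.ext
    funext y
    by_cases hy : f.1 y = g.1 y <;> simp [hy]
  have h2 := D.2 (f - g) ⟨_, h0⟩
  rw [← h1] at h2
  have hx : f.1 x = g.1 x := h.self_of_nhds
  have h3 : (f - g).1 x = 0 := by simp [hx]
  simp only [h3, hx, if_true, zero_mul, add_zero, map_sub] at h2
  exact sub_eq_zero.1 h2

/-- The chain rule for polynomials in regular functions. -/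
theorem tangent_aeval {τ : Type*} [Fintype τ] (D : tangentSpace k x)
    (c : τ → FunctionSheaf.regularAt (k := k) x) (P : MvPolynomial τ k) :
    D.1 (aeval c P) = ∑ i, eval (fun j => (c j).1 x) (pderiv i P) * D.1 (c i) := by
  classical
  have hev : ∀ Q : MvPolynomial τ k, (aeval c Q).1 x = eval (fun j => (c j).1 x) Q := by
    intro Q
    induction Q using MvPolynomial.induction_on with
    | C a => simp
    | add p q hp hq => simp [hp, hq]
    | mul_X p i hp => simp [hp]
  induction P using MvPolynomial.induction_on with
  | C a => simp [tangent_algebraMap]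
  | add p q hp hq => simp [hp, hq, add_mul, Finset.sum_add_distrib]
  | mul_X p i hp =>
    rw [map_mul, aeval_X, D.2, hp, hev]
    simp only [pderiv_mul, pderiv_X, map_add, map_mul, eval_X, add_mul, Finset.sum_add_distrib]
    rw [add_comm]
    congr 1
    · rw [Finset.mul_sum]
      exact Finset.sum_congr rfl fun j _ => by ring
    · rw [Finset.sum_eq_single i]
      · simp
      · intro j _ hj
        simp [hj.symm]
      · simp

end Tangent

/-! ### The equation of the surface and its irreducibility -/

section Equation

variable {k : Type*} [Field k]

/-- The equation of the surface. -/
def surfacePoly (ε : k) : MvPolynomial (Fin 5) k :=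
  X 3 ^ 2 * X 4 + X 2 ^ 3 + C ε * X 2 ^ 2 * X 4 * X 0 ^ 4 +
    (X 1 ^ 11 * X 0 - X 0 ^ 11 * X 1) * X 4 ^ 3

theorem eval_surfacePoly (ε : k) (v : Fin 5 → k) : eval v (surfacePoly ε) =
    v 3 ^ 2 * v 4 + v 2 ^ 3 + ε * v 2 ^ 2 * v 4 * v 0 ^ 4
      + (v 1 ^ 11 * v 0 - v 0 ^ 11 * v 1) * v 4 ^ 3 := by
  simp [surfacePoly]

theorem mem_surfaceCone {ε : k} {v : Fin 5 → k} : v ∈ surfaceCone ε ↔ (v 0 ≠ 0 ∨ v 1 ≠ 0) ∧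
    (v 2 ≠ 0 ∨ v 3 ≠ 0 ∨ v 4 ≠ 0) ∧ eval v (surfacePoly ε) = 0 := by
  rw [eval_surfacePoly]; rfl

/-- The equation of the surface as a monic polynomial in `x` over the polynomial ring in the
remaining variables. -/
def surfaceCubic (ε : k) : Polynomial (MvPolynomial (Fin 4) k) :=
  Polynomial.X ^ 3 + Polynomial.C (C ε * X 3 * X 1 ^ 4) * Polynomial.X ^ 2 +
    Polynomial.C (X 3 * (X 2 ^ 2 + (X 0 ^ 11 * X 1 - X 1 ^ 11 * X 0) * X 3 ^ 2))

/-- The transposition moves x to index 0, the variable that `finSuccEquiv` singles out. The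
remaining variables 0, 1, 2, 3 are then t₁, t₀, y, z. -/
theorem finSuccEquiv_surfacePoly (ε : k) :
    finSuccEquiv k 4 (rename (Equiv.swap (0 : Fin 5) 2) (surfacePoly ε)) = surfaceCubic ε := by
  have h0 : Equiv.swap (0 : Fin 5) 2 0 = 2 := by decide
  have h1 : Equiv.swap (0 : Fin 5) 2 1 = 1 := by decide
  have h2 : Equiv.swap (0 : Fin 5) 2 2 = 0 := by decide
  have h3 : Equiv.swap (0 : Fin 5) 2 3 = 3 := by decide
  have h4 : Equiv.swap (0 : Fin 5) 2 4 = 4 := by decide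
  have e1 : finSuccEquiv k 4 (X 1) = Polynomial.C (X 0) := finSuccEquiv_X_succ (j := 0)
  have e2 : finSuccEquiv k 4 (X 2) = Polynomial.C (X 1) := finSuccEquiv_X_succ (j := 1)
  have e3 : finSuccEquiv k 4 (X 3) = Polynomial.C (X 2) := finSuccEquiv_X_succ (j := 2)
  have e4 : finSuccEquiv k 4 (X 4) = Polynomial.C (X 3) := finSuccEquiv_X_succ (j := 3)
  have eC : finSuccEquiv k 4 (C ε) = Polynomial.C (C ε) := by simp [finSuccEquiv_apply]
  simp only [surfacePoly, map_add, map_mul, map_pow, map_sub, rename_X, rename_C, h0, h1, h2, h3,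
    h4, e1, e2, e3, e4, eC, finSuccEquiv_X_zero, surfaceCubic]
  ring

/-- Eisenstein's criterion at the prime z: the constant term z(y² + …z²) is divisible by z but not
by z², as the point with y = 1 and the other variables 0 shows. -/
theorem surfaceCubic_irreducible (ε : k) : Irreducible (surfaceCubic ε) := by
  have hmonic : (surfaceCubic ε).Monic := by unfold surfaceCubic; monicity!
  have hdeg : (surfaceCubic ε).natDegree = 3 := by unfold surfaceCubic; compute_degree!
  have hc : ∀ (a b : MvPolynomial (Fin 4) k) (n : ℕ),
      (Polynomial.X ^ 3 + Polynomial.C a * Polynomial.X ^ 2 + Polynomial.C b).coeff n =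
        (if n = 3 then 1 else 0) + (if n = 2 then a else 0) + (if n = 0 then b else 0) := by
    intro a b n
    simp only [Polynomial.coeff_add, Polynomial.coeff_X_pow, Polynomial.coeff_C_mul,
      Polynomial.coeff_C, mul_ite, mul_one, mul_zero]
  have hX : Prime (X 3 : MvPolynomial (Fin 4) k) := X_prime
  have hP : (Ideal.span {(X 3 : MvPolynomial (Fin 4) k)}).IsPrime :=
    (Ideal.span_singleton_prime hX.ne_zero).2 hX
  refine (hmonic.isEisensteinAt_of_mem_of_notMem hP.ne_top ?_ ?_).irreducible hP
    hmonic.isPrimitive (by omega)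
  · intro n hn
    rw [hdeg] at hn
    rw [Ideal.mem_span_singleton]
    rw [surfaceCubic, hc]
    interval_cases n <;> simp
    exact ⟨C ε * X 1 ^ 4, by ring⟩
  · rw [Ideal.span_singleton_pow, Ideal.mem_span_singleton]
    rintro ⟨R, hR⟩
    have h : X 2 ^ 2 + (X 0 ^ 11 * X 1 - X 1 ^ 11 * X 0) * X 3 ^ 2 = X 3 * R := by
      apply mul_left_cancel₀ hX.ne_zero
      rw [← mul_assoc, ← pow_two, ← hR, surfaceCubic, hc]
      simp
    have := congrArg (eval ![0, 0, 1, 0]) h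
    simp at this

theorem surfacePoly_prime (ε : k) : Prime (surfacePoly ε) := by
  have h : Prime ((renameEquiv k (Equiv.swap (0 : Fin 5) 2)).trans (finSuccEquiv k 4)
      (surfacePoly ε)) := by
    rw [AlgEquiv.trans_apply, renameEquiv_apply, finSuccEquiv_surfacePoly]
    exact (surfaceCubic_irreducible ε).prime
  exact (MulEquiv.prime_iff ((renameEquiv k (Equiv.swap (0 : Fin 5) 2)).trans
    (finSuccEquiv k 4))).1 h

theorem surfacePoly_not_dvd {ε : k} {P : MvPolynomial (Fin 5) k} {v : Fin 5 → k}
    (hv : eval v (surfacePoly ε) = 0) (hP : eval v P ≠ 0) : ¬ surfacePoly ε ∣ P := by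
  rintro ⟨R, rfl⟩
  simp [hv] at hP

variable [IsAlgClosed k]

/-- This is the Nullstellensatz for the prime ideal generated by the equation. -/
theorem surfacePoly_dvd_of_eval {ε : k} {P : MvPolynomial (Fin 5) k}
    (h : ∀ v, eval v (surfacePoly ε) = 0 → eval v P = 0) : surfacePoly ε ∣ P := by
  have hp := (Ideal.span_singleton_prime (surfacePoly_prime ε).ne_zero).2 (surfacePoly_prime ε)
  rw [← Ideal.mem_span_singleton, ← IsPrime.vanishingIdeal_zeroLocus (K := k) _ (h := hp),
    mem_vanishingIdeal_iff]
  intro v hv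
  rw [mem_zeroLocus_iff] at hv
  rw [aeval_eq_eval]
  apply h v
  have := hv _ (Ideal.mem_span_singleton_self _)
  rwa [aeval_eq_eval] at this

/-- A polynomial that vanishes at the points of the affine part `t₀ z ≠ 0` of the cone where `S`
does not vanish is divisible by the equation, unless `S` is. -/
theorem surfacePoly_dvd {ε : k} {P S : MvPolynomial (Fin 5) k} (hS : ¬ surfacePoly ε ∣ S)
    (h : ∀ v ∈ surfaceCone ε, v 0 ≠ 0 → v 4 ≠ 0 → eval v S ≠ 0 → eval v P = 0) :
    surfacePoly ε ∣ P := by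
  have h04 : ¬ surfacePoly ε ∣ X 0 * X 4 :=
    surfacePoly_not_dvd (v := ![1, 0, 0, 0, 1]) (by simp [eval_surfacePoly]) (by simp)
  -- Multiplying by S t₀ z produces a polynomial that vanishes on the whole hypersurface; primality
  -- of the equation then removes the extra factors.
  have h1 : surfacePoly ε ∣ P * S * (X 0 * X 4) := by
    apply surfacePoly_dvd_of_eval
    intro v hv
    by_cases h0 : v 0 = 0
    · simp [h0]
    by_cases h4 : v 4 = 0
    · simp [h4]
    by_cases hs : eval v S = 0
    · simp [hs]
    simp [h v (mem_surfaceCone.2 ⟨Or.inl h0, Or.inr (Or.inr h4), hv⟩) h0 h4 hs]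
  have h2 := ((surfacePoly_prime ε).dvd_or_dvd h1).resolve_right h04
  exact ((surfacePoly_prime ε).dvd_or_dvd h2).resolve_right hS

end Equation

/-! ### Affine charts of the surface -/

section Charts

variable {k : Type*} [Field k] {ε : k}

/-- The point of the surface with given homogeneous coordinates. -/
abbrev Surface.point (v : surfaceCone ε) : Surface ε := (Surface.coordinates ε).toPoint v

/-- The functions regular at a point of the surface. -/
abbrev Surface.Reg (q : Surface ε) : Subalgebra k (Surface ε → k) :=
  FunctionSheaf.regularAt (k := k) q

/-- Exponents of the first factor of the torus (k*)² on (t₀, t₁, x, y, z). -/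
def weight₁ : Fin 5 → ℕ := ![1, 1, 4, 6, 0]

/-- Exponents of the second factor of the torus. -/
def weight₂ : Fin 5 → ℕ := ![0, 0, 1, 1, 1]

theorem weight_eq (i : Fin 5) : (Surface.coordinates ε).weight i = (weight₁ i, weight₂ i) := by
  fin_cases i <;> rfl

theorem point_eq_iff {v w : surfaceCone ε} : Surface.point v = Surface.point w ↔
    ∃ a b : kˣ, ∀ i, v.1 i = a ^ weight₁ i * b ^ weight₂ i * w.1 i := by
  have : Surface.point v = Surface.point w ↔ (surfaceSetoid ε).r v w := Quotient.eq
  rw [this]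
  constructor
  · rintro ⟨a, b, h0, h1, h2, h3, h4⟩
    refine ⟨a, b, fun i => ?_⟩
    fin_cases i <;> simp [weight₁, weight₂, h0, h1, h2, h3, h4]
  · rintro ⟨a, b, h⟩
    exact ⟨a, b, by simpa [weight₁, weight₂] using h 0, by simpa [weight₁, weight₂] using h 1,
      by simpa [weight₁, weight₂] using h 2, by simpa [weight₁, weight₂] using h 3,
      by simpa [weight₁, weight₂] using h 4⟩

/-- The equation is bihomogeneous of degree (12, 3). -/
theorem smul_mem_surfaceCone {v : Fin 5 → k} (hv : v ∈ surfaceCone ε) {a b : k} (ha : a ≠ 0)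
    (hb : b ≠ 0) : (fun i => a ^ weight₁ i * b ^ weight₂ i * v i) ∈ surfaceCone ε := by
  obtain ⟨h1, h2, h3⟩ := hv
  refine ⟨by simpa [weight₁, weight₂, ha, hb] using h1,
    by simpa [weight₁, weight₂, ha, hb] using h2, ?_⟩
  simp only [weight₁, weight₂, Matrix.cons_val]
  linear_combination a ^ 12 * b ^ 3 * h3

/-- The pairs of coordinates that can be normalised to `1` on an affine chart. -/
structure IsChartPair (a b : Fin 5) : Prop where
  left : a = 0 ∨ a = 1
  right : b = 3 ∨ b = 4

theorem IsChartPair.weights {a b : Fin 5} (h : IsChartPair a b) :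
    weight₁ a = 1 ∧ weight₂ a = 0 ∧ weight₂ b = 1 := by
  obtain ⟨rfl | rfl, rfl | rfl⟩ := h <;> simp [weight₁, weight₂]

/-- Normalisation of the coordinates `a` and `b` to `1`. -/
def normalize (a b : Fin 5) (v : Fin 5 → k) (i : Fin 5) : k :=
  v i * v a ^ (weight₁ b * weight₂ i) / (v a ^ weight₁ i * v b ^ weight₂ i)

/-- Shows that normalising is the action of a torus element: its first component makes the
coordinate `a` equal to 1, and its second one corrects the coordinate `b`, including the change
caused by the first. The definition itself is a single fraction of monomials, as regularity
requires. -/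
theorem normalize_eq (a b : Fin 5) (v : Fin 5 → k) (i : Fin 5) : normalize a b v i =
    (v a)⁻¹ ^ weight₁ i * (v a ^ weight₁ b / v b) ^ weight₂ i * v i := by
  rw [normalize, div_pow, ← pow_mul, inv_pow, div_eq_mul_inv, mul_inv, div_eq_mul_inv]; ring

theorem normalize_mem {a b : Fin 5} {v : Fin 5 → k} (hv : v ∈ surfaceCone ε)
    (ha : v a ≠ 0) (hb : v b ≠ 0) : normalize a b v ∈ surfaceCone ε := by
  rw [show normalize a b v = _ from funext (normalize_eq a b v)]
  exact smul_mem_surfaceCone hv (inv_ne_zero ha) (div_ne_zero (pow_ne_zero _ ha) hb)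

theorem point_normalize {a b : Fin 5} (v : surfaceCone ε) (ha : v.1 a ≠ 0) (hb : v.1 b ≠ 0) :
    Surface.point ⟨_, normalize_mem v.2 ha hb⟩ = Surface.point v := by
  rw [point_eq_iff]
  refine ⟨Units.mk0 _ (inv_ne_zero ha), Units.mk0 _ (div_ne_zero (pow_ne_zero (weight₁ b) ha) hb),
    fun i => ?_⟩
  exact normalize_eq a b v.1 i

theorem normalize_left {a b : Fin 5} (h : IsChartPair a b) {v : Fin 5 → k} (ha : v a ≠ 0) :
    normalize a b v a = 1 := by
  rw [normalize_eq, h.weights.1, h.weights.2.1]; simp [ha]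

theorem normalize_right {a b : Fin 5} (h : IsChartPair a b) {v : Fin 5 → k} (ha : v a ≠ 0)
    (hb : v b ≠ 0) : normalize a b v b = 1 := by
  rw [normalize_eq, h.weights.2.2, inv_pow, pow_one]
  field_simp

theorem normalize_of_eq_one {a b : Fin 5} {v : Fin 5 → k} (ha : v a = 1) (hb : v b = 1) :
    normalize a b v = v := by
  funext i
  simp [normalize, ha, hb]

/-- Nonvanishing of `w a` and `w b` is not assumed: the values given by division by zero are
invariant too. Hence `chartCoord` is described by one fraction on all representatives of all points.
-/
theorem normalize_smul {a b : Fin 5} (h : IsChartPair a b) (v w : Fin 5 → k) (α β : kˣ)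
    (hvw : ∀ i, v i = α ^ weight₁ i * β ^ weight₂ i * w i) :
    normalize a b v = normalize a b w := by
  obtain ⟨h1, h2, h3⟩ := h.weights
  funext i
  have hα := α.ne_zero
  have hβ := β.ne_zero
  rw [normalize_eq, normalize_eq, hvw i, hvw a, hvw b, h1, h2, h3]
  have e1 : ((α : k) ^ 1 * β ^ 0 * w a)⁻¹ = (α : k)⁻¹ * (w a)⁻¹ := by simp [mul_comm]
  have e2 : ((α : k) ^ 1 * β ^ 0 * w a) ^ weight₁ b / (α ^ weight₁ b * β ^ 1 * w b) =
      (β : k)⁻¹ * (w a ^ weight₁ b / w b) := by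
    rw [pow_one, pow_zero, mul_one, pow_one, mul_pow]
    field_simp
  rw [e1, e2, mul_pow, mul_pow]
  have e3 : (α : k)⁻¹ ^ weight₁ i * α ^ weight₁ i = 1 := by
    rw [← mul_pow, inv_mul_cancel₀ hα, one_pow]
  have e4 : (β : k)⁻¹ ^ weight₂ i * β ^ weight₂ i = 1 := by
    rw [← mul_pow, inv_mul_cancel₀ hβ, one_pow]
  linear_combination ((w a)⁻¹ ^ weight₁ i * (w a ^ weight₁ b / w b) ^ weight₂ i * w i) *
    ((β : k)⁻¹ ^ weight₂ i * β ^ weight₂ i * e3 + e4)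

/-- The affine coordinate functions of the chart where the coordinates `a` and `b` do not
vanish. -/
def chartCoord (ε : k) (a b i : Fin 5) (q : Surface ε) : k :=
  normalize a b (Quotient.out q : surfaceCone ε).1 i

theorem chartCoord_point {a b : Fin 5} (h : IsChartPair a b) (i : Fin 5) (v : surfaceCone ε) :
    chartCoord ε a b i (Surface.point v) = normalize a b v.1 i := by
  obtain ⟨α, β, hαβ⟩ := point_eq_iff.1
    (show Surface.point (Quotient.out (Surface.point v)) = Surface.point v from Quotient.out_eq _)
  rw [chartCoord, normalize_smul h _ _ α β hαβ]

theorem chartCoord_mem {a b : Fin 5} (h : IsChartPair a b) (i : Fin 5) (v : surfaceCone ε)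
    (ha : v.1 a ≠ 0) (hb : v.1 b ≠ 0) : chartCoord ε a b i ∈ Surface.Reg (Surface.point v) := by
  refine ((Surface.coordinates ε).isRegularAt_iff v).2 ⟨(weight₁ i + weight₁ b * weight₂ i,
    weight₂ i), X i * X a ^ (weight₁ b * weight₂ i), X a ^ weight₁ i * X b ^ weight₂ i, ?_, ?_, ?_,
    ?_⟩
  · have := (isWeightedHomogeneous_X k (Surface.coordinates ε).weight i).mul
      ((isWeightedHomogeneous_X k (Surface.coordinates ε).weight a).pow (weight₁ b * weight₂ i))
    convert this using 1
    rw [weight_eq, weight_eq, h.weights.1, h.weights.2.1]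
    ext <;> simp
  · have := ((isWeightedHomogeneous_X k (Surface.coordinates ε).weight a).pow (weight₁ i)).mul
      ((isWeightedHomogeneous_X k (Surface.coordinates ε).weight b).pow (weight₂ i))
    convert this using 1
    rw [weight_eq, weight_eq, h.weights.1, h.weights.2.1, h.weights.2.2]
    ext <;> simp [mul_comm]
  · simp [ha, hb]
  · intro w _
    exact (chartCoord_point h i w).trans (by simp [normalize])

theorem eventually_point_iff {p : Surface ε → Prop} (v : surfaceCone ε) :
    (∀ᶠ y in nhds (Surface.point v), p y) ↔ ∃ (d : ℕ × ℕ) (B : MvPolynomial (Fin 5) k),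
      IsWeightedHomogeneous (Surface.coordinates ε).weight B d ∧ eval v.1 B ≠ 0 ∧
        ∀ w : surfaceCone ε, eval w.1 B ≠ 0 → p (Surface.point w) :=
  (Surface.coordinates ε).eventually_iff v

theorem eventually_ne_zero (v : surfaceCone ε) (i : Fin 5) (hi : v.1 i ≠ 0) :
    ∀ᶠ q in nhds (Surface.point v), ∀ w : surfaceCone ε, Surface.point w = q → w.1 i ≠ 0 := by
  refine (eventually_point_iff v).2 ⟨_, X i, isWeightedHomogeneous_X k _ i, by simpa using hi,
    fun w hw w' hw' h0 => hw ?_⟩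
  obtain ⟨α, β, hαβ⟩ := point_eq_iff.1 hw'.symm
  rw [eval_X, hαβ i, h0, mul_zero]

end Charts

/-! ## Differentials -/

section Differentials

variable {k : Type*} [Field k] {ε : k}

/-- The derivative of `P` at `v` in the direction `u`. -/
def dirDeriv (v u : Fin 5 → k) (P : MvPolynomial (Fin 5) k) : k :=
  ∑ m, eval v (pderiv m P) * u m

theorem dirDeriv_add (v u : Fin 5 → k) (P Q : MvPolynomial (Fin 5) k) :
    dirDeriv v u (P + Q) = dirDeriv v u P + dirDeriv v u Q := by
  simp [dirDeriv, add_mul, Finset.sum_add_distrib]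

theorem dirDeriv_sub (v u : Fin 5 → k) (P Q : MvPolynomial (Fin 5) k) :
    dirDeriv v u (P - Q) = dirDeriv v u P - dirDeriv v u Q := by
  simp [dirDeriv, sub_mul]

theorem dirDeriv_mul (v u : Fin 5 → k) (P Q : MvPolynomial (Fin 5) k) :
    dirDeriv v u (P * Q) = eval v P * dirDeriv v u Q + eval v Q * dirDeriv v u P := by
  simp only [dirDeriv, pderiv_mul, map_add, map_mul, add_mul, Finset.sum_add_distrib,
    Finset.mul_sum]
  rw [add_comm]
  congr 1 <;> exact Finset.sum_congr rfl fun _ _ => by ring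

theorem dirDeriv_C (v u : Fin 5 → k) (c : k) : dirDeriv v u (C c) = 0 := by simp [dirDeriv]

/-- The function `f` is the quotient `A / B` where `B` does not vanish. -/
def IsQuotient (f : Surface ε → k) (A B : MvPolynomial (Fin 5) k) : Prop :=
  ∀ w : surfaceCone ε, eval w.1 B ≠ 0 → f (Surface.point w) = eval w.1 A / eval w.1 B

/-- The gradient of the rational function `A / B`. -/
def ratGrad (A B : MvPolynomial (Fin 5) k) (v : Fin 5 → k) (m : Fin 5) : k :=
  (eval v (pderiv m A) * eval v B - eval v A * eval v (pderiv m B)) / eval v B ^ 2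

theorem sum_ratGrad_mul (A B : MvPolynomial (Fin 5) k) (v u : Fin 5 → k) :
    ∑ m, ratGrad A B v m * u m =
      (dirDeriv v u A * eval v B - eval v A * dirDeriv v u B) / eval v B ^ 2 := by
  simp only [ratGrad, dirDeriv, Finset.mul_sum, Finset.sum_mul, ← Finset.sum_sub_distrib,
    Finset.sum_div]
  exact Finset.sum_congr rfl fun _ _ => by ring

/-- The components of a tangent vector in a chart. -/
def component {a b : Fin 5} (h : IsChartPair a b) (v : surfaceCone ε) (ha : v.1 a ≠ 0)
    (hb : v.1 b ≠ 0) (D : tangentSpace k (Surface.point v)) (i : Fin 5) : k :=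
  D.1 ⟨chartCoord ε a b i, chartCoord_mem h i v ha hb⟩

theorem aeval_apply {x : Surface ε} (c : Fin 5 → Surface.Reg x) (P : MvPolynomial (Fin 5) k)
    (q : Surface ε) : (aeval c P).1 q = eval (fun i => (c i).1 q) P := by
  induction P using MvPolynomial.induction_on with
  | C a => simp
  | add p q hp hq => simp [hp, hq]
  | mul_X p i hp => simp [hp]

/-- Near the point, f · B(c) = A(c) where c are the chart coordinates. The Leibniz and chain rules
for this relation determine the value of D at f: it is the quotient rule. -/
theorem tangent_eq_sum {a b : Fin 5} (h : IsChartPair a b) (v : surfaceCone ε) (ha : v.1 a = 1)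
    (hb : v.1 b = 1) (ha' : v.1 a ≠ 0) (hb' : v.1 b ≠ 0)
    (D : tangentSpace k (Surface.point v)) (f : Surface.Reg (Surface.point v))
    {A B : MvPolynomial (Fin 5) k} {d : ℕ × ℕ}
    (hB : IsWeightedHomogeneous (Surface.coordinates ε).weight B d)
    (hf : IsQuotient f.1 A B) (hBv : eval v.1 B ≠ 0) :
    D.1 f = ∑ m, ratGrad A B v.1 m * component h v ha' hb' D m := by
  set c : Fin 5 → Surface.Reg (Surface.point v) :=
    fun i => ⟨chartCoord ε a b i, chartCoord_mem h i v ha' hb'⟩ with hc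
  have hcv : (fun i => (c i).1 (Surface.point v)) = v.1 := by
    funext i
    simp only [hc]
    rw [chartCoord_point h, normalize_of_eq_one ha hb]
  have heq : ∀ᶠ q in nhds (Surface.point v), (f * aeval c B).1 q = (aeval c A).1 q := by
    filter_upwards [(eventually_point_iff (p := fun q => ∃ w : surfaceCone ε, Surface.point w = q ∧
      eval w.1 B ≠ 0) v).2 ⟨d, B, hB, hBv, fun w hw => ⟨w, rfl, hw⟩⟩,
      eventually_ne_zero v a ha', eventually_ne_zero v b hb']
    rintro q ⟨w, rfl, hwB⟩ hwa hwb
    replace hwa := hwa w rfl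
    replace hwb := hwb w rfl
    have hcw : (fun i => (c i).1 (Surface.point w)) = normalize a b w.1 := by
      funext i
      exact chartCoord_point h i w
    have hp := point_normalize w hwa hwb
    have hB' : eval (normalize a b w.1) B ≠ 0 :=
      (Surface.coordinates ε).ne_zero B d hB w ⟨_, normalize_mem w.2 hwa hwb⟩ hp.symm hwB
    have := hf ⟨_, normalize_mem w.2 hwa hwb⟩ hB'
    rw [hp] at this
    change f.1 _ * (aeval c B).1 _ = _
    rw [aeval_apply, aeval_apply, hcw, this]
    exact div_mul_cancel₀ _ hB'
  have h1 := tangent_eq_of_eventuallyEq D _ _ heq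
  rw [D.2, tangent_aeval, tangent_aeval, aeval_apply, hcv, hf v hBv] at h1
  rw [sum_ratGrad_mul, eq_div_iff (pow_ne_zero 2 hBv)]
  change _ * dirDeriv v.1 (component h v ha' hb' D) B + _ =
    dirDeriv v.1 (component h v ha' hb' D) A at h1
  rw [← h1]
  field_simp
  ring

/-- The chart coordinates satisfy the equation near the point, so the chain rule makes the component
vector tangent to the cone. -/
theorem dirDeriv_component {a b : Fin 5} (h : IsChartPair a b) (v : surfaceCone ε)
    (ha : v.1 a = 1) (hb : v.1 b = 1) (ha' : v.1 a ≠ 0) (hb' : v.1 b ≠ 0)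
    (D : tangentSpace k (Surface.point v)) :
    dirDeriv v.1 (component h v ha' hb' D) (surfacePoly ε) = 0 := by
  set c : Fin 5 → Surface.Reg (Surface.point v) :=
    fun i => ⟨chartCoord ε a b i, chartCoord_mem h i v ha' hb'⟩ with hc
  have hcv : (fun i => (c i).1 (Surface.point v)) = v.1 := by
    funext i
    simp only [hc]
    rw [chartCoord_point h, normalize_of_eq_one ha hb]
  have heq : ∀ᶠ q in nhds (Surface.point v), (aeval c (surfacePoly ε)).1 q =
      (0 : Surface.Reg (Surface.point v)).1 q := by
    filter_upwards [eventually_ne_zero v a ha', eventually_ne_zero v b hb']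
    intro q hwa hwb
    obtain ⟨w, rfl⟩ := (Surface.coordinates ε).surjective q
    replace hwa := hwa w rfl
    replace hwb := hwb w rfl
    have hcw : (fun i => (c i).1 (Surface.point w)) = normalize a b w.1 := by
      funext i
      exact chartCoord_point h i w
    rw [aeval_apply, hcw]
    exact (mem_surfaceCone.1 (normalize_mem w.2 hwa hwb)).2.2
  have h1 := tangent_eq_of_eventuallyEq D _ _ heq
  rw [tangent_aeval, hcv, map_zero] at h1
  exact h1

/-- The two normalised coordinates are constantly 1 near the point. -/
theorem component_eq_zero {a b : Fin 5} (h : IsChartPair a b) (v : surfaceCone ε)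
    (ha' : v.1 a ≠ 0) (hb' : v.1 b ≠ 0) (D : tangentSpace k (Surface.point v)) :
    component h v ha' hb' D a = 0 ∧ component h v ha' hb' D b = 0 := by
  have key : ∀ i, (∀ w : surfaceCone ε, w.1 a ≠ 0 → w.1 b ≠ 0 → normalize a b w.1 i = 1) →
      component h v ha' hb' D i = 0 := by
    intro i hi
    have heq : ∀ᶠ q in nhds (Surface.point v), (⟨chartCoord ε a b i, chartCoord_mem h i v ha' hb'⟩ :
        Surface.Reg (Surface.point v)).1 q =
        (algebraMap k (Surface.Reg (Surface.point v)) 1).1 q := by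
      filter_upwards [eventually_ne_zero v a ha', eventually_ne_zero v b hb']
      intro q hwa hwb
      obtain ⟨w, rfl⟩ := (Surface.coordinates ε).surjective q
      replace hwa := hwa w rfl
      replace hwb := hwb w rfl
      refine (chartCoord_point h i w).trans ((hi w hwa hwb).trans ?_)
      simp
    rw [component, tangent_eq_of_eventuallyEq D _ _ heq, tangent_algebraMap]
  exact ⟨key a fun w hwa _ => normalize_left h hwa,
    key b fun w hwa hwb => normalize_right h hwa hwb⟩


variable [IsAlgClosed k]

/-- The equation divides BB'(AB' - A'B). Differentiating in a direction tangent to the cone kills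
this product, and since AB' - A'B vanishes at v while BB' does not, the derivative of AB' - A'B
vanishes as well. -/
theorem ratGrad_unique {f : Surface ε → k} {A B A' B' : MvPolynomial (Fin 5) k}
    (hf : IsQuotient f A B) (hf' : IsQuotient f A' B') (v : surfaceCone ε) (u : Fin 5 → k)
    (hu : dirDeriv v.1 u (surfacePoly ε) = 0) (hB : eval v.1 B ≠ 0) (hB' : eval v.1 B' ≠ 0) :
    ∑ m, ratGrad A B v.1 m * u m = ∑ m, ratGrad A' B' v.1 m * u m := by
  have hdvd : surfacePoly ε ∣ B * B' * (A * B' - A' * B) := by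
    refine surfacePoly_dvd (S := 1) (surfacePoly_prime ε).not_dvd_one ?_
    intro w hw _ _ _
    by_cases h1 : eval w B = 0
    · simp [h1]
    by_cases h2 : eval w B' = 0
    · simp [h2]
    have h3 := hf ⟨w, hw⟩ h1
    rw [hf' ⟨w, hw⟩ h2, div_eq_div_iff h2 h1] at h3
    simp [h3]
  obtain ⟨R, hR⟩ := hdvd
  have hv0 : eval v.1 (A * B' - A' * B) = 0 := by
    have h3 := hf v hB
    rw [hf' v hB', div_eq_div_iff hB' hB] at h3
    simp [h3]
  have h4 := congrArg (dirDeriv v.1 u) hR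
  rw [dirDeriv_mul _ _ (surfacePoly ε), hu, (mem_surfaceCone.1 v.2).2.2, dirDeriv_mul, hv0,
    zero_mul, zero_mul, mul_zero, add_zero, add_zero] at h4
  have h5 := (mul_eq_zero.1 h4).resolve_left (by simp [hB, hB'])
  rw [dirDeriv_sub, dirDeriv_mul, dirDeriv_mul] at h5
  simp only [map_sub, map_mul] at hv0
  rw [sum_ratGrad_mul, sum_ratGrad_mul, div_eq_div_iff (pow_ne_zero 2 hB) (pow_ne_zero 2 hB')]
  linear_combination eval v.1 B * eval v.1 B' * h5 -
    (dirDeriv v.1 u B * eval v.1 B' + eval v.1 B * dirDeriv v.1 u B') * hv0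

/-- Vectors tangent to the cone give tangent vectors of the surface. -/
theorem exists_tangent (v : surfaceCone ε) (u : Fin 5 → k)
    (hu : dirDeriv v.1 u (surfacePoly ε) = 0) :
    ∃ D : tangentSpace k (Surface.point v), ∀ (f : Surface.Reg (Surface.point v))
      (A B : MvPolynomial (Fin 5) k), IsQuotient f.1 A B → eval v.1 B ≠ 0 →
        D.1 f = ∑ m, ratGrad A B v.1 m * u m := by
  have hrep : ∀ f : Surface.Reg (Surface.point v), ∃ A B : MvPolynomial (Fin 5) k,
      IsQuotient f.1 A B ∧ eval v.1 B ≠ 0 := by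
    intro f
    obtain ⟨d, A, B, -, -, hBv, h⟩ := ((Surface.coordinates ε).isRegularAt_iff v).1 f.2
    exact ⟨A, B, h, hBv⟩
  choose A B hAB hBv using hrep
  -- The chosen fractions are arbitrary, but the value may be computed from any other fraction;
  -- linearity and the Leibniz rule then follow by taking common denominators.
  have huniq : ∀ (f : Surface.Reg (Surface.point v)) (A' B' : MvPolynomial (Fin 5) k),
      IsQuotient f.1 A' B' → eval v.1 B' ≠ 0 → ∑ m, ratGrad (A f) (B f) v.1 m * u m =
        (dirDeriv v.1 u A' * eval v.1 B' - eval v.1 A' * dirDeriv v.1 u B') / eval v.1 B' ^ 2 := by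
    intro f A' B' h h'
    rw [ratGrad_unique (hAB f) h v u hu (hBv f) h', sum_ratGrad_mul]
  refine ⟨⟨{ toFun := fun f => ∑ m, ratGrad (A f) (B f) v.1 m * u m
             map_add' := ?_
             map_smul' := ?_ }, ?_⟩, ?_⟩
  · intro f g
    rw [huniq (f + g) (A f * B g + A g * B f) (B f * B g), huniq f _ _ (hAB f) (hBv f),
      huniq g _ _ (hAB g) (hBv g)]
    · have h1 := hBv f
      have h2 := hBv g
      simp only [dirDeriv_add, dirDeriv_mul, map_add, map_mul]
      field_simp
      ring
    · intro w hw
      simp only [map_mul, ne_eq, mul_eq_zero, not_or] at hw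
      change f.1 _ + g.1 _ = _
      rw [hAB f w hw.1, hAB g w hw.2, div_add_div _ _ hw.1 hw.2]
      simp only [map_add, map_mul]
      ring
    · simp [hBv f, hBv g]
  · intro c f
    rw [huniq (c • f) (C c * A f) (B f) _ (hBv f), huniq f _ _ (hAB f) (hBv f)]
    · simp only [dirDeriv_mul, dirDeriv_C, map_mul, eval_C, smul_eq_mul, RingHom.id_apply]
      ring
    · intro w hw
      change c • f.1 _ = _
      rw [hAB f w hw]
      simp [mul_div_assoc]
  · intro f g
    change ∑ m, ratGrad (A (f * g)) (B (f * g)) v.1 m * u m =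
      f.1 _ * ∑ m, ratGrad (A g) (B g) v.1 m * u m + g.1 _ * ∑ m, ratGrad (A f) (B f) v.1 m * u m
    rw [huniq (f * g) (A f * A g) (B f * B g), huniq f _ _ (hAB f) (hBv f),
      huniq g _ _ (hAB g) (hBv g), hAB f v (hBv f), hAB g v (hBv g)]
    · have h1 := hBv f
      have h2 := hBv g
      simp only [dirDeriv_mul, map_mul]
      field_simp
      ring
    · intro w hw
      simp only [map_mul, ne_eq, mul_eq_zero, not_or] at hw
      change f.1 _ * g.1 _ = _
      rw [hAB f w hw.1, hAB g w hw.2, div_mul_div_comm]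
      simp only [map_mul]
    · simp [hBv f, hBv g]
  · intro f A' B' h h'
    exact ratGrad_unique (hAB f) h v u hu (hBv f) h'

end Differentials

/-! ## Rational functions on subsets of the cone -/

section Rational

variable {k : Type*} [Field k] {ε : k}

/-- `F` agrees on `W` with a rational function whose denominator does not vanish at `v`. -/
def IsRatAt (W : Set (surfaceCone ε)) (v : Fin 5 → k) (F : surfaceCone ε → k) : Prop :=
  ∃ A B : MvPolynomial (Fin 5) k, eval v B ≠ 0 ∧ ∀ w ∈ W, F w * eval w.1 B = eval w.1 A

variable {W : Set (surfaceCone ε)} {v : Fin 5 → k} {F G : surfaceCone ε → k}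

theorem IsRatAt.add (hF : IsRatAt W v F) (hG : IsRatAt W v G) : IsRatAt W v (F + G) := by
  obtain ⟨A, B, hB, h⟩ := hF
  obtain ⟨A', B', hB', h'⟩ := hG
  refine ⟨A * B' + A' * B, B * B', by simp [hB, hB'], fun w hw => ?_⟩
  simp only [Pi.add_apply, map_add, map_mul, ← h w hw, ← h' w hw]
  ring

theorem IsRatAt.mul (hF : IsRatAt W v F) (hG : IsRatAt W v G) : IsRatAt W v (F * G) := by
  obtain ⟨A, B, hB, h⟩ := hF
  obtain ⟨A', B', hB', h'⟩ := hG
  refine ⟨A * A', B * B', by simp [hB, hB'], fun w hw => ?_⟩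
  simp only [Pi.mul_apply, map_mul, ← h w hw, ← h' w hw]
  ring

theorem isRatAt_eval (P : MvPolynomial (Fin 5) k) : IsRatAt W v (fun w => eval w.1 P) :=
  ⟨P, 1, by simp, fun w _ => by simp⟩

theorem isRatAt_const (c : k) : IsRatAt W v (fun _ => c) :=
  ⟨C c, 1, by simp, fun w _ => by simp⟩

theorem IsRatAt.neg (hF : IsRatAt W v F) : IsRatAt W v (-F) := by
  have := (isRatAt_const (W := W) (v := v) (-1 : k)).mul hF
  convert this using 1
  funext w
  simp

theorem IsRatAt.sub (hF : IsRatAt W v F) (hG : IsRatAt W v G) : IsRatAt W v (F - G) := by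
  rw [sub_eq_add_neg]; exact hF.add hG.neg

theorem IsRatAt.sum {ι : Type*} (s : Finset ι) (f : ι → surfaceCone ε → k)
    (h : ∀ i ∈ s, IsRatAt W v (f i)) : IsRatAt W v (fun w => ∑ i ∈ s, f i w) := by
  classical
  induction s using Finset.induction_on with
  | empty => simpa using isRatAt_const (W := W) (v := v) (0 : k)
  | insert i s hi ih =>
    simp only [Finset.sum_insert hi]
    exact (h i (Finset.mem_insert_self i s)).add (ih fun j hj => h j (Finset.mem_insert_of_mem hj))

theorem isRatAt_div (A B : MvPolynomial (Fin 5) k) (hB : eval v B ≠ 0) :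
    IsRatAt W v (fun w => eval w.1 A / eval w.1 B) := by
  -- The factor B makes both sides vanish where the quotient is a division by zero.
  refine ⟨A * B, B * B, by simp [hB], fun w _ => ?_⟩
  by_cases h : eval w.1 B = 0
  · simp [h]
  · simp only [map_mul]; field_simp

theorem isRatAt_ratGrad (A B : MvPolynomial (Fin 5) k) (hB : eval v B ≠ 0) (m : Fin 5) :
    IsRatAt W v (fun w => ratGrad A B w.1 m) := by
  have := isRatAt_div (W := W) (pderiv m A * B - A * pderiv m B) (B ^ 2) (v := v) (by simp [hB])
  simpa [ratGrad] using this

/-- Agreement outside the zeros of B is enough: multiplying numerator and denominator by B makes the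
relation trivial at those zeros. -/
theorem IsRatAt.congr {B : MvPolynomial (Fin 5) k} (hB : eval v B ≠ 0) (hG : IsRatAt W v G)
    (h : ∀ w ∈ W, eval w.1 B ≠ 0 → F w = G w) : IsRatAt W v F := by
  obtain ⟨A', B', hB', h'⟩ := hG
  refine ⟨A' * B, B' * B, by simp [hB, hB'], fun w hw => ?_⟩
  by_cases h0 : eval w.1 B = 0
  · simp [h0]
  · simp only [map_mul, h w hw h0, ← h' w hw]; ring

/-- A function that is rational without poles everywhere is a polynomial. -/
theorem exists_eval_of_isRatAt [IsAlgClosed k] (h : ∀ v, IsRatAt W v F) :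
    ∃ P : MvPolynomial (Fin 5) k, ∀ w ∈ W, F w = eval w.1 P := by
  -- The ideal of denominators of F. By assumption it has no zero, so by the Nullstellensatz it
  -- contains 1.
  let I : Ideal (MvPolynomial (Fin 5) k) :=
    { carrier := {B | ∃ A : MvPolynomial (Fin 5) k, ∀ w ∈ W, F w * eval w.1 B = eval w.1 A}
      add_mem' := by
        rintro B B' ⟨A, hA⟩ ⟨A', hA'⟩
        exact ⟨A + A', fun w hw => by rw [map_add, map_add, mul_add, hA w hw, hA' w hw]⟩
      zero_mem' := ⟨0, fun w _ => by simp⟩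
      smul_mem' := by
        rintro C B ⟨A, hA⟩
        exact ⟨C * A, fun w hw => by
          rw [smul_eq_mul, map_mul, map_mul, ← hA w hw]; ring⟩ }
  have h0 : zeroLocus k I = ∅ := by
    rw [Set.eq_empty_iff_forall_notMem]
    intro v hv
    obtain ⟨A, B, hB, hAB⟩ := h v
    have := (mem_zeroLocus_iff.1 hv) B ⟨A, hAB⟩
    rw [aeval_eq_eval] at this
    exact hB this
  have h1 : (1 : MvPolynomial (Fin 5) k) ∈ I.radical := by
    rw [← vanishingIdeal_zeroLocus_eq_radical (K := k), h0, vanishingIdeal_empty]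
    trivial
  obtain ⟨n, hn⟩ := h1
  rw [one_pow] at hn
  obtain ⟨A, hA⟩ := hn
  exact ⟨A, fun w hw => by simpa using hA w hw⟩

end Rational

/-! ## Homogenization -/

section Homogenization

variable {k : Type*} [Field k]

/-- Powers of the coordinates `a` and `b` clear the denominators of the normalisation. Both
exponents stay free above a bound, so that summands can be given the same degree and different
charts a common exponent. -/
theorem exists_homogenization {a b : Fin 5} (h : IsChartPair a b) (ε : k)
    (P : MvPolynomial (Fin 5) k) : ∃ r : ℕ, ∀ m n : ℕ, r ≤ m → r ≤ n →
      ∃ Q : MvPolynomial (Fin 5) k, IsWeightedHomogeneous (Surface.coordinates ε).weight Q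
        (m + weight₁ b * n, n) ∧
      (∀ v, v a ≠ 0 → v b ≠ 0 → eval v Q = eval (normalize a b v) P * v a ^ m * v b ^ n) ∧
      (∀ v, v a = 0 ∨ v b = 0 → eval v Q = 0) := by
  obtain ⟨h1, h2, h3⟩ := h.weights
  have hX := isWeightedHomogeneous_X k (Surface.coordinates ε).weight
  induction P using MvPolynomial.induction_on with
  | C c =>
    -- The bound 1, rather than 0, makes the form vanish where the coordinate `a` or `b` does.
    refine ⟨1, fun m n hm hn => ⟨C c * (X a ^ m * X b ^ n), ?_, ?_, ?_⟩⟩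
    · have := (((hX a).pow m).mul ((hX b).pow n)).C_mul c
      convert this using 1
      rw [weight_eq, weight_eq, h1, h2, h3]
      ext <;> simp [mul_comm]
    · intro v _ _
      simp only [map_mul, eval_C, map_pow, eval_X]; ring
    · rintro v (hv | hv) <;> simp [hv] <;> omega
  | add p q hp hq =>
    obtain ⟨r, hr⟩ := hp
    obtain ⟨r', hr'⟩ := hq
    refine ⟨max r r', fun m n hm hn => ?_⟩
    obtain ⟨Q, hQ, hQ1, hQ2⟩ := hr m n (by omega) (by omega)
    obtain ⟨Q', hQ', hQ1', hQ2'⟩ := hr' m n (by omega) (by omega)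
    refine ⟨Q + Q', hQ.add hQ', fun v ha hb => ?_, fun v hv => ?_⟩
    · rw [map_add, hQ1 v ha hb, hQ1' v ha hb, map_add]; ring
    · rw [map_add, hQ2 v hv, hQ2' v hv, add_zero]
  | mul_X p i hp =>
    obtain ⟨r, hr⟩ := hp
    refine ⟨r + weight₁ i + weight₂ i, fun m n hm hn => ?_⟩
    obtain ⟨m', rfl⟩ : ∃ m', m = m' + weight₁ i := ⟨m - weight₁ i, by omega⟩
    obtain ⟨n', rfl⟩ : ∃ n', n = n' + weight₂ i := ⟨n - weight₂ i, by omega⟩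
    obtain ⟨Q, hQ, hQ1, hQ2⟩ := hr m' n' (by omega) (by omega)
    refine ⟨Q * (X i * X a ^ (weight₁ b * weight₂ i)), ?_, fun v ha hb => ?_, fun v hv => ?_⟩
    · have := hQ.mul ((hX i).mul ((hX a).pow (weight₁ b * weight₂ i)))
      convert this using 1
      rw [weight_eq, weight_eq, h1, h2]
      ext
      · simp; ring
      · simp
    · rw [map_mul, hQ1 v ha hb, map_mul, map_mul, map_pow, eval_X, eval_X, eval_X, normalize,
        pow_add, pow_add]
      have e1 := pow_ne_zero (weight₁ i) ha
      have e2 := pow_ne_zero (weight₂ i) hb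
      field_simp
    · rw [map_mul, hQ2 v hv, zero_mul]

theorem normalize_ne_zero {a b i : Fin 5} {v : Fin 5 → k} (ha : v a ≠ 0) (hb : v b ≠ 0)
    (hi : v i ≠ 0) : normalize a b v i ≠ 0 :=
  div_ne_zero (mul_ne_zero hi (pow_ne_zero _ ha)) (mul_ne_zero (pow_ne_zero _ ha)
    (pow_ne_zero _ hb))

/-- On an affine chart, a polynomial that vanishes on the points with `t₀ z ≠ 0` of a neighbourhood
of a point vanishes at this point. -/
theorem eval_eq_zero_of_generic [IsAlgClosed k] {ε : k} {a b : Fin 5} (h : IsChartPair a b)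
    (v : surfaceCone ε) (ha : v.1 a = 1) (hb : v.1 b = 1) {P B : MvPolynomial (Fin 5) k}
    (hB : eval v.1 B ≠ 0)
    (hP : ∀ w : surfaceCone ε, w.1 a = 1 → w.1 b = 1 → w.1 0 ≠ 0 → w.1 4 ≠ 0 → eval w.1 B ≠ 0 →
      eval w.1 P = 0) : eval v.1 P = 0 := by
  obtain ⟨r, hr⟩ := exists_homogenization h ε P
  obtain ⟨r', hr'⟩ := exists_homogenization h ε B
  obtain ⟨Q, -, hQ1, hQ2⟩ := hr r r le_rfl le_rfl
  obtain ⟨R, -, hR1, hR2⟩ := hr' r' r' le_rfl le_rfl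
  have ha' : v.1 a ≠ 0 := by simp [ha]
  have hb' : v.1 b ≠ 0 := by simp [hb]
  have hΦ := (mem_surfaceCone.1 v.2).2.2
  -- The homogenisation of P vanishes at the points of the cone with t₀ z ≠ 0 outside the zeros of
  -- that of B, and irreducibility extends this to the whole cone.
  have hdvd : surfacePoly ε ∣ Q := by
    refine surfacePoly_dvd (S := R) (surfacePoly_not_dvd hΦ ?_) ?_
    · rw [hR1 v.1 ha' hb', normalize_of_eq_one ha hb, ha, hb]
      simpa using hB
    · intro w hw h0 h4 hRw
      by_cases hwa : w a = 0
      · exact hQ2 w (Or.inl hwa)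
      by_cases hwb : w b = 0
      · exact hQ2 w (Or.inr hwb)
      rw [hQ1 w hwa hwb, hP ⟨_, normalize_mem hw hwa hwb⟩ (normalize_left h hwa)
        (normalize_right h hwa hwb) (normalize_ne_zero hwa hwb h0) (normalize_ne_zero hwa hwb h4),
        zero_mul, zero_mul]
      intro h0
      rw [hR1 w hwa hwb, h0] at hRw
      simp at hRw
  obtain ⟨T, rfl⟩ := hdvd
  have := hQ1 v.1 ha' hb'
  rw [normalize_of_eq_one ha hb, ha, hb, map_mul, hΦ] at this
  simpa using this.symm

end Homogenization

/-! ## Functions without poles are constant -/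

section Constant

variable {k : Type*} [Field k] {ε : k}

theorem weight_degree (s : Fin 5 →₀ ℕ) : Finsupp.weight (Surface.coordinates ε).weight s =
    (s 0 + s 1 + 4 * s 2 + 6 * s 3, s 2 + s 3 + s 4) := by
  rw [Finsupp.weight_apply, Finsupp.sum_fintype _ _ (by simp)]
  simp only [weight_eq, Fin.sum_univ_five, weight₁, weight₂]
  ext
  · simp; ring
  · simp

/-- Every variable has positive weight for the sum of the two gradings, so a bigraded piece lies in
a finite-dimensional piece of a single grading. -/
theorem homogeneous_fg (d : ℕ × ℕ) :
    Module.Finite k (weightedHomogeneousSubmodule k (Surface.coordinates ε).weight d) := by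
  have hw : ∀ i : Fin 5, (weight₁ + weight₂) i ≠ 0 := by decide
  have hle : weightedHomogeneousSubmodule k (Surface.coordinates ε).weight d ≤
      weightedHomogeneousSubmodule k (weight₁ + weight₂) (d.1 + d.2) := by
    intro P hP
    have := IsWeightedHomogeneous.map_weight (AddMonoidHom.fst ℕ ℕ + AddMonoidHom.snd ℕ ℕ) hP
    simp only [weight_eq] at this
    exact this
  have : Module.Finite k (weightedHomogeneousSubmodule k (weight₁ + weight₂) (d.1 + d.2)) :=
    Module.Finite.iff_fg.2 (weightedHomogeneousSubmodule_fg k _ hw _)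
  exact Module.Finite.of_injective (Submodule.inclusion hle) (Submodule.inclusion_injective hle)

/-- F becomes a form after multiplication by t^r y^r or t^r z^r with t one of t₀, t₁, so it suffices
to find such a factor in every monomial of degree (32r, 5r). The variables x, y, z occur 5r times in
total and take up at most 30r of the first degree, so t₀ and t₁ occur at least 2r times, one of them
at least r times. If y and z both occur fewer than r times, then x occurs more than 3r times, and
the relation x³ = zΨ on the cone supplies z^r. -/
theorem exists_mul_homogeneous {C₀ : Set (surfaceCone ε)} {F : surfaceCone ε → k} {r : ℕ}
    (Q : Fin 5 → Fin 5 → MvPolynomial (Fin 5) k)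
    (hQ : ∀ a b, IsChartPair a b → IsWeightedHomogeneous (Surface.coordinates ε).weight (Q a b)
      (r + weight₁ b * r, r))
    (hFQ : ∀ a b, IsChartPair a b → ∀ w ∈ C₀, F w * w.1 a ^ r * w.1 b ^ r = eval w.1 (Q a b))
    {P : MvPolynomial (Fin 5) k}
    (hP : IsWeightedHomogeneous (Surface.coordinates ε).weight P (32 * r, 5 * r)) :
    ∃ P', IsWeightedHomogeneous (Surface.coordinates ε).weight P' (32 * r, 5 * r) ∧
      ∀ w ∈ C₀, F w * eval w.1 P = eval w.1 P' := by
  have hX := isWeightedHomogeneous_X k (Surface.coordinates ε).weight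
  let Ψ : MvPolynomial (Fin 5) k :=
    -(X 3 ^ 2 + C ε * X 2 ^ 2 * X 0 ^ 4 + (X 1 ^ 11 * X 0 - X 0 ^ 11 * X 1) * X 4 ^ 2)
  have hΨ : IsWeightedHomogeneous (Surface.coordinates ε).weight Ψ (12, 2) := by
    refine (((hX 3).pow 2).add ?_ |>.add ?_).neg
    · rw [mul_assoc]
      exact (((hX 2).pow 2).mul ((hX 0).pow 4)).C_mul ε
    · exact ((((hX 1).pow 11).mul (hX 0)).sub (((hX 0).pow 11).mul (hX 1))).mul ((hX 4).pow 2)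
  have hΨe : ∀ w : surfaceCone ε, w.1 2 ^ 3 = w.1 4 * eval w.1 Ψ := by
    intro w
    have := w.2.2.2
    simp only [Ψ, map_neg, map_add, map_mul, map_sub, map_pow, eval_X, eval_C]
    linear_combination this
  have hred : ∀ s : Fin 5 →₀ ℕ, Finsupp.weight (Surface.coordinates ε).weight s =
      (32 * r, 5 * r) → ∃ P', IsWeightedHomogeneous (Surface.coordinates ε).weight P'
        (32 * r, 5 * r) ∧ ∀ w ∈ C₀, F w * eval w.1 (monomial s (1 : k)) = eval w.1 P' := by
    intro s hs
    have hev : ∀ w : Fin 5 → k, eval w (monomial s (1 : k)) =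
        w 0 ^ s 0 * w 1 ^ s 1 * w 2 ^ s 2 * w 3 ^ s 3 * w 4 ^ s 4 := by
      intro w
      rw [eval_monomial, Finsupp.prod_fintype _ _ (by simp), Fin.prod_univ_five, one_mul]
    rw [weight_degree, Prod.mk.injEq] at hs
    -- the base coordinate `a`, and the polynomial that remains after division by its power
    have hbase : ∃ (a : Fin 5) (e₀ e₁ : ℕ), (a = 0 ∨ a = 1) ∧ r + (e₀ + e₁) = s 0 + s 1 ∧
        ∀ w : Fin 5 → k, w 0 ^ s 0 * w 1 ^ s 1 = w a ^ r * (w 0 ^ e₀ * w 1 ^ e₁) := by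
      by_cases h0 : r ≤ s 0
      · refine ⟨0, s 0 - r, s 1, Or.inl rfl, by omega, fun w => ?_⟩
        rw [← mul_assoc, ← pow_add, Nat.add_sub_cancel' h0]
      · refine ⟨1, s 0, s 1 - r, Or.inr rfl, by omega, fun w => ?_⟩
        rw [mul_left_comm, ← pow_add, Nat.add_sub_cancel' (by omega)]
    obtain ⟨a, e₀, e₁, ha, he, hw01⟩ := hbase
    have hh : ∀ n₂ n₃ n₄ : ℕ, IsWeightedHomogeneous (Surface.coordinates ε).weight
        (X 0 ^ e₀ * X 1 ^ e₁ * X 2 ^ n₂ * X 3 ^ n₃ * X 4 ^ n₄ : MvPolynomial (Fin 5) k)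
        (e₀ + e₁ + 4 * n₂ + 6 * n₃, n₂ + n₃ + n₄) := by
      intro n₂ n₃ n₄
      have := (((((hX 0).pow e₀).mul ((hX 1).pow e₁)).mul ((hX 2).pow n₂)).mul
        ((hX 3).pow n₃)).mul ((hX 4).pow n₄)
      convert this using 1
      simp only [weight_eq, weight₁, weight₂]
      ext
      · simp; ring
      · simp
    by_cases h4 : r ≤ s 4
    · refine ⟨Q a 4 * (X 0 ^ e₀ * X 1 ^ e₁ * X 2 ^ s 2 * X 3 ^ s 3 * X 4 ^ (s 4 - r)), ?_, ?_⟩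
      · have := (hQ a 4 ⟨ha, Or.inr rfl⟩).mul (hh (s 2) (s 3) (s 4 - r))
        convert this using 1
        simp only [weight₁, Matrix.cons_val]
        ext
        · simp; omega
        · simp; omega
      · intro w hw
        rw [hev, hw01, map_mul, ← hFQ a 4 ⟨ha, Or.inr rfl⟩ w hw]
        simp only [map_mul, map_pow, eval_X]
        rw [show w.1 4 ^ s 4 = w.1 4 ^ r * w.1 4 ^ (s 4 - r) by
          rw [← pow_add, Nat.add_sub_cancel' h4]]
        ring
    by_cases h3 : r ≤ s 3
    · refine ⟨Q a 3 * (X 0 ^ e₀ * X 1 ^ e₁ * X 2 ^ s 2 * X 3 ^ (s 3 - r) * X 4 ^ s 4), ?_, ?_⟩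
      · have := (hQ a 3 ⟨ha, Or.inl rfl⟩).mul (hh (s 2) (s 3 - r) (s 4))
        convert this using 1
        simp only [weight₁, Matrix.cons_val]
        ext
        · simp; omega
        · simp; omega
      · intro w hw
        rw [hev, hw01, map_mul, ← hFQ a 3 ⟨ha, Or.inl rfl⟩ w hw]
        simp only [map_mul, map_pow, eval_X]
        rw [show w.1 3 ^ s 3 = w.1 3 ^ r * w.1 3 ^ (s 3 - r) by
          rw [← pow_add, Nat.add_sub_cancel' h3]]
        ring
    · have h2 : 3 * r ≤ s 2 := by omega
      refine ⟨Q a 4 * Ψ ^ r * (X 0 ^ e₀ * X 1 ^ e₁ * X 2 ^ (s 2 - 3 * r) * X 3 ^ s 3 * X 4 ^ s 4),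
        ?_, ?_⟩
      · have := ((hQ a 4 ⟨ha, Or.inr rfl⟩).mul (hΨ.pow r)).mul (hh (s 2 - 3 * r) (s 3) (s 4))
        convert this using 1
        simp only [weight₁, Matrix.cons_val]
        ext
        · simp; omega
        · simp; omega
      · intro w hw
        rw [hev, hw01, map_mul, map_mul, ← hFQ a 4 ⟨ha, Or.inr rfl⟩ w hw]
        simp only [map_mul, map_pow, eval_X]
        rw [show w.1 2 ^ s 2 = (w.1 4 * eval w.1 Ψ) ^ r * w.1 2 ^ (s 2 - 3 * r) by
          rw [← hΨe, ← pow_mul, ← pow_add, Nat.add_sub_cancel' h2]]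
        ring
  choose! P' hP' hFP' using hred
  refine ⟨∑ s ∈ P.support, C (coeff s P) * P' s,
    IsWeightedHomogeneous.sum _ _ _ fun s hs =>
      (hP' s (hP (mem_support_iff.1 hs))).C_mul _, fun w hw => ?_⟩
  conv_lhs => rw [← support_sum_monomial_coeff P]
  rw [map_sum, map_sum, Finset.mul_sum]
  refine Finset.sum_congr rfl fun s hs => ?_
  rw [map_mul, ← hFP' s (hP (mem_support_iff.1 hs)) w hw, eval_C,
    show monomial s (coeff s P) = C (coeff s P) * monomial s 1 by rw [C_mul_monomial, mul_one],
    map_mul, eval_C]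
  ring

variable [IsAlgClosed k]

/-- Multiplication by F preserves the finite-dimensional space of restrictions of forms of degree
(32r, 5r). Its characteristic polynomial annihilates the values of F by Cayley–Hamilton, tested on
t₀^(32r) z^(5r), which has no zero on C₀. -/
theorem finite_values {C₀ : Set (surfaceCone ε)} (hC : ∀ w ∈ C₀, w.1 0 ≠ 0 ∧ w.1 4 ≠ 0)
    {F : surfaceCone ε → k} {r : ℕ} (Q : Fin 5 → Fin 5 → MvPolynomial (Fin 5) k)
    (hQ : ∀ a b, IsChartPair a b → IsWeightedHomogeneous (Surface.coordinates ε).weight (Q a b)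
      (r + weight₁ b * r, r))
    (hFQ : ∀ a b, IsChartPair a b → ∀ w ∈ C₀, F w * w.1 a ^ r * w.1 b ^ r = eval w.1 (Q a b)) :
    ∃ p : Polynomial k, p.Monic ∧ ∀ w ∈ C₀, p.eval (F w) = 0 := by
  let H := weightedHomogeneousSubmodule k (Surface.coordinates ε).weight (32 * r, 5 * r)
  let ev : MvPolynomial (Fin 5) k →ₗ[k] (C₀ → k) :=
    { toFun := fun P w => eval w.1.1 P
      map_add' := fun P Q => by funext w; simp
      map_smul' := fun c P => by funext w; simp [smul_eval] }
  let V : Submodule k (C₀ → k) := H.map ev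
  have hH : Module.Finite k H := homogeneous_fg _
  have hV : Module.Finite k V := inferInstanceAs (Module.Finite k (H.map ev))
  let mulF : (C₀ → k) →ₗ[k] (C₀ → k) := LinearMap.mulLeft k fun w => F w.1
  have hmul : ∀ s ∈ V, mulF s ∈ V := by
    rintro s ⟨P, hP, rfl⟩
    obtain ⟨P', hP', h⟩ := exists_mul_homogeneous Q hQ hFQ hP
    exact ⟨P', hP', by funext w; exact (h w.1 w.2).symm⟩
  let T : V →ₗ[k] V := mulF.restrict hmul
  refine ⟨T.charpoly, T.charpoly_monic, fun w hw => ?_⟩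
  have hpow : ∀ (n : ℕ) (s : V), ((T ^ n) s).1 ⟨w, hw⟩ = F w ^ n * s.1 ⟨w, hw⟩ := by
    intro n
    induction n with
    | zero => intro s; simp
    | succ n ih =>
      intro s
      rw [pow_succ, Module.End.mul_apply, ih]
      change F w ^ n * (F w * s.1 ⟨w, hw⟩) = _
      ring
  have hpoly : ∀ (p : Polynomial k) (s : V), ((Polynomial.aeval T p) s).1 ⟨w, hw⟩ =
      p.eval (F w) * s.1 ⟨w, hw⟩ := by
    intro p s
    induction p using Polynomial.induction_on' with
    | add p q hp hq => simp [hp, hq, add_mul]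
    | monomial n a => simp [Polynomial.aeval_monomial, hpow, mul_assoc, Module.algebraMap_end_apply]
  have hX := isWeightedHomogeneous_X k (Surface.coordinates ε).weight
  have hs : ev (X 0 ^ (32 * r) * X 4 ^ (5 * r)) ∈ V := by
    refine ⟨_, ?_, rfl⟩
    have := ((hX 0).pow (32 * r)).mul ((hX 4).pow (5 * r))
    simp only [weight_eq, weight₁, weight₂] at this
    change IsWeightedHomogeneous _ _ (32 * r, 5 * r)
    convert this using 1
    ext <;> simp
  have h1 := hpoly T.charpoly ⟨_, hs⟩
  rw [LinearMap.aeval_self_charpoly] at h1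
  have h2 : eval w.1 (X 0 ^ (32 * r) * X 4 ^ (5 * r)) ≠ 0 := by
    simp only [map_mul, map_pow, eval_X]
    exact mul_ne_zero (pow_ne_zero _ (hC w hw).1) (pow_ne_zero _ (hC w hw).2)
  exact (mul_eq_zero.1 h1.symm).resolve_right h2

/-- A function on the affine part `t₀ z ≠ 0` of the surface that extends without poles to the whole
surface is constant. -/
theorem exists_eq_const (F : Surface ε → k)
    (hF : ∀ a b, IsChartPair a b → ∀ v : surfaceCone ε, v.1 a = 1 → v.1 b = 1 →
      IsRatAt {w : surfaceCone ε | w.1 a = 1 ∧ w.1 b = 1 ∧ w.1 0 ≠ 0 ∧ w.1 4 ≠ 0} v.1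
        (fun w => F (Surface.point w))) :
    ∃ c, ∀ w : surfaceCone ε, w.1 0 ≠ 0 → w.1 4 ≠ 0 → F (Surface.point w) = c := by
  have hpoly : ∀ a b, IsChartPair a b → ∃ P : MvPolynomial (Fin 5) k, ∀ w : surfaceCone ε,
      w.1 a = 1 → w.1 b = 1 → w.1 0 ≠ 0 → w.1 4 ≠ 0 → F (Surface.point w) = eval w.1 P := by
    intro a b hab
    obtain ⟨P, hP⟩ := exists_eval_of_isRatAt (F := fun w => F (Surface.point w))
      (W := {w : surfaceCone ε | w.1 a = 1 ∧ w.1 b = 1 ∧ w.1 0 ≠ 0 ∧ w.1 4 ≠ 0}) (by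
        intro v
        by_cases ha : v a = 1
        · by_cases hb : v b = 1
          · by_cases hv : eval v (surfacePoly ε) = 0
            · refine hF a b hab ⟨v, mem_surfaceCone.2 ⟨?_, ?_, hv⟩⟩ ha hb
              · obtain ⟨rfl | rfl, -⟩ := hab <;> simp [ha]
              · obtain ⟨-, rfl | rfl⟩ := hab <;> simp [hb]
            -- Away from the chart nothing has to be known about F: the equation, or below a
            -- normalised coordinate minus 1, vanishes on the set in question and serves as
            -- denominator.
            · exact ⟨0, surfacePoly ε, hv, fun w _ => by simp [(mem_surfaceCone.1 w.2).2.2]⟩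
          · refine ⟨0, X b - 1, by simpa [sub_eq_zero] using hb, fun w hw => ?_⟩
            simp [hw.2.1]
        · refine ⟨0, X a - 1, by simpa [sub_eq_zero] using ha, fun w hw => ?_⟩
          simp [hw.1])
    exact ⟨P, fun w h1 h2 h3 h4 => hP w ⟨h1, h2, h3, h4⟩⟩
  choose! P hP using hpoly
  have hhom : ∀ a b, ∃ r : ℕ, IsChartPair a b → ∀ m n : ℕ, r ≤ m → r ≤ n →
      ∃ Q : MvPolynomial (Fin 5) k, IsWeightedHomogeneous (Surface.coordinates ε).weight Q
        (m + weight₁ b * n, n) ∧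
      (∀ v, v a ≠ 0 → v b ≠ 0 → eval v Q = eval (normalize a b v) (P a b) * v a ^ m * v b ^ n) ∧
      (∀ v, v a = 0 ∨ v b = 0 → eval v Q = 0) := by
    intro a b
    by_cases hab : IsChartPair a b
    · obtain ⟨r, hr⟩ := exists_homogenization hab ε (P a b)
      exact ⟨r, fun _ => hr⟩
    · exact ⟨0, fun h => absurd h hab⟩
  choose r' hr' using hhom
  -- A common exponent for all charts; the summand 1 keeps it nonzero.
  let r := 1 + ∑ a, ∑ b, r' a b
  have hle : ∀ a b, r' a b ≤ r := by
    intro a b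
    have h1 : r' a b ≤ ∑ b, r' a b := Finset.single_le_sum (fun _ _ => Nat.zero_le _)
      (Finset.mem_univ b)
    have h2 : ∑ b, r' a b ≤ ∑ a, ∑ b, r' a b :=
      Finset.single_le_sum (f := fun a => ∑ b, r' a b) (fun _ _ => Nat.zero_le _)
      (Finset.mem_univ a)
    omega
  have hQ : ∀ a b, ∃ Q : MvPolynomial (Fin 5) k, IsChartPair a b →
      IsWeightedHomogeneous (Surface.coordinates ε).weight Q (r + weight₁ b * r, r) ∧
      (∀ v, v a ≠ 0 → v b ≠ 0 → eval v Q = eval (normalize a b v) (P a b) * v a ^ r * v b ^ r) ∧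
      (∀ v, v a = 0 ∨ v b = 0 → eval v Q = 0) := by
    intro a b
    by_cases hab : IsChartPair a b
    · obtain ⟨Q, hQ⟩ := hr' a b hab r r (hle a b) (hle a b)
      exact ⟨Q, fun _ => hQ⟩
    · exact ⟨0, fun h => absurd h hab⟩
  choose Q hQ using hQ
  have hFQ : ∀ a b, IsChartPair a b → ∀ w : surfaceCone ε, w.1 0 ≠ 0 → w.1 4 ≠ 0 →
      F (Surface.point w) * w.1 a ^ r * w.1 b ^ r = eval w.1 (Q a b) := by
    intro a b hab w h0 h4
    have hr0 : r ≠ 0 := by omega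
    by_cases ha : w.1 a = 0
    · rw [(hQ a b hab).2.2 w.1 (Or.inl ha), ha, zero_pow hr0]; ring
    by_cases hb : w.1 b = 0
    · rw [(hQ a b hab).2.2 w.1 (Or.inr hb), hb, zero_pow hr0]; ring
    rw [(hQ a b hab).2.1 w.1 ha hb, ← point_normalize w ha hb,
      hP a b hab _ (normalize_left hab ha) (normalize_right hab ha hb)
      (normalize_ne_zero ha hb h0) (normalize_ne_zero ha hb h4)]
  obtain ⟨p, hp, hpF⟩ := finite_values (C₀ := {w : surfaceCone ε | w.1 0 ≠ 0 ∧ w.1 4 ≠ 0})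
    (fun w hw => hw) (F := fun w => F (Surface.point w)) Q (fun a b hab => (hQ a b hab).1)
    (fun a b hab w hw => hFQ a b hab w hw.1 hw.2)
  -- The values of F are roots of p, so the product of the functions F - c over the roots c
  -- vanishes. Since the equation is prime, one of the factors vanishes identically.
  have hdvd : surfacePoly ε ∣ (p.roots.map fun c => Q 0 4 - C c * (X 0 ^ r * X 4 ^ r)).prod := by
    refine surfacePoly_dvd (S := 1) (surfacePoly_prime ε).not_dvd_one ?_
    intro w hw h0 h4 _
    have h1 := hpF ⟨w, hw⟩ ⟨h0, h4⟩
    have h2 := (Polynomial.mem_roots hp.ne_zero).2 h1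
    rw [map_multiset_prod, Multiset.prod_eq_zero_iff, Multiset.map_map, Multiset.mem_map]
    refine ⟨_, h2, ?_⟩
    have h3 := hFQ 0 4 ⟨Or.inl rfl, Or.inr rfl⟩ ⟨w, hw⟩ h0 h4
    simp only [Function.comp_apply, map_sub, map_mul, map_pow, eval_C, eval_X, ← h3]
    ring
  obtain ⟨c, -, hc⟩ := (surfacePoly_prime ε).exists_mem_multiset_map_dvd hdvd
  refine ⟨c, fun w h0 h4 => ?_⟩
  obtain ⟨R, hR⟩ := hc
  have h3 := congrArg (eval w.1) hR
  rw [map_mul, (mem_surfaceCone.1 w.2).2.2, zero_mul, map_sub,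
    ← hFQ 0 4 ⟨Or.inl rfl, Or.inr rfl⟩ w h0 h4] at h3
  simp only [map_mul, map_pow, eval_C, eval_X] at h3
  have h5 : (w.1 0 ^ r * w.1 4 ^ r) ≠ 0 := mul_ne_zero (pow_ne_zero _ h0) (pow_ne_zero _ h4)
  apply mul_right_cancel₀ h5
  linear_combination h3

end Constant

/-! ## Brackets of functions -/

section Frames

variable {k : Type*} [Field k] {ε : k}

/-- The determinant of the columns `i`, `j`, `l` of three row vectors. -/
def det3 (i j l : Fin 5) (r s t : Fin 5 → k) : k :=
  r i * (s j * t l - s l * t j) - r j * (s i * t l - s l * t i) + r l * (s i * t j - s j * t i)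

/-- A chart, where the coordinates `a` and `b` are normalised, with an order of the affine
coordinates `i`, `j`, `l`. -/
inductive IsFrame : Fin 5 → Fin 5 → Fin 5 → Fin 5 → Fin 5 → Prop
  | z0 : IsFrame 0 4 2 3 1
  | z1 : IsFrame 1 4 3 2 0
  | y0 : IsFrame 0 3 2 1 4
  | y1 : IsFrame 1 3 0 2 4

theorem IsFrame.isChartPair {a b i j l : Fin 5} (h : IsFrame a b i j l) : IsChartPair a b := by
  cases h <;> exact ⟨by decide, by decide⟩

theorem IsChartPair.exists_isFrame {a b : Fin 5} (h : IsChartPair a b) :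
    ∃ i j l, IsFrame a b i j l := by
  obtain ⟨rfl | rfl, rfl | rfl⟩ := h
  exacts [⟨_, _, _, .y0⟩, ⟨_, _, _, .z0⟩, ⟨_, _, _, .y1⟩, ⟨_, _, _, .z1⟩]

/-- In the three coordinates i, j, l, the vectors u and w are orthogonal to φ, so their cross
product is proportional to φ. The identity compares r ∧ s on (u, w) with the determinant of r, s, φ
through the l-th component of that cross product. -/
theorem frame_identity {a b i j l : Fin 5} (h : IsFrame a b i j l) (r s φ u w : Fin 5 → k)
    (hu : u a = 0 ∧ u b = 0) (hw : w a = 0 ∧ w b = 0) (hφu : ∑ m, φ m * u m = 0)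
    (hφw : ∑ m, φ m * w m = 0) :
    ((∑ m, r m * u m) * (∑ m, s m * w m) - (∑ m, r m * w m) * (∑ m, s m * u m)) * φ l =
      det3 i j l r s φ * (u i * w j - u j * w i) := by
  obtain ⟨hua, hub⟩ := hu
  obtain ⟨hwa, hwb⟩ := hw
  have key : ∀ ri rj rl si sj sl fi fj fl ui uj ul wi wj wl : k,
      fi * ui + fj * uj + fl * ul = 0 → fi * wi + fj * wj + fl * wl = 0 →
      ((ri * ui + rj * uj + rl * ul) * (si * wi + sj * wj + sl * wl) -
        (ri * wi + rj * wj + rl * wl) * (si * ui + sj * uj + sl * ul)) * fl =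
      (ri * (sj * fl - sl * fj) - rj * (si * fl - sl * fi) + rl * (si * fj - sj * fi)) *
        (ui * wj - uj * wi) := by
    intro ri rj rl si sj sl fi fj fl ui uj ul wi wj wl h1 h2
    linear_combination ((rj * sl - rl * sj) * (-wj) + (rl * si - ri * sl) * wi) * h1 +
      ((rj * sl - rl * sj) * uj - (rl * si - ri * sl) * ui) * h2
  have hsum : ∀ p q : Fin 5 → k, q a = 0 → q b = 0 →
      ∑ m, p m * q m = p i * q i + p j * q j + p l * q l := by
    intro p q ha hb
    cases h <;> rw [Fin.sum_univ_five, ha, hb] <;> ring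
  rw [hsum _ _ hua hub] at hφu
  rw [hsum _ _ hwa hwb] at hφw
  rw [hsum _ _ hua hub, hsum _ _ hwa hwb, hsum _ _ hwa hwb, hsum _ _ hua hub, det3]
  exact key _ _ _ _ _ _ _ _ _ _ _ _ _ _ _ hφu hφw

/-- Vectors annihilated by the two Euler vectors of the torus action at `v`. -/
def IsBasic (v r : Fin 5 → k) : Prop :=
  v 0 * r 0 + v 1 * r 1 + 4 * v 2 * r 2 + 6 * v 3 * r 3 = 0 ∧
    v 2 * r 2 + v 3 * r 3 + v 4 * r 4 = 0

/-- Three covectors annihilated by two vectors have 3 × 3 minors proportional, up to sign, to the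
complementary 2 × 2 minors of these vectors. For the Euler vectors the minor in the columns `a`, `b`
is v a · v b; the order of i, j, l in `IsFrame` makes all signs agree. -/
theorem det3_eq_of_isBasic {a b i j l : Fin 5} (h : IsFrame a b i j l) {v r s t : Fin 5 → k}
    (hr : IsBasic v r) (hs : IsBasic v s) (ht : IsBasic v t) :
    v 0 * v 4 * det3 i j l r s t = v a * v b * det3 2 3 1 r s t := by
  obtain ⟨hr1, hr2⟩ := hr
  obtain ⟨hs1, hs2⟩ := hs
  obtain ⟨ht1, ht2⟩ := ht
  have h1 : v 0 * det3 3 2 0 r s t = v 1 * det3 2 3 1 r s t := by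
    simp only [det3]
    linear_combination -(s 2 * t 3 - s 3 * t 2) * hr1 + (r 2 * t 3 - r 3 * t 2) * hs1
      - (r 2 * s 3 - r 3 * s 2) * ht1
  have h2 : v 4 * det3 2 1 4 r s t = v 3 * det3 2 3 1 r s t := by
    simp only [det3]
    linear_combination -(s 1 * t 2 - s 2 * t 1) * hr2 + (r 1 * t 2 - r 2 * t 1) * hs2
      - (r 1 * s 2 - r 2 * s 1) * ht2
  have h3 : v 4 * det3 0 2 4 r s t = v 3 * det3 3 2 0 r s t := by
    simp only [det3]
    linear_combination (s 0 * t 2 - s 2 * t 0) * hr2 - (r 0 * t 2 - r 2 * t 0) * hs2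
      + (r 0 * s 2 - r 2 * s 0) * ht2
  cases h
  · ring
  · linear_combination v 4 * h1
  · linear_combination v 0 * h2
  · linear_combination v 0 * h3 + v 3 * h1

/-- The gradient of the equation. -/
def gradPoly (ε : k) (v : Fin 5 → k) (m : Fin 5) : k := eval v (pderiv m (surfacePoly ε))

theorem gradPoly_zero [CharP k 11] (v : Fin 5 → k) :
    gradPoly ε v 0 = 4 * ε * v 2 ^ 2 * v 4 * v 0 ^ 3 + v 1 ^ 11 * v 4 ^ 3 := by
  have h11 : (11 : k) = 0 := CharP.cast_eq_zero k 11
  simp [gradPoly, surfacePoly, pderiv_X, Derivation.leibniz_pow]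
  linear_combination (-v 0 ^ 10 * v 1 * v 4 ^ 3) * h11

/-- The term t₁¹¹ has derivative zero in characteristic 11. Hence this partial derivative has no
zero where t₀ z ≠ 0, and x, y are local coordinates at all those points, even at singular points of
fibres. -/
theorem gradPoly_one [CharP k 11] (v : Fin 5 → k) :
    gradPoly ε v 1 = -v 0 ^ 11 * v 4 ^ 3 := by
  have h11 : (11 : k) = 0 := CharP.cast_eq_zero k 11
  simp [gradPoly, surfacePoly, pderiv_X, Derivation.leibniz_pow]
  linear_combination (v 1 ^ 10 * v 0 * v 4 ^ 3) * h11

theorem gradPoly_four (v : Fin 5 → k) : gradPoly ε v 4 = v 3 ^ 2 + ε * v 2 ^ 2 * v 0 ^ 4 +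
    3 * (v 1 ^ 11 * v 0 - v 0 ^ 11 * v 1) * v 4 ^ 2 := by
  simp [gradPoly, surfacePoly, pderiv_X, Derivation.leibniz_pow]
  ring

/-- Euler's relation for the degree (12, 3), where the right-hand sides vanish because v lies on the
cone. -/
theorem isBasic_gradPoly (v : surfaceCone ε) : IsBasic v.1 (gradPoly ε v.1) := by
  have h := v.2.2.2
  constructor
  · simp [gradPoly, surfacePoly, pderiv_X, Derivation.leibniz_pow]
    linear_combination 12 * h
  · simp [gradPoly, surfacePoly, pderiv_X, Derivation.leibniz_pow]
    linear_combination 3 * h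

theorem euler_identity {P : MvPolynomial (Fin 5) k} {d : ℕ × ℕ}
    (hP : IsWeightedHomogeneous (Surface.coordinates ε).weight P d) (v : Fin 5 → k) :
    v 0 * eval v (pderiv 0 P) + v 1 * eval v (pderiv 1 P) + 4 * v 2 * eval v (pderiv 2 P) +
        6 * v 3 * eval v (pderiv 3 P) = d.1 * eval v P ∧
      v 2 * eval v (pderiv 2 P) + v 3 * eval v (pderiv 3 P) + v 4 * eval v (pderiv 4 P) =
        d.2 * eval v P := by
  have h1 := (IsWeightedHomogeneous.map_weight (AddMonoidHom.fst ℕ ℕ)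
    hP).sum_weight_X_mul_pderiv
  have h2 := (IsWeightedHomogeneous.map_weight (AddMonoidHom.snd ℕ ℕ)
    hP).sum_weight_X_mul_pderiv
  replace h1 := congrArg (eval v) h1
  replace h2 := congrArg (eval v) h2
  simp only [weight_eq, Fin.sum_univ_five, weight₁, weight₂, AddMonoidHom.coe_fst,
    AddMonoidHom.coe_snd, Matrix.cons_val, nsmul_eq_mul, map_add, map_mul, map_natCast,
    eval_X] at h1 h2
  push_cast at h1 h2
  exact ⟨by linear_combination h1, by linear_combination h2⟩

/-- A quotient of forms of equal degree has degree zero, so both Euler derivatives vanish. -/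
theorem isBasic_ratGrad {A B : MvPolynomial (Fin 5) k} {d : ℕ × ℕ}
    (hA : IsWeightedHomogeneous (Surface.coordinates ε).weight A d)
    (hB : IsWeightedHomogeneous (Surface.coordinates ε).weight B d) (v : Fin 5 → k) :
    IsBasic v (ratGrad A B v) := by
  obtain ⟨a1, a2⟩ := euler_identity hA v
  obtain ⟨b1, b2⟩ := euler_identity hB v
  simp only [IsBasic, ratGrad]
  constructor
  · linear_combination (eval v B * a1 - eval v A * b1) / eval v B ^ 2
  · linear_combination (eval v B * a2 - eval v A * b2) / eval v B ^ 2

/-- Every point has a chart in which the last affine coordinate is a function of the others. -/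
theorem exists_good_frame [CharP k 11] (q : Surface ε) : ∃ (a b i j l : Fin 5)
    (_ : IsFrame a b i j l) (v : surfaceCone ε), Surface.point v = q ∧ v.1 a = 1 ∧ v.1 b = 1 ∧
      gradPoly ε v.1 l ≠ 0 := by
  obtain ⟨w, rfl⟩ := (Surface.coordinates ε).surjective q
  have key : ∀ {a b i j l : Fin 5} (h : IsFrame a b i j l) (ha : w.1 a ≠ 0) (hb : w.1 b ≠ 0),
      gradPoly ε (normalize a b w.1) l ≠ 0 → ∃ (a b i j l : Fin 5)
      (_ : IsFrame a b i j l) (v : surfaceCone ε), Surface.point v = Surface.point w ∧ v.1 a = 1 ∧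
        v.1 b = 1 ∧ gradPoly ε v.1 l ≠ 0 := fun h ha hb hg =>
    ⟨_, _, _, _, _, h, ⟨_, normalize_mem w.2 ha hb⟩, point_normalize w ha hb,
      normalize_left h.isChartPair ha, normalize_right h.isChartPair ha hb, hg⟩
  have hzero : ∀ a b i : Fin 5, w.1 i = 0 → normalize a b w.1 i = 0 := by
    intro a b i hi
    simp [normalize, hi]
  -- This is the smoothness of the surface. On the zero section x = z = 0 and the derivative by z is
  -- y². Elsewhere the derivative by t₁ is -t₀¹¹z³, and on the fibre t₀ = 0 the derivative by t₀ is
  -- t₁¹¹z³.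
  by_cases h4 : w.1 4 = 0
  · have h2 : w.1 2 = 0 := by
      have := w.2.2.2
      rw [h4] at this
      simpa using this
    have h3 : w.1 3 ≠ 0 := by
      rcases w.2.2.1 with h | h | h
      exacts [absurd h2 h, h, absurd h4 h]
    by_cases h0 : w.1 0 = 0
    · have h1 : w.1 1 ≠ 0 := w.2.1.resolve_left fun h => h h0
      refine key .y1 h1 h3 ?_
      rw [gradPoly_four, normalize_right (IsFrame.y1).isChartPair h1 h3, hzero 1 3 2 h2,
        hzero 1 3 4 h4]
      simp
    · refine key .y0 h0 h3 ?_
      rw [gradPoly_four, normalize_right (IsFrame.y0).isChartPair h0 h3, hzero 0 3 2 h2,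
        hzero 0 3 4 h4]
      simp
  · by_cases h0 : w.1 0 = 0
    · have h1 : w.1 1 ≠ 0 := w.2.1.resolve_left fun h => h h0
      refine key .z1 h1 h4 ?_
      rw [gradPoly_zero, normalize_right (IsFrame.z1).isChartPair h1 h4,
        normalize_left (IsFrame.z1).isChartPair h1, hzero 1 4 0 h0]
      simp
    · refine key .z0 h0 h4 ?_
      rw [gradPoly_one, normalize_right (IsFrame.z0).isChartPair h0 h4,
        normalize_left (IsFrame.z0).isChartPair h0]
      simp

end Frames

/-! ### Wedge products of differentials as multiples of dx ∧ dy -/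

section Bracket

variable {k : Type*} [Field k] {ε : k}

theorem chartCoord_isQuotient {a b : Fin 5} (h : IsChartPair a b) (i : Fin 5) :
    IsQuotient (chartCoord ε a b i) (X i * X a ^ (weight₁ b * weight₂ i))
      (X a ^ weight₁ i * X b ^ weight₂ i) :=
  fun w _ => (chartCoord_point h i w).trans (by simp [normalize])

theorem exists_isQuotient {v : surfaceCone ε} {f : Surface ε → k}
    (hf : f ∈ Surface.Reg (Surface.point v)) : ∃ (d : ℕ × ℕ) (A B : MvPolynomial (Fin 5) k),
      IsWeightedHomogeneous (Surface.coordinates ε).weight A d ∧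
      IsWeightedHomogeneous (Surface.coordinates ε).weight B d ∧ eval v.1 B ≠ 0 ∧
        IsQuotient f A B :=
  ((Surface.coordinates ε).isRegularAt_iff v).1 hf

/-- The wedge product of the differentials of two functions. -/
def wedge {q : Surface ε} {g h : Surface ε → k} (hg : g ∈ Surface.Reg q) (hh : h ∈ Surface.Reg q)
    (D E : tangentSpace k q) : k :=
  D.1 ⟨g, hg⟩ * E.1 ⟨h, hh⟩ - E.1 ⟨g, hg⟩ * D.1 ⟨h, hh⟩

theorem wedge_mul_gradPoly {a b i j l : Fin 5} (hF : IsFrame a b i j l) (v : surfaceCone ε)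
    (ha : v.1 a = 1) (hb : v.1 b = 1) {g h : Surface ε → k}
    (hg : g ∈ Surface.Reg (Surface.point v)) (hh : h ∈ Surface.Reg (Surface.point v))
    {A B A' B' : MvPolynomial (Fin 5) k} {d d' : ℕ × ℕ}
    (hB : IsWeightedHomogeneous (Surface.coordinates ε).weight B d) (hgA : IsQuotient g A B)
    (hBv : eval v.1 B ≠ 0)
    (hB' : IsWeightedHomogeneous (Surface.coordinates ε).weight B' d') (hhA : IsQuotient h A' B')
    (hBv' : eval v.1 B' ≠ 0)
    (hi : chartCoord ε a b i ∈ Surface.Reg (Surface.point v))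
    (hj : chartCoord ε a b j ∈ Surface.Reg (Surface.point v))
    (D E : tangentSpace k (Surface.point v)) :
    wedge hg hh D E * gradPoly ε v.1 l =
      det3 i j l (ratGrad A B v.1) (ratGrad A' B' v.1) (gradPoly ε v.1) * wedge hi hj D E := by
  have ha' : v.1 a ≠ 0 := by simp [ha]
  have hb' : v.1 b ≠ 0 := by simp [hb]
  have hab := hF.isChartPair
  have := frame_identity hF (ratGrad A B v.1) (ratGrad A' B' v.1) (gradPoly ε v.1)
    (component hab v ha' hb' D) (component hab v ha' hb' E) (component_eq_zero hab v ha' hb' D)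
    (component_eq_zero hab v ha' hb' E) (dirDeriv_component hab v ha hb ha' hb' D)
    (dirDeriv_component hab v ha hb ha' hb' E)
  rw [← tangent_eq_sum hab v ha hb ha' hb' D ⟨g, hg⟩ hB hgA hBv,
    ← tangent_eq_sum hab v ha hb ha' hb' E ⟨h, hh⟩ hB' hhA hBv',
    ← tangent_eq_sum hab v ha hb ha' hb' D ⟨h, hh⟩ hB' hhA hBv',
    ← tangent_eq_sum hab v ha hb ha' hb' E ⟨g, hg⟩ hB hgA hBv] at this
  rw [wedge, this, wedge, component, component, component, component]
  ring

variable [CharP k 11] [IsAlgClosed k]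

/-- Tangent vectors dual to multiples of the differentials of `x` and `y`. -/
theorem exists_dual_pair (w : surfaceCone ε) (h0 : w.1 0 ≠ 0) (h4 : w.1 4 ≠ 0)
    (hx : chartCoord ε 0 4 2 ∈ Surface.Reg (Surface.point w))
    (hy : chartCoord ε 0 4 3 ∈ Surface.Reg (Surface.point w)) :
    ∃ D E : tangentSpace k (Surface.point w), wedge hx hy D E = 1 / (w.1 0 ^ 10 * w.1 4 ^ 2) ∧
      ∀ (g h : Surface ε → k) (hg : g ∈ Surface.Reg (Surface.point w))
        (hh : h ∈ Surface.Reg (Surface.point w)) (A B A' B' : MvPolynomial (Fin 5) k),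
        IsQuotient g A B → IsQuotient h A' B' → eval w.1 B ≠ 0 → eval w.1 B' ≠ 0 →
        wedge hg hh D E * gradPoly ε w.1 1 =
          det3 2 3 1 (ratGrad A B w.1) (ratGrad A' B' w.1) (gradPoly ε w.1) := by
  have hg1 : gradPoly ε w.1 1 ≠ 0 := by
    rw [gradPoly_one]
    exact mul_ne_zero (neg_ne_zero.2 (pow_ne_zero _ h0)) (pow_ne_zero _ h4)
  -- Unit vectors in the directions x and y, with the t₁-component solved from the linearised
  -- equation. The affine coordinates are x / (t₀⁴z) and y / (t₀⁶z), which explains the factor 1 /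
  -- (t₀¹⁰z²).
  set u : Fin 5 → k := ![0, -gradPoly ε w.1 2 / gradPoly ε w.1 1, 1, 0, 0] with hu
  set u' : Fin 5 → k := ![0, -gradPoly ε w.1 3 / gradPoly ε w.1 1, 0, 1, 0] with hu'
  have hφu : ∑ m, gradPoly ε w.1 m * u m = 0 := by
    simp only [Fin.sum_univ_five, hu, Matrix.cons_val]
    field_simp; ring
  have hφu' : ∑ m, gradPoly ε w.1 m * u' m = 0 := by
    simp only [Fin.sum_univ_five, hu', Matrix.cons_val]
    field_simp; ring
  obtain ⟨D, hD⟩ := exists_tangent w u hφu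
  obtain ⟨E, hE⟩ := exists_tangent w u' hφu'
  have h04 : IsChartPair 0 4 := ⟨Or.inl rfl, Or.inr rfl⟩
  refine ⟨D, E, ?_, ?_⟩
  · have e2 := chartCoord_isQuotient (ε := ε) h04 2
    have e3 := chartCoord_isQuotient (ε := ε) h04 3
    have n2 : eval w.1 (X 0 ^ weight₁ 2 * X 4 ^ weight₂ 2) ≠ 0 := by simp [h0, h4]
    have n3 : eval w.1 (X 0 ^ weight₁ 3 * X 4 ^ weight₂ 3) ≠ 0 := by simp [h0, h4]
    rw [wedge, hD ⟨_, hx⟩ _ _ e2 n2, hE ⟨_, hy⟩ _ _ e3 n3, hE ⟨_, hx⟩ _ _ e2 n2,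
      hD ⟨_, hy⟩ _ _ e3 n3]
    simp [Fin.sum_univ_five, hu, hu', ratGrad, weight₁, weight₂, pderiv_X, Derivation.leibniz_pow]
    field_simp
  · intro g h hg hh A B A' B' hgA hhA hB hB'
    have := frame_identity .z0 (ratGrad A B w.1) (ratGrad A' B' w.1) (gradPoly ε w.1) u u'
      (by simp [hu]) (by simp [hu']) hφu hφu'
    rw [← hD ⟨g, hg⟩ A B hgA hB, ← hD ⟨h, hh⟩ A' B' hhA hB', ← hE ⟨g, hg⟩ A B hgA hB,
      ← hE ⟨h, hh⟩ A' B' hhA hB'] at this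
    rw [wedge, this]
    simp [hu, hu']

-- At the representative with t₀ = z = 1 the derivative by t₁ is -1, so `wedge_mul_gradPoly` can be
-- solved for the wedge product.
omit [IsAlgClosed k] in
theorem exists_wedge_eq_mul (w : surfaceCone ε) (h0 : w.1 0 ≠ 0) (h4 : w.1 4 ≠ 0)
    (hx : chartCoord ε 0 4 2 ∈ Surface.Reg (Surface.point w))
    (hy : chartCoord ε 0 4 3 ∈ Surface.Reg (Surface.point w)) {g h : Surface ε → k}
    (hg : g ∈ Surface.Reg (Surface.point w)) (hh : h ∈ Surface.Reg (Surface.point w)) :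
    ∃ c, ∀ D E, wedge hg hh D E = c * wedge hx hy D E := by
  have h04 : IsChartPair 0 4 := ⟨Or.inl rfl, Or.inr rfl⟩
  have key : ∀ q : Surface ε, Surface.point ⟨_, normalize_mem w.2 h0 h4⟩ = q →
      ∀ (hx : chartCoord ε 0 4 2 ∈ Surface.Reg q) (hy : chartCoord ε 0 4 3 ∈ Surface.Reg q)
        (hg : g ∈ Surface.Reg q) (hh : h ∈ Surface.Reg q),
        ∃ c, ∀ D E, wedge hg hh D E = c * wedge hx hy D E := by
    rintro _ rfl hx hy hg hh
    obtain ⟨d, A, B, hA, hB, hBv, hq⟩ := exists_isQuotient hg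
    obtain ⟨d', A', B', hA', hB', hBv', hq'⟩ := exists_isQuotient hh
    have hl := normalize_left h04 (v := w.1) h0
    have hr := normalize_right h04 (v := w.1) h0 h4
    refine ⟨-det3 2 3 1 (ratGrad A B (normalize 0 4 w.1)) (ratGrad A' B' (normalize 0 4 w.1))
      (gradPoly ε (normalize 0 4 w.1)), fun D E => ?_⟩
    have := wedge_mul_gradPoly .z0 ⟨_, normalize_mem w.2 h0 h4⟩ hl hr hg hh hB hq hBv hB' hq' hBv'
      hx hy D E
    rw [gradPoly_one] at this
    simp only [hl, hr] at this
    linear_combination -this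
  exact key _ (point_normalize w h0 h4) hx hy hg hh

/-- The canonical class is trivial: the coefficient c is found from the dual pair as det3 2 3 1 = -c
t₀ z, and passing to the normalised chart by `det3_eq_of_isBasic` divides by exactly t₀ z. Thus no
power of t₀ or z is left, and dx ∧ dy has no zero or pole along t₀ z = 0. -/
theorem wedge_eq_det3_mul {a b i j l : Fin 5} (hF : IsFrame a b i j l) (w : surfaceCone ε)
    (ha : w.1 a = 1) (hb : w.1 b = 1) (h0 : w.1 0 ≠ 0) (h4 : w.1 4 ≠ 0)
    (hx : chartCoord ε 0 4 2 ∈ Surface.Reg (Surface.point w))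
    (hy : chartCoord ε 0 4 3 ∈ Surface.Reg (Surface.point w)) {g h : Surface ε → k}
    (hg : g ∈ Surface.Reg (Surface.point w)) (hh : h ∈ Surface.Reg (Surface.point w))
    {A B A' B' : MvPolynomial (Fin 5) k} {d d' : ℕ × ℕ}
    (hA : IsWeightedHomogeneous (Surface.coordinates ε).weight A d)
    (hB : IsWeightedHomogeneous (Surface.coordinates ε).weight B d) (hgA : IsQuotient g A B)
    (hBv : eval w.1 B ≠ 0)
    (hA' : IsWeightedHomogeneous (Surface.coordinates ε).weight A' d')
    (hB' : IsWeightedHomogeneous (Surface.coordinates ε).weight B' d') (hhA : IsQuotient h A' B')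
    (hBv' : eval w.1 B' ≠ 0) (D E : tangentSpace k (Surface.point w)) :
    wedge hg hh D E =
      -det3 i j l (ratGrad A B w.1) (ratGrad A' B' w.1) (gradPoly ε w.1) * wedge hx hy D E := by
  obtain ⟨c, hc⟩ := exists_wedge_eq_mul w h0 h4 hx hy hg hh
  obtain ⟨D₁, E₁, h1, h2⟩ := exists_dual_pair w h0 h4 hx hy
  have h3 := h2 g h hg hh A B A' B' hgA hhA hBv hBv'
  have h5 := det3_eq_of_isBasic hF (isBasic_ratGrad hA hB w.1) (isBasic_ratGrad hA' hB' w.1)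
    (isBasic_gradPoly w)
  rw [hc D₁ E₁, h1, gradPoly_one] at h3
  rw [ha, hb, ← h3] at h5
  rw [hc D E]
  congr 1
  have : w.1 0 * w.1 4 * det3 i j l (ratGrad A B w.1) (ratGrad A' B' w.1) (gradPoly ε w.1) =
      w.1 0 * w.1 4 * -c := by
    rw [h5]; field_simp
  rw [mul_left_cancel₀ (mul_ne_zero h0 h4) this, neg_neg]

end Bracket

/-! ## Regular 2-forms on the surface -/

section Forms

variable {k : Type*} [Field k] {ε : k}

/-- The points with `t₀ z ≠ 0`. -/
def IsGeneric (q : Surface ε) : Prop :=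
  ∃ w : surfaceCone ε, Surface.point w = q ∧ w.1 0 ≠ 0 ∧ w.1 4 ≠ 0

theorem isChartPair_zero_four : IsChartPair 0 4 := ⟨Or.inl rfl, Or.inr rfl⟩

theorem IsGeneric.mem {q : Surface ε} (h : IsGeneric q) (i : Fin 5) :
    chartCoord ε 0 4 i ∈ Surface.Reg q := by
  obtain ⟨w, rfl, h0, h4⟩ := h
  exact chartCoord_mem isChartPair_zero_four i w h0 h4

theorem isGeneric_point {w : surfaceCone ε} :
    IsGeneric (Surface.point w) ↔ w.1 0 ≠ 0 ∧ w.1 4 ≠ 0 := by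
  refine ⟨?_, fun h => ⟨w, rfl, h⟩⟩
  rintro ⟨w', h, h0, h4⟩
  obtain ⟨α, β, hαβ⟩ := point_eq_iff.1 h
  constructor
  · intro h'
    rw [hαβ 0, h', mul_zero] at h0
    exact h0 rfl
  · intro h'
    rw [hαβ 4, h', mul_zero] at h4
    exact h4 rfl

/-- The form `dx ∧ dy` at the points with `t₀ z ≠ 0`. -/
def dxdy {q : Surface ε} (h : IsGeneric q) (D E : tangentSpace k q) : k :=
  wedge (h.mem 2) (h.mem 3) D E

/-- The function that represents the form `∑ f dg ∧ dh` in a chart. -/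
def bracketSum {n : ℕ} (i j l : Fin 5) (Af Bf Ag Bg Ah Bh : Fin n → MvPolynomial (Fin 5) k)
    (w : surfaceCone ε) : k :=
  ∑ s, eval w.1 (Af s) / eval w.1 (Bf s) *
    det3 i j l (ratGrad (Ag s) (Bg s) w.1) (ratGrad (Ah s) (Bh s) w.1) (gradPoly ε w.1)

theorem isRatAt_bracketSum {n : ℕ} (i j l : Fin 5)
    (Af Bf Ag Bg Ah Bh : Fin n → MvPolynomial (Fin 5) k) {v : Fin 5 → k}
    {W : Set (surfaceCone ε)} (hf : ∀ s, eval v (Bf s) ≠ 0) (hg : ∀ s, eval v (Bg s) ≠ 0)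
    (hh : ∀ s, eval v (Bh s) ≠ 0) : IsRatAt W v (bracketSum i j l Af Bf Ag Bg Ah Bh) := by
  refine IsRatAt.sum _ _ fun s _ => ?_
  have hG := fun m => isRatAt_ratGrad (W := W) (Ag s) (Bg s) (hg s) m
  have hH := fun m => isRatAt_ratGrad (W := W) (Ah s) (Bh s) (hh s) m
  have hP := fun m => isRatAt_eval (W := W) (v := v) (pderiv m (surfacePoly ε))
  exact (isRatAt_div _ _ (hf s)).mul
    ((((hG i).mul (((hH j).mul (hP l)).sub ((hH l).mul (hP j)))).sub
      ((hG j).mul (((hH i).mul (hP l)).sub ((hH l).mul (hP i))))).add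
      ((hG l).mul (((hH i).mul (hP j)).sub ((hH j).mul (hP i)))))

variable [CharP k 11] [IsAlgClosed k]

theorem exists_dxdy_ne_zero {q : Surface ε} (h : IsGeneric q) : ∃ D E, dxdy h D E ≠ 0 := by
  obtain ⟨w, rfl, h0, h4⟩ := id h
  obtain ⟨D, E, h1, -⟩ := exists_dual_pair w h0 h4 (h.mem 2) (h.mem 3)
  refine ⟨D, E, ?_⟩
  rw [dxdy, h1]
  exact div_ne_zero one_ne_zero (mul_ne_zero (pow_ne_zero _ h0) (pow_ne_zero _ h4))

/-- Near a point, the form `∑ f dg ∧ dh` is represented by a rational function in each chart. -/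
theorem exists_bracket {a b i j l : Fin 5} (hF : IsFrame a b i j l) (v : surfaceCone ε)
    {n : ℕ} {f g h : Fin n → Surface ε → k}
    (hf : ∀ s, f s ∈ Surface.Reg (Surface.point v))
    (hg : ∀ s, g s ∈ Surface.Reg (Surface.point v))
    (hh : ∀ s, h s ∈ Surface.Reg (Surface.point v)) :
    ∃ (β : surfaceCone ε → k) (B : MvPolynomial (Fin 5) k), eval v.1 B ≠ 0 ∧
      (∀ W, IsRatAt W v.1 β) ∧
      (∀ w : surfaceCone ε, w.1 a = 1 → w.1 b = 1 → eval w.1 B ≠ 0 →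
        ∀ (hgw : ∀ s, g s ∈ Surface.Reg (Surface.point w))
          (hhw : ∀ s, h s ∈ Surface.Reg (Surface.point w)),
          (∀ (hw : IsGeneric (Surface.point w)) (D E : tangentSpace k (Surface.point w)),
            ∑ s, f s (Surface.point w) * wedge (hgw s) (hhw s) D E = -β w * dxdy hw D E) ∧
          ∀ (hi : chartCoord ε a b i ∈ Surface.Reg (Surface.point w))
            (hj : chartCoord ε a b j ∈ Surface.Reg (Surface.point w))
            (D E : tangentSpace k (Surface.point w)),
            (∑ s, f s (Surface.point w) * wedge (hgw s) (hhw s) D E) * gradPoly ε w.1 l =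
              β w * wedge hi hj D E) := by
  choose df Af Bf hAf hBf hfv hfq using fun s => exists_isQuotient (hf s)
  choose dg Ag Bg hAg hBg hgv hgq using fun s => exists_isQuotient (hg s)
  choose dh Ah Bh hAh hBh hhv hhq using fun s => exists_isQuotient (hh s)
  refine ⟨bracketSum i j l Af Bf Ag Bg Ah Bh, ∏ s, (Bf s * Bg s * Bh s), ?_, ?_, ?_⟩
  · rw [map_prod]
    exact Finset.prod_ne_zero_iff.2 fun s _ => by simp [hfv s, hgv s, hhv s]
  · exact fun W => isRatAt_bracketSum i j l Af Bf Ag Bg Ah Bh hfv hgv hhv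
  · intro w ha hb hB hgw hhw
    rw [map_prod] at hB
    have hB' : ∀ s, (eval w.1 (Bf s) ≠ 0 ∧ eval w.1 (Bg s) ≠ 0) ∧ eval w.1 (Bh s) ≠ 0 := by
      intro s
      have := Finset.prod_ne_zero_iff.1 hB s (Finset.mem_univ s)
      simpa only [map_mul, ne_eq, mul_eq_zero, not_or] using this
    constructor
    · intro hw D E
      rw [bracketSum, ← Finset.sum_neg_distrib, Finset.sum_mul]
      refine Finset.sum_congr rfl fun s _ => ?_
      rw [wedge_eq_det3_mul hF w ha hb (isGeneric_point.1 hw).1 (isGeneric_point.1 hw).2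
        (hw.mem 2) (hw.mem 3) (hgw s) (hhw s) (hAg s) (hBg s) (hgq s) (hB' s).1.2 (hAh s) (hBh s)
        (hhq s) (hB' s).2, hfq s w (hB' s).1.1, dxdy]
      ring
    · intro hi hj D E
      rw [bracketSum, Finset.sum_mul, Finset.sum_mul]
      refine Finset.sum_congr rfl fun s _ => ?_
      rw [mul_assoc, wedge_mul_gradPoly hF w ha hb (hgw s) (hhw s) (hBg s) (hgq s) (hB' s).1.2
        (hBh s) (hhq s) (hB' s).2 hi hj, hfq s w (hB' s).1.1]
      ring

omit [CharP k 11] [IsAlgClosed k] in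
theorem eventually_mem {p : Surface ε} {n : ℕ} {f : Fin n → Surface ε → k}
    (hf : ∀ s, f s ∈ Surface.Reg p) : ∀ᶠ q in nhds p, ∀ s, f s ∈ Surface.Reg q :=
  Filter.eventually_all.2 fun s => FunctionSheaf.eventually (hf s)

/-- A regular form that vanishes on the points with `t₀ z ≠ 0` near a point vanishes at it. -/
theorem sum_wedge_eq_zero (p : Surface ε) {n : ℕ} {f g h : Fin n → Surface ε → k}
    (hf : ∀ s, f s ∈ Surface.Reg p) (hg : ∀ s, g s ∈ Surface.Reg p)
    (hh : ∀ s, h s ∈ Surface.Reg p)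
    (hzero : ∀ᶠ q in nhds p, ∀ (hg : ∀ s, g s ∈ Surface.Reg q) (hh : ∀ s, h s ∈ Surface.Reg q),
      IsGeneric q → ∀ D E : tangentSpace k q, ∑ s, f s q * wedge (hg s) (hh s) D E = 0)
    (D E : tangentSpace k p) : ∑ s, f s p * wedge (hg s) (hh s) D E = 0 := by
  obtain ⟨a, b, i, j, l, hF, v, rfl, ha, hb, hl⟩ := exists_good_frame p
  have ha' : v.1 a ≠ 0 := by simp [ha]
  have hb' : v.1 b ≠ 0 := by simp [hb]
  obtain ⟨β, B, hBv, hβ, hw⟩ := exists_bracket hF v hf hg hh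
  obtain ⟨A', B', hB', hAB⟩ := hβ Set.univ
  obtain ⟨d, S, hS, hSv, hSw⟩ := (eventually_point_iff v).1
    (hzero.and ((eventually_mem hg).and (eventually_mem hh)))
  -- The numerator of the coefficient β vanishes at the nearby points with t₀ z ≠ 0, hence also at
  -- v.
  have hA' : eval v.1 A' = 0 := by
    refine eval_eq_zero_of_generic hF.isChartPair v ha hb (B := S * B) (by simp [hSv, hBv]) ?_
    intro w hwa hwb h0 h4 hne
    simp only [map_mul, ne_eq, mul_eq_zero, not_or] at hne
    obtain ⟨hz, hgw, hhw⟩ := hSw w hne.1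
    have hgen : IsGeneric (Surface.point w) := isGeneric_point.2 ⟨h0, h4⟩
    obtain ⟨D, E, hDE⟩ := exists_dxdy_ne_zero hgen
    have h1 := (hw w hwa hwb hne.2 hgw hhw).1 hgen D E
    rw [hz hgw hhw hgen D E] at h1
    have h2 : β w = 0 := neg_eq_zero.1 ((mul_eq_zero.1 h1.symm).resolve_right hDE)
    rw [← hAB w trivial, h2, zero_mul]
  have hβv : β v = 0 := by
    have := hAB v trivial
    rw [hA'] at this
    exact (mul_eq_zero.1 this).resolve_right hB'
  have := (hw v ha hb hBv hg hh).2 (chartCoord_mem hF.isChartPair i v ha' hb')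
    (chartCoord_mem hF.isChartPair j v ha' hb') D E
  rw [hβv, zero_mul] at this
  exact (mul_eq_zero.1 this).resolve_right hl

omit [CharP k 11] [IsAlgClosed k] in
theorem TwoFormField.ext_apply {ω η : TwoFormField k (Surface ε)}
    (h : ∀ q (D E : tangentSpace k q), ω q ![D, E] = η q ![D, E]) : ω = η := by
  funext q
  ext m
  have := h q (m 0) (m 1)
  rwa [show ![m 0, m 1] = m from by funext i; fin_cases i <;> rfl] at this

/-- Regular forms that agree at the points with `t₀ z ≠ 0` are equal. -/
theorem TwoFormField.IsRegular.ext_generic {ω η : TwoFormField k (Surface ε)}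
    (hω : ω.IsRegular) (hη : η.IsRegular)
    (h : ∀ q, IsGeneric q → ∀ D E : tangentSpace k q, ω q ![D, E] = η q ![D, E]) : ω = η := by
  refine TwoFormField.ext_apply fun p D E => ?_
  obtain ⟨n, f, g, h₁, H⟩ := hω p
  obtain ⟨n', f', g', h₁', H'⟩ := hη p
  obtain ⟨hf, hg, hh, e⟩ := H.self_of_nhds
  obtain ⟨hf', hg', hh', e'⟩ := H'.self_of_nhds
  -- The difference of the two local expressions is again one expression, with concatenated families
  -- and the sign put into the coefficients f'.
  have key : ∀ (q : Surface ε) (hg : ∀ s, g s ∈ Surface.Reg q) (hh : ∀ s, h₁ s ∈ Surface.Reg q)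
      (hg' : ∀ s, g' s ∈ Surface.Reg q) (hh' : ∀ s, h₁' s ∈ Surface.Reg q)
      (hG : ∀ s, Fin.append g g' s ∈ Surface.Reg q)
      (hH : ∀ s, Fin.append h₁ h₁' s ∈ Surface.Reg q) (D E : tangentSpace k q),
      ∑ s, Fin.append f (-f') s q * wedge (hG s) (hH s) D E =
        ∑ s, f s q * wedge (hg s) (hh s) D E - ∑ s, f' s q * wedge (hg' s) (hh' s) D E := by
    intro q hg hh hg' hh' hG hH D E
    rw [Fin.sum_univ_add, sub_eq_add_neg, ← Finset.sum_neg_distrib]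
    congr 1
    · refine Finset.sum_congr rfl fun s _ => ?_
      simp only [wedge, Fin.append_left]
    · refine Finset.sum_congr rfl fun s _ => ?_
      simp only [wedge, Fin.append_right, Pi.neg_apply]
      ring
  have mem : ∀ (q : Surface ε) (u : Fin n → Surface ε → k) (u' : Fin n' → Surface ε → k),
      (∀ s, u s ∈ Surface.Reg q) → (∀ s, u' s ∈ Surface.Reg q) →
      ∀ s, Fin.append u u' s ∈ Surface.Reg q := by
    intro q u u' hu hu' s
    refine Fin.addCases (fun s => ?_) (fun s => ?_) s
    · rw [Fin.append_left]; exact hu s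
    · rw [Fin.append_right]; exact hu' s
  have hz := sum_wedge_eq_zero p (mem p f (-f') hf fun s => neg_mem (hf' s)) (mem p g g' hg hg')
    (mem p h₁ h₁' hh hh') (by
      filter_upwards [H, H'] with q Hq Hq' hG hH hgen D E
      obtain ⟨-, hg, hh, e⟩ := Hq
      obtain ⟨-, hg', hh', e'⟩ := Hq'
      rw [key q hg hh hg' hh' hG hH, sub_eq_zero]
      exact (e D E).symm.trans ((h q hgen D E).trans (e' D E))) D E
  rw [key p hg hh hg' hh', sub_eq_zero] at hz
  exact (e D E).trans (hz.trans (e' D E).symm)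

/-- A regular form is a constant multiple of `dx ∧ dy` at the points with `t₀ z ≠ 0`. -/
theorem TwoFormField.IsRegular.exists_eq_const {ω : TwoFormField k (Surface ε)}
    (hω : ω.IsRegular) : ∃ c : k, ∀ q (hq : IsGeneric q) (D E : tangentSpace k q),
      ω q ![D, E] = c * dxdy hq D E := by
  have hpt : ∀ q, ∃ c : k, ∀ (hq : IsGeneric q) (D E : tangentSpace k q),
      ω q ![D, E] = c * dxdy hq D E := by
    intro q
    by_cases hq : IsGeneric q
    · obtain ⟨w, rfl, h0, h4⟩ := id hq
      obtain ⟨n, f, g, h, H⟩ := hω (Surface.point w)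
      obtain ⟨hf, hg, hh, e⟩ := H.self_of_nhds
      choose c hc using fun s => exists_wedge_eq_mul w h0 h4 (hq.mem 2) (hq.mem 3) (hg s) (hh s)
      refine ⟨∑ s, f s (Surface.point w) * c s, fun _ D E => (e D E).trans ?_⟩
      rw [Finset.sum_mul]
      refine Finset.sum_congr rfl fun s _ => ?_
      have := hc s D E
      rw [wedge] at this
      rw [this, mul_assoc]
      rfl
    · exact ⟨0, fun h => absurd h hq⟩
  choose F hF using hpt
  obtain ⟨c, hc⟩ := K3Eleven.exists_eq_const F (by
    intro a b hab v ha hb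
    obtain ⟨i, j, l, hfr⟩ := hab.exists_isFrame
    obtain ⟨n, f, g, h, H⟩ := hω (Surface.point v)
    obtain ⟨hf, hg, hh, -⟩ := H.self_of_nhds
    obtain ⟨β, B, hBv, hβ, hw⟩ := exists_bracket hfr v hf hg hh
    obtain ⟨d, S, hS, hSv, hSw⟩ := (eventually_point_iff v).1 H
    -- On the chart the coefficient F is -β near v, and β has no pole at v.
    refine IsRatAt.congr (B := S * B) (by simp [hSv, hBv]) (hβ _).neg ?_
    rintro w ⟨hwa, hwb, h0, h4⟩ hne
    simp only [map_mul, ne_eq, mul_eq_zero, not_or] at hne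
    obtain ⟨-, hgw, hhw, e⟩ := hSw w hne.1
    have hgen : IsGeneric (Surface.point w) := isGeneric_point.2 ⟨h0, h4⟩
    obtain ⟨D, E, hDE⟩ := exists_dxdy_ne_zero hgen
    have h1 := (hw w hwa hwb hne.2 hgw hhw).1 hgen D E
    exact mul_right_cancel₀ hDE ((hF _ hgen D E).symm.trans ((e D E).trans h1)))
  refine ⟨c, fun q hq D E => ?_⟩
  obtain ⟨w, rfl, h0, h4⟩ := id hq
  rw [hF _ hq, hc w h0 h4]

/-- Near each point there is an expression `f dg ∧ dh` of the form `dx ∧ dy`. -/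
theorem exists_local_dxdy (p : Surface ε) : ∃ f g h : Surface ε → k, ∀ᶠ q in nhds p,
    f ∈ Surface.Reg q ∧ ∃ (hg : g ∈ Surface.Reg q) (hh : h ∈ Surface.Reg q),
      ∀ (hq : IsGeneric q) (D E : tangentSpace k q), f q * wedge hg hh D E = dxdy hq D E := by
  obtain ⟨a, b, i, j, l, hF, v, rfl, ha, hb, hl⟩ := exists_good_frame p
  have hab := hF.isChartPair
  have ha' : v.1 a ≠ 0 := by simp [ha]
  have hb' : v.1 b ≠ 0 := by simp [hb]
  let c : Fin 5 → Surface.Reg (Surface.point v) :=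
    fun m => ⟨chartCoord ε a b m, chartCoord_mem hab m v ha' hb'⟩
  -- The residue formula: with G the derivative of the equation by the coordinate l, the form is
  -- -G⁻¹ dcᵢ ∧ dcⱼ in the chart coordinates c. The frame was chosen so that G does not vanish at v.
  let G : Surface ε → k := (aeval c (pderiv l (surfacePoly ε))).1
  have hGw : ∀ w : surfaceCone ε, G (Surface.point w) = gradPoly ε (normalize a b w.1) l := by
    intro w
    simp only [G]
    rw [aeval_apply, gradPoly]
    congr 2
    funext m
    exact chartCoord_point hab m w
  have hGv : G (Surface.point v) ≠ 0 := by rwa [hGw, normalize_of_eq_one ha hb]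
  have hG : G ∈ Surface.Reg (Surface.point v) := (aeval c (pderiv l (surfacePoly ε))).2
  have hGi := (HomogeneousCoordinates.IsRegularAt.inv (Surface.coordinates ε) hG hGv)
  have hf : (fun q => -(G q)⁻¹) ∈ Surface.Reg (Surface.point v) := neg_mem (S := Subalgebra k _) hGi
  refine ⟨fun q => -(G q)⁻¹, chartCoord ε a b i, chartCoord ε a b j, ?_⟩
  have hne : ∀ᶠ q in nhds (Surface.point v), G q ≠ 0 := by
    obtain ⟨d, A, B, hA, hB, hBv, hq⟩ := exists_isQuotient hG
    have hAv : eval v.1 A ≠ 0 := by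
      intro h0
      rw [hq v hBv, h0, zero_div] at hGv
      exact hGv rfl
    refine (eventually_point_iff v).2 ⟨_, A * B, hA.mul hB, by simp [hAv, hBv], fun w hw => ?_⟩
    simp only [map_mul, ne_eq, mul_eq_zero, not_or] at hw
    rw [hq w hw.2]
    exact div_ne_zero hw.1 hw.2
  filter_upwards [FunctionSheaf.eventually hf, hne, eventually_ne_zero v a ha',
    eventually_ne_zero v b hb'] with q hfq hGq hqa hqb
  obtain ⟨w, rfl⟩ := (Surface.coordinates ε).surjective q
  have hwa := hqa w rfl
  have hwb := hqb w rfl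
  refine ⟨hfq, chartCoord_mem hab i w hwa hwb, chartCoord_mem hab j w hwa hwb, ?_⟩
  clear hfq
  have hpt : Surface.point ⟨_, normalize_mem w.2 hwa hwb⟩ = (Surface.coordinates ε).toPoint w :=
    point_normalize w hwa hwb
  have hGq' := hGw w
  rw [show Surface.point w = (Surface.coordinates ε).toPoint w from rfl] at hGq'
  rw [hGq'] at hGq
  simp only [hGq']
  revert hGq
  -- The tangent space depends on the point, so the point is generalised before it is replaced by
  -- its normalised representative.
  suffices H : ∀ q, Surface.point ⟨_, normalize_mem w.2 hwa hwb⟩ = q →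
      ∀ (hg : chartCoord ε a b i ∈ Surface.Reg q) (hh : chartCoord ε a b j ∈ Surface.Reg q)
        (hq : IsGeneric q) (D E : tangentSpace k q), gradPoly ε (normalize a b w.1) l ≠ 0 →
        -(gradPoly ε (normalize a b w.1) l)⁻¹ * wedge hg hh D E = dxdy hq D E by
    intro hne hq D E
    exact H _ hpt _ _ hq D E hne
  rintro _ rfl hg hh hq D E hne
  have hl := normalize_left hab (v := w.1) hwa
  have hr := normalize_right hab (v := w.1) hwa hwb
  have hX := isWeightedHomogeneous_X k (Surface.coordinates ε).weight
  have e := fun m => chartCoord_isQuotient (ε := ε) hab m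
  have hA : ∀ m, IsWeightedHomogeneous (Surface.coordinates ε).weight
      (X m * X a ^ (weight₁ b * weight₂ m) : MvPolynomial (Fin 5) k)
      (weight₁ m + weight₁ b * weight₂ m, weight₂ m) := by
    intro m
    convert (hX m).mul ((hX a).pow (weight₁ b * weight₂ m)) using 1
    rw [weight_eq, weight_eq, hab.weights.1, hab.weights.2.1]
    ext <;> simp
  have hB : ∀ m, IsWeightedHomogeneous (Surface.coordinates ε).weight
      (X a ^ weight₁ m * X b ^ weight₂ m : MvPolynomial (Fin 5) k)
      (weight₁ m + weight₁ b * weight₂ m, weight₂ m) := by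
    intro m
    convert ((hX a).pow (weight₁ m)).mul ((hX b).pow (weight₂ m)) using 1
    rw [weight_eq, weight_eq, hab.weights.1, hab.weights.2.1, hab.weights.2.2]
    ext <;> simp [mul_comm]
  have hn : ∀ m, eval (normalize a b w.1) (X a ^ weight₁ m * X b ^ weight₂ m) ≠ 0 := by
    intro m
    simp [hl, hr]
  have := wedge_eq_det3_mul hF ⟨_, normalize_mem w.2 hwa hwb⟩ hl hr (isGeneric_point.1 hq).1
    (isGeneric_point.1 hq).2 (hq.mem 2) (hq.mem 3) hg hh (hA i) (hB i) (e i) (hn i)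
    (hA j) (hB j) (e j) (hn j) D E
  rw [this]
  have hrat : ∀ m m', m' ≠ a → m' ≠ b → ratGrad (X m * X a ^ (weight₁ b * weight₂ m))
      (X a ^ weight₁ m * X b ^ weight₂ m) (normalize a b w.1) m' = if m = m' then 1 else 0 := by
    intro m m' h1 h2
    simp [ratGrad, pderiv_X, Derivation.leibniz_pow, hl, hr, Pi.single_apply, h1.symm, h2.symm]
    split_ifs <;> simp [hl]
  -- The first two rows are unit vectors in the columns i, j, l, so only the l-th entry of the
  -- gradient remains.
  have hdet : det3 i j l (ratGrad (X i * X a ^ (weight₁ b * weight₂ i))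
      (X a ^ weight₁ i * X b ^ weight₂ i) (normalize a b w.1))
      (ratGrad (X j * X a ^ (weight₁ b * weight₂ j))
      (X a ^ weight₁ j * X b ^ weight₂ j) (normalize a b w.1))
      (gradPoly ε (normalize a b w.1)) = gradPoly ε (normalize a b w.1) l := by
    have : i ≠ a ∧ i ≠ b ∧ j ≠ a ∧ j ≠ b ∧ l ≠ a ∧ l ≠ b ∧ i ≠ j ∧ i ≠ l ∧ j ≠ l := by
      cases hF <;> decide
    obtain ⟨ia, ib, ja, jb, la, lb, ij, il, jl⟩ := this
    rw [det3, hrat i i ia ib, hrat j j ja jb, hrat j l la lb, hrat j i ia ib, hrat i j ja jb,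
      hrat i l la lb]
    simp [ij, ij.symm, il, jl]
  simp only [hdet]
  rw [dxdy]
  field_simp

/-- The alternating form `c dg ∧ dh` on a tangent space. -/
def wedgeForm {q : Surface ε} {g h : Surface ε → k} (hg : g ∈ Surface.Reg q)
    (hh : h ∈ Surface.Reg q) (c : k) : tangentSpace k q [⋀^Fin 2]→ₗ[k] k where
  toFun m := c * wedge hg hh (m 0) (m 1)
  map_update_add' := by
    intro inst m i x y
    rw [Subsingleton.elim inst (instDecidableEqFin 2)]
    fin_cases i <;> simp [wedge] <;> ring
  map_update_smul' := by
    intro inst m i c x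
    rw [Subsingleton.elim inst (instDecidableEqFin 2)]
    fin_cases i <;> simp [wedge] <;> ring
  map_eq_zero_of_eq' := by
    intro m i j h hij
    have : m 0 = m 1 := by
      fin_cases i <;> fin_cases j <;> first | exact absurd rfl hij | exact h | exact h.symm
    rw [wedge, this, sub_self, mul_zero]

variable (ε) in
/-- The surface has a regular form that is equal to `dx ∧ dy` at the points with `t₀ z ≠ 0`. -/
theorem exists_regular_form : ∃ ω : TwoFormField k (Surface ε), ω.IsRegular ∧
    ∀ q (hq : IsGeneric q) (D E : tangentSpace k q), ω q ![D, E] = dxdy hq D E := by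
  choose f g h H using fun p : Surface ε => exists_local_dxdy p
  have H₀ := fun p => (H p).self_of_nhds
  choose hf hg hh e using H₀
  -- The expressions chosen at different points agree where t₀ z ≠ 0, hence wherever both are
  -- regular. So the form assembled pointwise is given near p by the single expression chosen at p.
  have key : ∀ p, ∀ᶠ q in nhds p, f p ∈ Surface.Reg q ∧ ∃ (hg' : g p ∈ Surface.Reg q)
      (hh' : h p ∈ Surface.Reg q), ∀ D E : tangentSpace k q,
        f q q * wedge (hg q) (hh q) D E = f p q * wedge hg' hh' D E := by
    intro p
    filter_upwards [(H p).eventually_nhds] with q hq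
    obtain ⟨hf', hg', hh', e'⟩ := hq.self_of_nhds
    refine ⟨hf', hg', hh', fun D E => ?_⟩
    have mem : ∀ (u u' : Surface ε → k) (y : Surface ε), u ∈ Surface.Reg y → u' ∈ Surface.Reg y →
        ∀ s : Fin 2, (![u, u'] : Fin 2 → Surface ε → k) s ∈ Surface.Reg y := by
      intro u u' y h1 h2 s
      fin_cases s
      exacts [h1, h2]
    have hz := sum_wedge_eq_zero q (mem (f q) (-f p) q (hf q) (neg_mem hf'))
      (mem (g q) (g p) q (hg q) hg') (mem (h q) (h p) q (hh q) hh') (by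
        filter_upwards [H q, hq] with y h1 h2 hG hH hgen D E
        obtain ⟨-, hg1, hh1, e1⟩ := h1
        obtain ⟨-, hg2, hh2, e2⟩ := h2
        rw [Fin.sum_univ_two]
        have e3 := (e1 hgen D E).trans (e2 hgen D E).symm
        change f q y * wedge hg1 hh1 D E + (-f p y) * wedge hg2 hh2 D E = 0
        rw [e3]; ring) D E
    rw [Fin.sum_univ_two] at hz
    change f q q * wedge (hg q) (hh q) D E + (-f p q) * wedge hg' hh' D E = 0 at hz
    linear_combination hz
  refine ⟨fun p => wedgeForm (hg p) (hh p) (f p p), fun p => ?_, fun q hq D E => e q hq D E⟩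
  refine ⟨1, fun _ => f p, fun _ => g p, fun _ => h p, ?_⟩
  filter_upwards [key p] with q hq
  obtain ⟨hf', hg', hh', e'⟩ := hq
  refine ⟨fun _ => hf', fun _ => hg', fun _ => hh', fun D E => ?_⟩
  rw [Fin.sum_univ_one]
  exact e' D E

omit [CharP k 11] [IsAlgClosed k] in
theorem TwoFormField.IsRegular.pullback {ω : TwoFormField k (Surface ε)} (hω : ω.IsRegular)
    (φ : VarietyAut k (Surface ε)) : (ω.pullback φ).IsRegular := by
  intro x
  obtain ⟨n, f, g, h, H⟩ := hω (φ.1 x)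
  refine ⟨n, fun i => f i ∘ φ.1, fun i => g i ∘ φ.1, fun i => h i ∘ φ.1, ?_⟩
  filter_upwards [φ.2.1.continuous.continuousAt.eventually H] with y hy
  obtain ⟨hf, hg, hh, e⟩ := hy
  refine ⟨fun i => φ.2.1.regular y _ (hf i), fun i => φ.2.1.regular y _ (hg i),
    fun i => φ.2.1.regular y _ (hh i), fun D E => ?_⟩
  have := e (tangentMap φ.2.1 y D) (tangentMap φ.2.1 y E)
  rw [TwoFormField.pullback, AlternatingMap.compLinearMap_apply]
  refine Eq.trans ?_ this
  congr 1
  funext i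
  fin_cases i <;> rfl

omit [CharP k 11] [IsAlgClosed k] in
theorem TwoFormField.IsRegular.smul {ω : TwoFormField k (Surface ε)} (hω : ω.IsRegular)
    (c : k) : TwoFormField.IsRegular (fun q => c • ω q) := by
  intro x
  obtain ⟨n, f, g, h, H⟩ := hω x
  refine ⟨n, fun i => c • f i, g, h, ?_⟩
  filter_upwards [H] with y hy
  obtain ⟨hf, hg, hh, e⟩ := hy
  refine ⟨fun i => Subalgebra.smul_mem _ (hf i) c, hg, hh, fun D E => ?_⟩
  rw [AlternatingMap.smul_apply, e, Finset.smul_sum]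
  refine Finset.sum_congr rfl fun s _ => ?_
  simp only [Pi.smul_apply, smul_eq_mul]
  ring

/-- An automorphism is symplectic if and only if it multiplies `dx ∧ dy` by `1` at some point. -/
theorem isSymplectic_iff (φ : VarietyAut k (Surface ε)) {c : k} {q : Surface ε}
    (hq : IsGeneric q) (hφq : IsGeneric (φ.1 q))
    (h : ∀ D E : tangentSpace k q,
      dxdy hφq (tangentMap φ.2.1 q D) (tangentMap φ.2.1 q E) = c * dxdy hq D E) :
    IsSymplectic φ ↔ c = 1 := by
  obtain ⟨ω₀, hreg, hω₀⟩ := exists_regular_form ε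
  have happ : ∀ (ω : TwoFormField k (Surface ε)) (y : Surface ε) (D E : tangentSpace k y),
      ω.pullback φ y ![D, E] = ω (φ.1 y) ![tangentMap φ.2.1 y D, tangentMap φ.2.1 y E] := by
    intro ω y D E
    rw [TwoFormField.pullback, AlternatingMap.compLinearMap_apply]
    congr 1
    funext i
    fin_cases i <;> rfl
  -- The pullback is again regular, so it is a constant multiple of dx ∧ dy, and the constant is
  -- identified at the point q.
  obtain ⟨c', hc'⟩ := (hreg.pullback φ).exists_eq_const
  obtain ⟨D₀, E₀, hDE⟩ := exists_dxdy_ne_zero hq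
  have hcc : c' = c := by
    have h1 := hc' q hq D₀ E₀
    rw [happ, hω₀ _ hφq, h] at h1
    exact (mul_right_cancel₀ hDE h1).symm
  subst hcc
  constructor
  · rintro ⟨ω, hω, hne, hinv⟩
    obtain ⟨d, hd⟩ := hω.exists_eq_const
    by_contra hc1
    apply hne
    have hd0 : d = 0 := by
      have h1 := happ ω q D₀ E₀
      rw [hinv, hd q hq, hd _ hφq, h] at h1
      have h2 : d * (c' - 1) = 0 := by
        apply mul_right_cancel₀ hDE
        linear_combination -h1
      exact (mul_eq_zero.1 h2).resolve_right (sub_ne_zero.2 hc1)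
    refine hω.ext_generic (η := 0) ?_ fun q hq D E => ?_
    · have := hω.smul 0
      simp only [zero_smul] at this
      exact this
    · rw [hd q hq, hd0, zero_mul]; rfl
  · rintro rfl
    refine ⟨ω₀, hreg, ?_, (hreg.pullback φ).ext_generic hreg fun q hq D E => ?_⟩
    · rintro rfl
      exact hDE (hω₀ q hq D₀ E₀).symm
    · rw [hc' q hq, hω₀ q hq, one_mul]

end Forms

/-! ## Automorphisms of the projective line -/

section Moebius

variable {k : Type*} [Field k]

/-- The point of the projective line with given homogeneous coordinates. -/
abbrev P1.point (v : (P1.coordinates k).cone) : P1 k := (P1.coordinates k).toPoint v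

theorem P1.point_eq_iff {v w : (P1.coordinates k).cone} :
    P1.point v = P1.point w ↔ ∃ a : kˣ, ∀ i, v.1 i = a * w.1 i := by
  have h : P1.point v = P1.point w ↔ ∃ a : kˣ, a • w.1 = v.1 :=
    Projectivization.mk_eq_mk_iff k v.1 w.1 v.2 w.2
  rw [h]
  refine exists_congr fun a => ⟨fun h i => by rw [← h]; rfl, fun h => ?_⟩
  funext i
  rw [h i]; rfl

theorem mulVec_ne_zero (A : GL (Fin 2) k) {v : Fin 2 → k} (hv : v ≠ 0) : A.1.mulVec v ≠ 0 := by
  intro h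
  apply hv
  have := congrArg (A⁻¹).1.mulVec h
  rwa [Matrix.mulVec_mulVec, ← Units.val_mul, inv_mul_cancel, Units.val_one, Matrix.one_mulVec,
    Matrix.mulVec_zero] at this

/-- The linear action on coordinate vectors. -/
def coneMap (A : GL (Fin 2) k) (v : (P1.coordinates k).cone) : (P1.coordinates k).cone :=
  ⟨A.1.mulVec v.1, mulVec_ne_zero A v.2⟩

/-- The permutation of the projective line given by an invertible matrix. -/
def moebiusPerm (A : GL (Fin 2) k) : Equiv.Perm (P1 k) where
  toFun := Projectivization.map A.1.mulVecLin (fun v w h => by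
    by_contra hne
    exact mulVec_ne_zero A (sub_ne_zero.2 hne) (by rw [Matrix.mulVec_sub]; exact sub_eq_zero.2 h))
  invFun := Projectivization.map (A⁻¹).1.mulVecLin (fun v w h => by
    by_contra hne
    exact mulVec_ne_zero A⁻¹ (sub_ne_zero.2 hne)
      (by rw [Matrix.mulVec_sub]; exact sub_eq_zero.2 h))
  left_inv := by
    intro x
    obtain ⟨v, rfl⟩ := (P1.coordinates k).surjective x
    refine P1.point_eq_iff (v := coneMap A⁻¹ (coneMap A v)).2 ⟨1, fun i => ?_⟩
    simp only [coneMap, Matrix.mulVec_mulVec, ← Units.val_mul, inv_mul_cancel, Units.val_one,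
      Matrix.one_mulVec, one_mul]
  right_inv := by
    intro x
    obtain ⟨v, rfl⟩ := (P1.coordinates k).surjective x
    refine P1.point_eq_iff (v := coneMap A (coneMap A⁻¹ v)).2 ⟨1, fun i => ?_⟩
    simp only [coneMap, Matrix.mulVec_mulVec, ← Units.val_mul, mul_inv_cancel, Units.val_one,
      Matrix.one_mulVec, one_mul]

theorem moebiusPerm_point (A : GL (Fin 2) k) (v : (P1.coordinates k).cone) :
    moebiusPerm A (P1.point v) = P1.point (coneMap A v) := rfl

theorem moebiusPerm_symm_point (A : GL (Fin 2) k) (v : (P1.coordinates k).cone) :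
    (moebiusPerm A).symm (P1.point v) = P1.point (coneMap A⁻¹ v) := rfl

theorem linear_homogeneous (A : GL (Fin 2) k) (i : Fin 2) :
    IsWeightedHomogeneous (P1.coordinates k).weight (∑ j, C (A.1 i j) * X j : MvPolynomial _ k)
      ((P1.coordinates k).weight i) :=
  IsWeightedHomogeneous.sum _ _ _ fun j _ => (isWeightedHomogeneous_X k _ j).C_mul _

theorem coneMap_eval (A : GL (Fin 2) k) (v : (P1.coordinates k).cone) (i : Fin 2) :
    (coneMap A v).1 i = eval v.1 (∑ j, C (A.1 i j) * X j : MvPolynomial _ k) := by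
  simp only [coneMap, Matrix.mulVec, dotProduct, map_sum, map_mul, eval_C, eval_X]

variable (k) in
/-- The action of invertible matrices on the projective line. -/
def moebius : GL (Fin 2) k →* VarietyAut k (P1 k) where
  toFun A := (P1.coordinates k).autOfPolynomial _ _ (linear_homogeneous A) (linear_homogeneous A⁻¹)
    (coneMap A) (coneMap A⁻¹) (coneMap_eval A) (coneMap_eval A⁻¹) (moebiusPerm A)
    (moebiusPerm_point A) (moebiusPerm_symm_point A)
  map_one' := by
    apply Subtype.ext
    apply Equiv.ext
    intro x
    obtain ⟨v, rfl⟩ := (P1.coordinates k).surjective x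
    refine P1.point_eq_iff (v := coneMap 1 v).2 ⟨1, fun i => ?_⟩
    simp [coneMap]
  map_mul' A B := by
    apply Subtype.ext
    apply Equiv.ext
    intro x
    obtain ⟨v, rfl⟩ := (P1.coordinates k).surjective x
    refine P1.point_eq_iff (v := coneMap (A * B) v) (w := coneMap A (coneMap B v)).2
      ⟨1, fun i => ?_⟩
    simp only [coneMap, Units.val_mul, Matrix.mulVec_mulVec, Units.val_one, one_mul]

theorem moebius_point (A : GL (Fin 2) k) (v : (P1.coordinates k).cone) :
    (moebius k A).1 (P1.point v) = P1.point (coneMap A v) := rfl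

/-- The three points [1:0], [0:1] and [1:1] are enough to force a scalar matrix. -/
theorem moebius_eq_one_iff (A : GL (Fin 2) k) :
    moebius k A = 1 ↔ A.1 0 1 = 0 ∧ A.1 1 0 = 0 ∧ A.1 0 0 = A.1 1 1 := by
  constructor
  · intro h
    have h' : ∀ v : (P1.coordinates k).cone, ∃ a : kˣ, ∀ i, (coneMap A v).1 i = a * v.1 i := by
      intro v
      rw [← P1.point_eq_iff, ← moebius_point, h]
      rfl
    have n0 : (![1, 0] : Fin 2 → k) ≠ 0 := fun h => by simpa using congrFun h 0
    have n1 : (![0, 1] : Fin 2 → k) ≠ 0 := fun h => by simpa using congrFun h 1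
    have n2 : (![1, 1] : Fin 2 → k) ≠ 0 := fun h => by simpa using congrFun h 1
    obtain ⟨a, ha⟩ := h' ⟨_, n0⟩
    obtain ⟨b, hb⟩ := h' ⟨_, n1⟩
    obtain ⟨c, hc⟩ := h' ⟨_, n2⟩
    have ha1 := ha 1
    have hb0 := hb 0
    have hc0 := hc 0
    have hc1 := hc 1
    simp [coneMap] at ha1 hb0 hc0 hc1
    refine ⟨hb0, ha1, ?_⟩
    rw [hb0] at hc0
    rw [ha1] at hc1
    linear_combination hc0 - hc1
  · rintro ⟨h1, h2, h3⟩
    apply Subtype.ext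
    apply Equiv.ext
    intro x
    obtain ⟨v, rfl⟩ := (P1.coordinates k).surjective x
    have hne : A.1 1 1 ≠ 0 := by
      intro h0
      have hdet := (Matrix.isUnits_det_units A).ne_zero
      rw [Matrix.det_fin_two, h1, h0] at hdet
      simp at hdet
    refine P1.point_eq_iff (v := coneMap A v).2 ⟨Units.mk0 _ hne, fun i => ?_⟩
    fin_cases i <;> simp [coneMap, h1, h2, h3]

/-- The points of the affine line. -/
def affinePoint (t : k) : P1 k :=
  P1.point ⟨![1, t], fun h => by simpa using congrFun h 0⟩

variable (k) in
/-- The point at infinity. -/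
def infPoint : P1 k := P1.point ⟨![0, 1], fun h => by simpa using congrFun h 1⟩

theorem eq_affinePoint {v : (P1.coordinates k).cone} (h : v.1 0 ≠ 0) :
    P1.point v = affinePoint (v.1 1 / v.1 0) := by
  refine P1.point_eq_iff.2 ⟨Units.mk0 _ h, fun i => ?_⟩
  fin_cases i
  · simp
  · simp; field_simp

theorem eq_infPoint {v : (P1.coordinates k).cone} (h : v.1 0 = 0) : P1.point v = infPoint k := by
  have h1 : v.1 1 ≠ 0 := by
    intro h1
    apply v.2
    funext i
    fin_cases i
    exacts [h, h1]
  refine P1.point_eq_iff.2 ⟨Units.mk0 _ h1, fun i => ?_⟩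
  fin_cases i <;> simp [h]

theorem affinePoint_injective {s t : k} (h : affinePoint s = affinePoint t) : s = t := by
  obtain ⟨a, ha⟩ := P1.point_eq_iff.1 h
  have h0 := ha 0
  have h1 := ha 1
  simp at h0 h1
  rw [h1, ← h0, one_mul]

theorem affinePoint_ne_infPoint (t : k) : affinePoint t ≠ infPoint k := by
  intro h
  obtain ⟨a, ha⟩ := P1.point_eq_iff.1 h
  simpa using ha 0

theorem P1.eq_affinePoint_or (x : P1 k) : (∃ t, x = affinePoint t) ∨ x = infPoint k := by
  obtain ⟨v, rfl⟩ := (P1.coordinates k).surjective x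
  by_cases h : v.1 0 = 0
  · exact Or.inr (eq_infPoint h)
  · exact Or.inl ⟨_, eq_affinePoint h⟩

/-- The affine coordinate. -/
def affineCoord (x : P1 k) : k := (Projectivization.rep x) 1 / (Projectivization.rep x) 0

theorem affineCoord_point (v : (P1.coordinates k).cone) :
    affineCoord (P1.point v) = v.1 1 / v.1 0 := by
  obtain ⟨a, ha⟩ := P1.point_eq_iff.1 (show P1.point ⟨Projectivization.rep (P1.point v),
    Projectivization.rep_nonzero _⟩ = P1.point v from Projectivization.mk_rep _)
  rw [affineCoord, show Projectivization.rep (P1.point v) 1 = a * v.1 1 from ha 1,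
    show Projectivization.rep (P1.point v) 0 = a * v.1 0 from ha 0,
    mul_div_mul_left _ _ a.ne_zero]

theorem affineCoord_mem (t : k) :
    affineCoord ∈ FunctionSheaf.regularAt (k := k) (affinePoint t) := by
  refine ((P1.coordinates k).isRegularAt_iff _).2 ⟨1, X 1, X 0, isWeightedHomogeneous_X k _ 1,
    isWeightedHomogeneous_X k _ 0, by simp, fun w _ => ?_⟩
  exact (affineCoord_point w).trans (by simp)

theorem eval_affine (P : MvPolynomial (Fin 2) k) (t : k) :
    eval ![1, t] P = (aeval ![1, Polynomial.X] P : Polynomial k).eval t := by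
  induction P using MvPolynomial.induction_on with
  | C a => simp
  | add p q hp hq => simp [hp, hq]
  | mul_X p i hp => fin_cases i <;> simp [hp]

variable [IsAlgClosed k]

/-- The affine coordinate of g is regular at every point of the affine line. Its denominators form a
principal ideal whose generator has no root, hence is constant over an algebraically closed field.
-/
theorem exists_polynomial_of_fixes_inf (g : VarietyAut k (P1 k))
    (hg : g.1 (infPoint k) = infPoint k) :
    ∃ P : Polynomial k, ∀ t, g.1 (affinePoint t) = affinePoint (P.eval t) := by
  have hφ : ∀ t, ∃ s, g.1 (affinePoint t) = affinePoint s := by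
    intro t
    rcases P1.eq_affinePoint_or (g.1 (affinePoint t)) with h | h
    · exact h
    · exact absurd (g.1.injective (h.trans hg.symm)) (affinePoint_ne_infPoint t)
  choose φ hφ using hφ
  have hcoord : ∀ t, affineCoord (g.1 (affinePoint t)) = φ t := by
    intro t
    rw [hφ, affinePoint, affineCoord_point]
    simp
  have hloc : ∀ t₀, ∃ a b : Polynomial k, b.eval t₀ ≠ 0 ∧ ∀ t, φ t * b.eval t = a.eval t := by
    intro t₀
    have hreg : affineCoord ∈ FunctionSheaf.regularAt (k := k) (g.1 (affinePoint t₀)) := by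
      rw [hφ]; exact affineCoord_mem _
    obtain ⟨d, A, B, -, -, hB, h⟩ :=
      ((P1.coordinates k).isRegularAt_iff _).1 (g.2.1.regular (affinePoint t₀) _ hreg)
    rw [eval_affine] at hB
    refine ⟨aeval ![1, Polynomial.X] (A * B), aeval ![1, Polynomial.X] (B * B), ?_, fun t => ?_⟩
    · simp only [map_mul, Polynomial.eval_mul]
      exact mul_ne_zero hB hB
    · simp only [map_mul, Polynomial.eval_mul]
      by_cases h0 : (aeval ![1, Polynomial.X] B : Polynomial k).eval t = 0
      · simp [h0]
      · have := h ⟨![1, t], fun h => by simpa using congrFun h 0⟩ (by rwa [eval_affine])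
        change affineCoord (g.1 (affinePoint t)) = _ at this
        rw [hcoord, eval_affine, eval_affine] at this
        rw [this]; field_simp
  let I : Ideal (Polynomial k) :=
    { carrier := {b | ∃ a : Polynomial k, ∀ t, φ t * b.eval t = a.eval t}
      add_mem' := by
        rintro b b' ⟨a, ha⟩ ⟨a', ha'⟩
        exact ⟨a + a', fun t => by
          rw [Polynomial.eval_add, Polynomial.eval_add, mul_add, ha, ha']⟩
      zero_mem' := ⟨0, fun t => by simp⟩
      smul_mem' := by
        rintro c b ⟨a, ha⟩
        exact ⟨c * a, fun t => by
          rw [smul_eq_mul, Polynomial.eval_mul, Polynomial.eval_mul, ← ha]; ring⟩ }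
  obtain ⟨d, hd⟩ := (IsPrincipalIdealRing.principal I).principal
  have hroot : ∀ t, d.eval t ≠ 0 := by
    intro t h0
    obtain ⟨a, b, hb, hab⟩ := hloc t
    have hmem : b ∈ I := ⟨a, hab⟩
    rw [hd, Ideal.submodule_span_eq, Ideal.mem_span_singleton] at hmem
    obtain ⟨e, rfl⟩ := hmem
    rw [Polynomial.eval_mul, h0, zero_mul] at hb
    exact hb rfl
  have hdeg : d.degree = 0 := by
    by_contra h
    obtain ⟨t, ht⟩ := IsAlgClosed.exists_root d h
    exact hroot t ht
  have hdI : d ∈ I := by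
    rw [hd]; exact Submodule.mem_span_singleton_self d
  obtain ⟨a, ha⟩ := hdI
  rw [Polynomial.eq_C_of_degree_eq_zero hdeg] at ha hroot
  simp only [Polynomial.eval_C] at ha hroot
  refine ⟨a * Polynomial.C (d.coeff 0)⁻¹, fun t => ?_⟩
  rw [hφ, Polynomial.eval_mul, Polynomial.eval_C, ← ha, mul_assoc, mul_inv_cancel₀ (hroot 0),
    mul_one]

/-- Both g and its inverse are polynomials on the affine line, and polynomials with P ∘ Q = X have
degree one. -/
theorem exists_moebius_of_fixes_inf (g : VarietyAut k (P1 k))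
    (hg : g.1 (infPoint k) = infPoint k) : ∃ A, moebius k A = g := by
  obtain ⟨P, hP⟩ := exists_polynomial_of_fixes_inf g hg
  have hg' : (g⁻¹).1 (infPoint k) = infPoint k := by
    rw [← hg]
    exact g.1.symm_apply_apply _ |>.trans hg.symm
  obtain ⟨Q, hQ⟩ := exists_polynomial_of_fixes_inf g⁻¹ hg'
  have hcomp : P.comp Q = Polynomial.X := by
    apply Polynomial.funext
    intro t
    rw [Polynomial.eval_comp, Polynomial.eval_X]
    apply affinePoint_injective
    rw [← hP, ← hQ]
    exact g.1.apply_symm_apply _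
  have hdeg : P.natDegree = 1 := by
    have := congrArg Polynomial.natDegree hcomp
    rw [Polynomial.natDegree_comp, Polynomial.natDegree_X] at this
    exact Nat.eq_one_of_mul_eq_one_right this
  obtain ⟨a, ha, b, rfl⟩ := Polynomial.natDegree_eq_one.1 hdeg
  have hdet : (!![1, 0; b, a] : Matrix (Fin 2) (Fin 2) k).det ≠ 0 := by
    rw [Matrix.det_fin_two]; simpa using ha
  refine ⟨Matrix.GeneralLinearGroup.mkOfDetNeZero _ hdet, ?_⟩
  apply Subtype.ext
  apply Equiv.ext
  intro x
  rcases P1.eq_affinePoint_or x with ⟨t, rfl⟩ | rfl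
  · rw [hP, affinePoint, moebius_point]
    refine P1.point_eq_iff.2 ⟨1, fun i => ?_⟩
    fin_cases i <;> simp [coneMap, Matrix.GeneralLinearGroup.mkOfDetNeZero]
    ring
  · rw [hg, infPoint, moebius_point]
    refine P1.point_eq_iff.2 ⟨Units.mk0 a ha, fun i => ?_⟩
    fin_cases i <;> simp [coneMap, Matrix.GeneralLinearGroup.mkOfDetNeZero]

/-- Every automorphism of the projective line is a Möbius transformation. -/
theorem moebius_surjective : Function.Surjective (moebius k) := by
  intro h
  -- A matrix with the same effect on ∞ reduces to an automorphism that fixes ∞.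
  obtain ⟨A, hA⟩ : ∃ A, (moebius k A).1 (infPoint k) = h.1 (infPoint k) := by
    obtain ⟨v, hv⟩ := (P1.coordinates k).surjective (h.1 (infPoint k))
    by_cases h0 : v.1 0 = 0
    · exact ⟨1, by rw [map_one, ← hv]; exact (eq_infPoint h0).symm⟩
    · have hdet : (!![0, v.1 0; 1, v.1 1] : Matrix (Fin 2) (Fin 2) k).det ≠ 0 := by
        rw [Matrix.det_fin_two]; simpa using h0
      refine ⟨Matrix.GeneralLinearGroup.mkOfDetNeZero _ hdet, ?_⟩
      rw [← hv, infPoint, moebius_point]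
      refine P1.point_eq_iff.2 ⟨1, fun i => ?_⟩
      fin_cases i <;> simp [coneMap, Matrix.GeneralLinearGroup.mkOfDetNeZero]
  obtain ⟨B, hB⟩ := exists_moebius_of_fixes_inf ((moebius k A)⁻¹ * h) (by
    change (moebius k A).1.symm (h.1 (infPoint k)) = _
    rw [← hA, Equiv.symm_apply_apply])
  exact ⟨A * B, by rw [map_mul, hB, mul_inv_cancel_left]⟩

end Moebius

/-! ## Automorphisms of the surface that act linearly on the coordinates of the base -/

section FibredAction

variable {k : Type*} [Field k] {ε : k}

/-- The map `(t, x, y, z) ↦ (A t, α x + β t₀⁴ z, γ y, z)`, in polynomials. -/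
def fibredPoly (A : GL (Fin 2) k) (α β γ : k) : Fin 5 → MvPolynomial (Fin 5) k :=
  ![C (A.1 0 0) * X 0 + C (A.1 0 1) * X 1, C (A.1 1 0) * X 0 + C (A.1 1 1) * X 1,
    C α * X 2 + C β * (X 0 ^ 4 * X 4), C γ * X 3, X 4]

theorem fibredPoly_homogeneous (A : GL (Fin 2) k) (α β γ : k) (i : Fin 5) :
    IsWeightedHomogeneous (Surface.coordinates ε).weight (fibredPoly A α β γ i)
      ((Surface.coordinates ε).weight i) := by
  have hX := isWeightedHomogeneous_X k (Surface.coordinates ε).weight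
  have h := ((hX 0).pow 4).mul (hX 4)
  fin_cases i
  · exact ((hX 0).C_mul _).add ((hX 1).C_mul _)
  · exact ((hX 0).C_mul _).add ((hX 1).C_mul _)
  · exact ((hX 2).C_mul _).add (h.C_mul β)
  · exact (hX 3).C_mul _
  · exact hX 4

/-- The map `(t, x, y, z) ↦ (A t, α x + β t₀⁴ z, γ y, z)`. -/
def fibredMap (A : GL (Fin 2) k) (α β γ : k) (v : Fin 5 → k) : Fin 5 → k :=
  ![A.1 0 0 * v 0 + A.1 0 1 * v 1, A.1 1 0 * v 0 + A.1 1 1 * v 1,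
    α * v 2 + β * (v 0 ^ 4 * v 4), γ * v 3, v 4]

theorem fibredMap_eval (A : GL (Fin 2) k) (α β γ : k) (v : Fin 5 → k) (i : Fin 5) :
    fibredMap A α β γ v i = eval v (fibredPoly A α β γ i) := by
  fin_cases i <;> simp [fibredMap, fibredPoly]

theorem Surface.exists_point (p : Surface ε) : ∃ v : surfaceCone ε, Surface.point v = p :=
  Quotient.exists_rep p

variable (ε) in
/-- A group action on the coordinate vectors by maps
`(t, x, y, z) ↦ (A t, α x + β t₀⁴ z, γ y, z)`. -/
structure FibredAction (G : Type*) [Group G] where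
  base : G →* GL (Fin 2) k
  α : G → k
  β : G → k
  γ : G → k
  mem : ∀ g, ∀ v ∈ surfaceCone ε, fibredMap (base g) (α g) (β g) (γ g) v ∈ surfaceCone ε
  one_apply : ∀ v, fibredMap (base 1) (α 1) (β 1) (γ 1) v = v
  mul_apply : ∀ g h v, fibredMap (base (g * h)) (α (g * h)) (β (g * h)) (γ (g * h)) v =
    fibredMap (base g) (α g) (β g) (γ g) (fibredMap (base h) (α h) (β h) (γ h) v)

namespace FibredAction

variable {G : Type*} [Group G] (a : FibredAction ε G)

/-- The polynomials defining the action of a group element. -/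
def poly (g : G) : Fin 5 → MvPolynomial (Fin 5) k := fibredPoly (a.base g) (a.α g) (a.β g) (a.γ g)

/-- The action on coordinate vectors. -/
def act (g : G) (v : surfaceCone ε) : surfaceCone ε := ⟨_, a.mem g v.1 v.2⟩

theorem act_one (v : surfaceCone ε) : a.act 1 v = v := Subtype.ext (a.one_apply v.1)

theorem act_mul (g h : G) (v : surfaceCone ε) : a.act (g * h) v = a.act g (a.act h v) :=
  Subtype.ext (a.mul_apply g h v.1)

theorem act_eval (g : G) (v : surfaceCone ε) (i : Fin 5) :
    (a.act g v).1 i = eval v.1 (a.poly g i) :=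
  fibredMap_eval _ _ _ _ _ _

theorem point_act_congr (g : G) {v w : surfaceCone ε} (h : Surface.point v = Surface.point w) :
    Surface.point (a.act g v) = Surface.point (a.act g w) := by
  obtain ⟨c, d, hcd⟩ := point_eq_iff.1 h
  refine point_eq_iff.2 ⟨c, d, fun i => ?_⟩
  fin_cases i <;>
    simp [act, fibredMap, hcd, weight₁, weight₂] <;> ring

/-- The map on the surface. -/
def surfaceMap (g : G) : Surface ε → Surface ε :=
  Quotient.lift (fun v => Surface.point (a.act g v))
    fun _ _ h => a.point_act_congr g (Quotient.sound h)

/-- The permutation of the surface. -/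
def perm (g : G) : Equiv.Perm (Surface ε) where
  toFun := a.surfaceMap g
  invFun := a.surfaceMap g⁻¹
  left_inv := by
    intro x
    obtain ⟨v, rfl⟩ := Surface.exists_point x
    change Surface.point (a.act g⁻¹ (a.act g v)) = Surface.point v
    rw [← act_mul, inv_mul_cancel, act_one]
  right_inv := by
    intro x
    obtain ⟨v, rfl⟩ := Surface.exists_point x
    change Surface.point (a.act g (a.act g⁻¹ v)) = Surface.point v
    rw [← act_mul, mul_inv_cancel, act_one]

/-- The action on the surface by automorphisms. -/
def toAut : G →* VarietyAut k (Surface ε) where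
  toFun g := (Surface.coordinates ε).autOfPolynomial (a.poly g) (a.poly g⁻¹)
    (fibredPoly_homogeneous _ _ _ _) (fibredPoly_homogeneous _ _ _ _)
    (a.act g) (a.act g⁻¹) (a.act_eval g) (a.act_eval g⁻¹) (a.perm g) (fun _ => rfl) (fun _ => rfl)
  map_one' := by
    apply Subtype.ext
    apply Equiv.ext
    intro x
    obtain ⟨v, rfl⟩ := Surface.exists_point x
    exact congrArg Surface.point (a.act_one v)
  map_mul' g h := by
    apply Subtype.ext
    apply Equiv.ext
    intro x
    obtain ⟨v, rfl⟩ := Surface.exists_point x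
    exact congrArg Surface.point (a.act_mul g h v)

theorem induces (g : G) : Induces (a.toAut g) (moebius k (a.base g)) := by
  intro p
  obtain ⟨v, rfl⟩ := Surface.exists_point p
  have hne : ∀ v : surfaceCone ε, ![v.1 0, v.1 1] ≠ 0 := fun v h =>
    v.2.1.elim (fun h' => h' (congrFun h 0)) (fun h' => h' (congrFun h 1))
  change P1.point ⟨![(a.act g v).1 0, (a.act g v).1 1], hne _⟩ =
    P1.point (coneMap (a.base g) ⟨![v.1 0, v.1 1], hne v⟩)
  refine P1.point_eq_iff.2 ⟨1, fun i => ?_⟩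
  fin_cases i <;> simp [act, fibredMap, coneMap]

theorem image_zeroSection (g : G) : (a.toAut g).1 '' zeroSection ε = zeroSection ε := by
  have key : ∀ g, ∀ p ∈ zeroSection ε, (a.toAut g).1 p ∈ zeroSection ε := by
    rintro g _ ⟨v, rfl, h2, h4⟩
    exact ⟨a.act g v, rfl, by simp [act, fibredMap, h2, h4], by simp [act, fibredMap, h4]⟩
  refine Set.Subset.antisymm (Set.image_subset_iff.2 (key g)) fun p hp => ?_
  refine ⟨_, key g⁻¹ p hp, ?_⟩
  change (a.toAut g * a.toAut g⁻¹).1 p = p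
  rw [← map_mul, mul_inv_cancel, map_one]
  rfl

/-! ### The multiplier of dx ∧ dy under a fibred action -/

section Symplectic

theorem chartCoord_toAut_isQuotient (g : G) (i : Fin 5) :
    IsQuotient (chartCoord ε 0 4 i ∘ (a.toAut g).1) (a.poly g i)
      (a.poly g 0 ^ weight₁ i * a.poly g 4 ^ weight₂ i) := by
  intro w _
  refine (chartCoord_point isChartPair_zero_four i (a.act g w)).trans ?_
  have h4 : weight₁ 4 = 0 := rfl
  rw [normalize, h4, zero_mul, pow_zero, mul_one, act_eval, act_eval, act_eval, map_mul, map_pow,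
    map_pow]

/-- These test points are singular points of the fibres over 𝔽₁₁: the derivatives of the equation by
x and y vanish there. -/
theorem mem_surfaceCone_of_pow {t : k} (ht : t ^ 11 = t) : ![1, t, 0, 0, 1] ∈ surfaceCone ε := by
  refine ⟨by simp, by simp, ?_⟩
  simp [ht]

variable [CharP k 11] {t : k} {v : surfaceCone ε} (hv : v.1 = ![1, t, 0, 0, 1])
  (h0 : v.1 0 ≠ 0) (h4 : v.1 4 ≠ 0) (D : tangentSpace k (Surface.point v))
include hv

/-- In the chart t₀ = z = 1 the gradient at a test point has only its t₁-component -1, so the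
tangent plane is spanned by the directions x and y. -/
theorem component_one_eq_zero : component isChartPair_zero_four v h0 h4 D 1 = 0 := by
  have h := dirDeriv_component isChartPair_zero_four v (by simp [hv]) (by simp [hv]) h0 h4 D
  obtain ⟨c0, c4⟩ := component_eq_zero isChartPair_zero_four v h0 h4 D
  have h11 : (11 : k) = 0 := CharP.cast_eq_zero k 11
  simp only [dirDeriv, Fin.sum_univ_five, c0, c4] at h
  simpa [surfacePoly, pderiv_X, h11, hv] using h

/-- The denominator involves only t₀, t₁ and z, and the components of D in these directions vanish
at a test point. So the quotient rule keeps only the derivative of the numerator. -/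
theorem tangent_toAut (g : G) (hL : (a.base g).1 0 0 + (a.base g).1 0 1 * t ≠ 0)
    {i : Fin 5} (hf : chartCoord ε 0 4 i ∘ (a.toAut g).1 ∈ Surface.Reg (Surface.point v)) :
    D.1 ⟨_, hf⟩ = dirDeriv v.1 (component isChartPair_zero_four v h0 h4 D) (a.poly g i) /
      ((a.base g).1 0 0 + (a.base g).1 0 1 * t) ^ weight₁ i := by
  have e0 : eval v.1 (a.poly g 0) = (a.base g).1 0 0 + (a.base g).1 0 1 * t := by
    simp [poly, fibredPoly, hv]
  have e4 : eval v.1 (a.poly g 4) = 1 := by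
    simp [poly, fibredPoly, hv]
  have hpow : ∀ (P : MvPolynomial (Fin 5) k) (n : ℕ),
      dirDeriv v.1 (component isChartPair_zero_four v h0 h4 D) P = 0 →
      dirDeriv v.1 (component isChartPair_zero_four v h0 h4 D) (P ^ n) = 0 := by
    intro P n hP
    induction n with
    | zero => rw [pow_zero, ← C_1, dirDeriv_C]
    | succ n ih => rw [pow_succ, dirDeriv_mul, hP, ih, mul_zero, mul_zero, add_zero]
  obtain ⟨c0, c4⟩ := component_eq_zero isChartPair_zero_four v h0 h4 D
  have c1 := component_one_eq_zero hv h0 h4 D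
  have d : dirDeriv v.1 (component isChartPair_zero_four v h0 h4 D)
      (a.poly g 0 ^ weight₁ i * a.poly g 4 ^ weight₂ i) = 0 := by
    rw [dirDeriv_mul, hpow, hpow, mul_zero, mul_zero, add_zero]
    · simp [poly, fibredPoly, dirDeriv, Fin.sum_univ_five, pderiv_X, c0, c1]
    · simp [poly, fibredPoly, dirDeriv, Fin.sum_univ_five, pderiv_X, c4]
  have hB : IsWeightedHomogeneous (Surface.coordinates ε).weight
      (a.poly g 0 ^ weight₁ i * a.poly g 4 ^ weight₂ i) _ :=
    ((fibredPoly_homogeneous _ _ _ _ 0).pow (weight₁ i)).mul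
      ((fibredPoly_homogeneous _ _ _ _ 4).pow (weight₂ i))
  have h := tangent_eq_sum isChartPair_zero_four v (by simp [hv]) (by simp [hv])
    h0 h4 D ⟨_, hf⟩ hB (a.chartCoord_toAut_isQuotient g i) (by
      rw [map_mul, map_pow, map_pow, e0, e4, one_pow, mul_one]
      exact pow_ne_zero _ hL)
  rw [h, sum_ratGrad_mul, d, map_mul, map_pow, map_pow, e0, e4, one_pow, mul_one, mul_zero,
    sub_zero, pow_two, mul_div_mul_right _ _ (pow_ne_zero _ hL)]

-- At the test point, with L the value of the new t₀, pulling back multiplies dx by α / L⁴ and dy by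
-- γ / L⁶; the term β t₀⁴ z has derivative zero. Hence dx ∧ dy is multiplied by αγ / L¹⁰, and `hL`
-- keeps the image point in the chart.
omit hv in
theorem isSymplectic_toAut_iff [IsAlgClosed k] (g : G) {t : k} (ht : t ^ 11 = t)
    (hL : (a.base g).1 0 0 + (a.base g).1 0 1 * t ≠ 0) :
    IsSymplectic (a.toAut g) ↔
      a.α g * a.γ g = ((a.base g).1 0 0 + (a.base g).1 0 1 * t) ^ 10 := by
  set L := (a.base g).1 0 0 + (a.base g).1 0 1 * t with hLdef
  obtain ⟨v, hv⟩ : ∃ v : surfaceCone ε, v.1 = ![1, t, 0, 0, 1] :=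
    ⟨⟨_, mem_surfaceCone_of_pow ht⟩, rfl⟩
  have h0 : v.1 0 ≠ 0 := by simp [hv]
  have h4 : v.1 4 ≠ 0 := by simp [hv]
  have hq : IsGeneric (Surface.point v) := isGeneric_point.2 ⟨h0, h4⟩
  have hφq : IsGeneric ((a.toAut g).1 (Surface.point v)) :=
    isGeneric_point.2 ⟨by simpa [act, fibredMap, hv] using hL, by simp [act, fibredMap, hv]⟩
  rw [isSymplectic_iff (a.toAut g) hq hφq (c := a.α g * a.γ g / L ^ 10),
    div_eq_one_iff_eq (pow_ne_zero _ hL)]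
  have h2 : ∀ D : tangentSpace k (Surface.point v),
      D.1 ⟨_, (a.toAut g).2.1.regular _ _ (hφq.mem 2)⟩ = a.α g * D.1 ⟨_, hq.mem 2⟩ / L ^ 4 := by
    intro D
    obtain ⟨c0, c4⟩ := component_eq_zero isChartPair_zero_four v h0 h4 D
    rw [a.tangent_toAut hv h0 h4 D g hL, dirDeriv, Fin.sum_univ_five, c0, c4]
    simp [poly, fibredPoly, pderiv_X, weight₁]
    rfl
  have h3 : ∀ D : tangentSpace k (Surface.point v),
      D.1 ⟨_, (a.toAut g).2.1.regular _ _ (hφq.mem 3)⟩ = a.γ g * D.1 ⟨_, hq.mem 3⟩ / L ^ 6 := by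
    intro D
    obtain ⟨c0, c4⟩ := component_eq_zero isChartPair_zero_four v h0 h4 D
    rw [a.tangent_toAut hv h0 h4 D g hL, dirDeriv, Fin.sum_univ_five, c0, c4]
    simp [poly, fibredPoly, pderiv_X, weight₁]
    rfl
  intro D E
  change D.1 ⟨_, (a.toAut g).2.1.regular _ _ (hφq.mem 2)⟩ *
      E.1 ⟨_, (a.toAut g).2.1.regular _ _ (hφq.mem 3)⟩ -
    E.1 ⟨_, (a.toAut g).2.1.regular _ _ (hφq.mem 2)⟩ *
      D.1 ⟨_, (a.toAut g).2.1.regular _ _ (hφq.mem 3)⟩ = _ *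
    (D.1 ⟨_, hq.mem 2⟩ * E.1 ⟨_, hq.mem 3⟩ - E.1 ⟨_, hq.mem 2⟩ * D.1 ⟨_, hq.mem 3⟩)
  rw [h2, h2, h3, h3]
  field_simp

end Symplectic
end FibredAction
end FibredAction

/-! ## Cyclic groups and semidirect products -/

section Groups

/-- The homomorphism from a cyclic group that maps the generator to `u`. -/
def cycHom (n : ℕ) [NeZero n] {H : Type*} [Group H] (u : H) (hu : u ^ n = 1) : Cyc n →* H where
  toFun c := u ^ (Multiplicative.toAdd c).val
  map_one' := by simp
  map_mul' a b := by
    rw [toAdd_mul, ZMod.val_add, ← pow_add]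
    exact (pow_eq_pow_mod _ hu).symm

theorem cycHom_injective {n : ℕ} [NeZero n] {H : Type*} [Group H] {u : H} (hu : orderOf u = n) :
    Function.Injective (cycHom n u (hu ▸ pow_orderOf_eq_one u)) := by
  intro a b h
  apply Multiplicative.toAdd.injective
  apply ZMod.val_injective n
  refine pow_injOn_Iio_orderOf ?_ ?_ h
  · rw [hu]; exact ZMod.val_lt _
  · rw [hu]; exact ZMod.val_lt _

theorem cycHom_surjective {n : ℕ} [NeZero n] {H : Type*} [Group H] {u : H} (hu : u ^ n = 1) {x : H}
    (hx : ∃ m : ℕ, x = u ^ m) : ∃ c, cycHom n u hu c = x := by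
  obtain ⟨m, rfl⟩ := hx
  refine ⟨Multiplicative.ofAdd (m : ZMod n), ?_⟩
  change u ^ (m : ZMod n).val = _
  rw [ZMod.val_natCast]
  exact (pow_eq_pow_mod _ hu).symm

/-- A group is a semidirect product if it has a normal subgroup and a complement. -/
theorem exists_semidirectProduct {N H G : Type*} [Group N] [Group H] [Group G] (f : N →* G)
    (g : H →* G) (hf : Function.Injective f) (hn : f.range.Normal)
    (hdisj : ∀ n h, f n = g h → h = 1) (hex : ∀ x, ∃ n h, x = f n * g h) :
    ∃ (φ : H →* MulAut N) (e : N ⋊[φ] H ≃* G), (∀ n, e (SemidirectProduct.inl n) = f n) ∧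
      ∀ h, e (SemidirectProduct.inr h) = g h := by
  let φ : H →* MulAut N :=
    (MulAut.congr (MonoidHom.ofInjective hf).symm).toMonoidHom.comp (MulAut.conjNormal.comp g)
  have hφ : ∀ h n, f (φ h n) = g h * f n * (g h)⁻¹ := by
    intro h n
    have h1 : ∀ y : f.range, f ((MonoidHom.ofInjective hf).symm y) = y := fun y =>
      congrArg Subtype.val ((MonoidHom.ofInjective hf).apply_symm_apply y)
    exact (h1 _).trans rfl
  let F : N ⋊[φ] H →* G := SemidirectProduct.lift f g (fun h => by
    ext n
    exact hφ h n)
  have hF : ∀ x, F x = f x.left * g x.right := fun x => rfl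
  have hbij : Function.Bijective F := by
    constructor
    · rw [injective_iff_map_eq_one]
      intro x hx
      rw [hF] at hx
      have h1 : x.right = 1 := by
        have := hdisj x.left⁻¹ x.right (by rw [map_inv]; exact inv_eq_of_mul_eq_one_right hx)
        exact this
      rw [h1, map_one, mul_one] at hx
      exact SemidirectProduct.ext (hf (by rw [hx]; exact (map_one f).symm)) h1
    · intro x
      obtain ⟨n, h, rfl⟩ := hex x
      exact ⟨⟨n, h⟩, hF _⟩
  refine ⟨φ, MulEquiv.ofBijective F hbij, fun n => (hF _).trans ?_, fun h => (hF _).trans ?_⟩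
  · simp
  · simp

end Groups

/-! ## The form `t₁¹¹ t₀ - t₀¹¹ t₁` -/

section Form

variable {k : Type*} [Field k]

/-- The binary form `t₁¹¹ t₀ - t₀¹¹ t₁`. -/
def hermForm (v : Fin 2 → k) : k := v 1 ^ 11 * v 0 - v 0 ^ 11 * v 1

variable [CharP k 11]

instance expCharEleven : ExpChar k 11 := ExpChar.prime (by norm_num)

theorem add_pow_eleven (a b : k) : (a + b) ^ 11 = a ^ 11 + b ^ 11 := add_pow_expChar a b 11

theorem sub_pow_eleven (a b : k) : (a - b) ^ 11 = a ^ 11 - b ^ 11 := sub_pow_expChar a b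

theorem natCast_ne_zero_of_lt {n : ℕ} (h0 : n ≠ 0) (h : n < 11) : (n : k) ≠ 0 := by
  rw [Ne, CharP.cast_eq_zero_iff k 11]
  exact Nat.not_dvd_of_pos_of_lt (Nat.pos_of_ne_zero h0) h

theorem two_ne : (2 : k) ≠ 0 := by
  exact_mod_cast natCast_ne_zero_of_lt (k := k) two_ne_zero (by norm_num)

theorem eleven_eq : (11 : k) = 0 := CharP.cast_eq_zero k 11

variable (k) in
/-- The inclusion of the prime field. -/
def primeHom : ZMod 11 →+* k := ZMod.castHom (dvd_refl 11) k

theorem primeHom_pow (n : ZMod 11) : primeHom k n ^ 11 = primeHom k n := by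
  rw [← map_pow, ZMod.pow_card]

-- With q the order of F, the polynomial X^q - X would otherwise have q + 1 roots: t and the images
-- of the elements of F.
omit [CharP k 11] in
theorem exists_of_pow_card {F : Type*} [Field F] [Fintype F] (f : F →+* k) {t : k}
    (ht : t ^ Fintype.card F = t) : ∃ n, f n = t := by
  classical
  by_contra! hne
  have h1 := Fintype.one_lt_card (α := F)
  have hP : (Polynomial.X ^ Fintype.card F - Polynomial.X : Polynomial k) = 0 := by
    refine Polynomial.eq_zero_of_natDegree_lt_card_of_eval_eq_zero' _
      (insert t (Finset.univ.image f)) ?_ ?_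
    · intro i hi
      rw [Finset.mem_insert, Finset.mem_image] at hi
      obtain rfl | ⟨n, -, rfl⟩ := hi
      · simp [ht]
      · simp [← map_pow, FiniteField.pow_card]
    · rw [FiniteField.X_pow_card_sub_X_natDegree_eq k h1, Finset.card_insert_of_notMem,
        Finset.card_image_of_injective _ f.injective, Finset.card_univ]
      · exact Nat.lt_succ_self _
      · rw [Finset.mem_image]
        rintro ⟨n, -, h⟩
        exact hne n h
  exact FiniteField.X_pow_card_sub_X_ne_zero k h1 hP

theorem exists_primeHom {t : k} (ht : t ^ 11 = t) : ∃ n, primeHom k n = t :=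
  exists_of_pow_card _ (by rwa [ZMod.card])

/-- A matrix that maps enough rational points to zeros of the form is proportional to its
Frobenius conjugate. -/
theorem exists_frobenius_eq_smul (A : GL (Fin 2) k)
    (h : ∀ t : k, t ^ 11 = t → hermForm (A.1.mulVec ![1, t]) = 0) :
    ∃ c : k, c ≠ 0 ∧ ∀ i j, A.1 i j ^ 11 = c * A.1 i j := by
  have hdet : A.1 0 0 * A.1 1 1 - A.1 0 1 * A.1 1 0 ≠ 0 := by
    rw [← Matrix.det_fin_two]
    exact (Matrix.isUnits_det_units A).ne_zero
  -- For t¹¹ = t the condition is a quadratic polynomial in t; its values at 0, 1 and -1 determine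
  -- its three coefficients `e0`, `emid` and `einf`.
  have e0 := h 0 (by simp)
  have e1 := h 1 (by simp)
  have em := h (-1) (by ring)
  simp [hermForm, add_pow_eleven, sub_pow_eleven, ← sub_eq_add_neg] at e0 e1 em
  set a := A.1 0 0
  set b := A.1 0 1
  set c := A.1 1 0
  set d := A.1 1 1
  have emid : c ^ 11 * b + d ^ 11 * a - a ^ 11 * d - b ^ 11 * c = 0 := by
    apply mul_left_cancel₀ (two_ne (k := k))
    linear_combination e1 - em
  have einf : d ^ 11 * b - b ^ 11 * d = 0 := by
    apply mul_left_cancel₀ (two_ne (k := k))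
    linear_combination e1 + em - 2 * e0
  -- The outer coefficients say that each column is proportional to its Frobenius conjugate.
  have hcol : ∀ x y : k, y ^ 11 * x - x ^ 11 * y = 0 → (x ≠ 0 ∨ y ≠ 0) →
      ∃ l, l ≠ 0 ∧ x ^ 11 = l * x ∧ y ^ 11 = l * y := by
    intro x y hxy h0
    by_cases hx : x = 0
    · have hy := h0.resolve_left (not_not.2 hx)
      exact ⟨y ^ 10, pow_ne_zero _ hy, by simp [hx], by ring⟩
    · refine ⟨x ^ 10, pow_ne_zero _ hx, by ring, ?_⟩
      apply mul_left_cancel₀ hx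
      linear_combination hxy
  obtain ⟨l, hl, ha, hc⟩ := hcol a c e0 (by
    by_contra! h0
    rw [h0.1, h0.2] at hdet
    simp at hdet)
  obtain ⟨m, hm, hb, hd⟩ := hcol b d einf (by
    by_contra! h0
    rw [h0.1, h0.2] at hdet
    simp at hdet)
  -- The middle coefficient becomes (m - l) det A.
  have hlm : m = l := by
    apply sub_eq_zero.1
    apply (mul_eq_zero.1 (_ : (m - l) * (a * d - b * c) = 0)).resolve_right hdet
    rw [ha, hb, hc, hd] at emid
    linear_combination emid
  subst hlm
  refine ⟨m, hm, fun i j => ?_⟩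
  fin_cases i <;> fin_cases j <;> assumption

omit [CharP k 11] in
/-- Rescaling a matrix does not change its Möbius transformation. -/
theorem exists_smul_moebius_eq (A : GL (Fin 2) k) {s : k} (hs : s ≠ 0) :
    ∃ B : GL (Fin 2) k, moebius k B = moebius k A ∧ ∀ i j, B.1 i j = s * A.1 i j := by
  have hdet : (s • (1 : Matrix (Fin 2) (Fin 2) k)).det ≠ 0 := by
    simp [hs]
  refine ⟨Matrix.GeneralLinearGroup.mkOfDetNeZero _ hdet * A, ?_, fun i j => ?_⟩
  · rw [map_mul, (moebius_eq_one_iff _).2, one_mul]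
    simp [Matrix.GeneralLinearGroup.mkOfDetNeZero]
  · simp [Matrix.GeneralLinearGroup.mkOfDetNeZero]

/-- The zeros of the discriminant. -/
theorem point_mem_discriminantLocus {ε : k} {v : (P1.coordinates k).cone} :
    P1.point v ∈ discriminantLocus ε ↔
      hermForm v.1 = 0 ∨ hermForm v.1 = -3 * ε ^ 3 * v.1 0 ^ 12 := by
  -- In characteristic 11 one has 4 = 5 · 3, so the last factor of the discriminant, multiplied by
  -- t₀, is 5(H + 3ε³t₀¹²).
  have hev : ∀ v : Fin 2 → k, eval v (discriminantForm ε) =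
      - 5 * (hermForm v * (hermForm v - -3 * ε ^ 3 * v 0 ^ 12)) := by
    intro v
    rw [discriminantForm_eq]
    simp [hermForm]
    linear_combination -ε ^ 3 * v 0 ^ 12 * (v 1 ^ 11 * v 0 - v 0 ^ 11 * v 1) * eleven_eq (k := k)
  have h5 : (-5 : k) ≠ 0 := by
    have := natCast_ne_zero_of_lt (k := k) (n := 5) (by norm_num) (by norm_num)
    exact neg_ne_zero.2 (by exact_mod_cast this)
  constructor
  · rintro ⟨w, hw, h0⟩
    obtain ⟨a, ha⟩ := P1.point_eq_iff.1 hw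
    rw [hev] at h0
    have hherm : hermForm w.1 = a ^ 12 * hermForm v.1 := by
      rw [hermForm, hermForm, ha, ha]; ring
    rw [hherm, ha 0] at h0
    have ha0 : (a : k) ^ 24 ≠ 0 := pow_ne_zero _ a.ne_zero
    have : -5 * ((a : k) ^ 24 * (hermForm v.1 * (hermForm v.1 - -3 * ε ^ 3 * v.1 0 ^ 12))) = 0 := by
      linear_combination h0
    have := (mul_eq_zero.1 ((mul_eq_zero.1 this).resolve_left h5)).resolve_left ha0
    rwa [mul_eq_zero, sub_eq_zero] at this
  · intro h
    refine ⟨v, rfl, ?_⟩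
    rw [hev]
    rcases h with h | h <;> simp [h]

omit [CharP k 11] in
/-- A group of Möbius transformations that map the discriminant locus into itself preserves it. -/
theorem moebius_mem_discriminantStabilizer {ε : k} {G : Type*} [Group G] (b : G →* GL (Fin 2) k)
    (h : ∀ g, ∀ p ∈ discriminantLocus ε, (moebius k (b g)).1 p ∈ discriminantLocus ε) (g : G) :
    moebius k (b g) ∈ discriminantStabilizer ε := by
  refine Set.Subset.antisymm (Set.image_subset_iff.2 (h g)) fun p hp => ⟨_, h g⁻¹ p hp, ?_⟩
  change (moebius k (b g) * moebius k (b g⁻¹)).1 p = p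
  rw [← map_mul, ← map_mul, mul_inv_cancel, map_one, map_one]
  rfl

omit [CharP k 11] in
theorem standardFibration_surjective [IsAlgClosed k] (ε : k) :
    Function.Surjective (standardFibration ε) := by
  intro p
  obtain ⟨w, rfl⟩ := (P1.coordinates k).surjective p
  have hw : w.1 0 ≠ 0 ∨ w.1 1 ≠ 0 := by
    by_contra! h
    exact w.2 (funext fun i => by fin_cases i; exacts [h.1, h.2])
  refine ⟨Surface.point ⟨![w.1 0, w.1 1, 0, 1, 0], hw, by simp, by simp⟩, ?_⟩
  refine congrArg P1.point (Subtype.ext (funext fun i => ?_))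
  fin_cases i <;> rfl

-- The induced automorphism of the base is unique because the fibration is surjective.
omit [CharP k 11] in
theorem FibredAction.induces_iff [IsAlgClosed k] {ε : k} {G : Type*} [Group G]
    (a : FibredAction ε G) (g : G) (h : VarietyAut k (P1 k)) :
    Induces (a.toAut g) h ↔ moebius k (a.base g) = h := by
  refine ⟨fun hI => ?_, fun hI => hI ▸ a.induces g⟩
  apply Subtype.ext
  apply Equiv.ext
  intro x
  obtain ⟨p, rfl⟩ := standardFibration_surjective ε x
  rw [← hI p, ← a.induces g p]

end Form

/-! ## The group `11 : n` generated by translations and a reflection -/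

section Dihedral

theorem mulVec_fin_two {k : Type*} [Field k] (A : Matrix (Fin 2) (Fin 2) k) (v : Fin 2 → k)
    (i : Fin 2) : A.mulVec v i = A i 0 * v 0 + A i 1 * v 1 := by
  rw [Matrix.mulVec, dotProduct, Fin.sum_univ_two]

theorem coneMap_apply {k : Type*} [Field k] (A : GL (Fin 2) k) (v : (P1.coordinates k).cone)
    (i : Fin 2) : (coneMap A v).1 i = A.1 i 0 * v.1 0 + A.1 i 1 * v.1 1 :=
  mulVec_fin_two _ _ _

/-- The generator acts by inversion on the cyclic group of order `11`. -/
def inversion (N : ℕ) [NeZero N] (hN : Even N) : Cyc N →* MulAut (Cyc 11) :=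
  cycHom N (MulEquiv.inv (Cyc 11)) (by
    obtain ⟨m, rfl⟩ := hN
    rw [← two_mul, pow_mul]
    have : (MulEquiv.inv (Cyc 11) : MulAut (Cyc 11)) ^ 2 = 1 := by
      ext a; simp [pow_two]
    rw [this, one_pow])

theorem inversion_ne_one (N : ℕ) [NeZero N] (hN : Even N) (h1 : 1 < N) : inversion N hN ≠ 1 := by
  intro h
  have h2 := congrArg (fun f => Multiplicative.toAdd
    (f (Multiplicative.ofAdd (1 : ZMod N)) (Multiplicative.ofAdd (1 : ZMod 11)))) h
  have : Fact (1 < N) := ⟨h1⟩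
  simp [inversion, cycHom, ZMod.val_one] at h2
  revert h2
  decide

variable {k : Type*} [Field k] [CharP k 11]

variable (k) in
/-- The sign of an element of a cyclic group of even order. -/
def sgn (N : ℕ) [NeZero N] (hN : Even N) : Cyc N →* kˣ := cycHom N (-1) hN.neg_one_pow

omit [CharP k 11] in
theorem sgn_eq (N : ℕ) [NeZero N] (hN : Even N) (c : Cyc N) :
    (sgn k N hN c : k) = 1 ∨ (sgn k N hN c : k) = -1 := by
  rcases neg_one_pow_eq_or kˣ (Multiplicative.toAdd c).val with h | h
  · left; rw [sgn, cycHom]; exact congrArg Units.val h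
  · right; rw [sgn, cycHom]; exact congrArg Units.val h

theorem primeHom_inversion (N : ℕ) [NeZero N] (hN : Even N) (c : Cyc N) (a : Cyc 11) :
    primeHom k (Multiplicative.toAdd (inversion N hN c a)) =
      sgn k N hN c * primeHom k (Multiplicative.toAdd a) := by
  change primeHom k (Multiplicative.toAdd ((MulEquiv.inv (Cyc 11) ^ (Multiplicative.toAdd c).val :
    MulAut (Cyc 11)) a)) = (((-1 : kˣ) ^ (Multiplicative.toAdd c).val : kˣ) : k) * _
  generalize (Multiplicative.toAdd c).val = m
  induction m with
  | zero => simp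
  | succ m ih =>
    rw [pow_succ', MulAut.mul_apply, pow_succ]
    simp [ih]

/-- The group `11 : n` acting on the affine line by translations and a reflection. -/
abbrev AffineGroup (N : ℕ) [NeZero N] (hN : Even N) : Type := Cyc 11 ⋊[inversion N hN] Cyc N

/-- The translation part. -/
def shift (r : k) {N : ℕ} [NeZero N] {hN : Even N} (g : AffineGroup N hN) : k :=
  primeHom k (Multiplicative.toAdd g.left) + (1 - sgn k N hN g.right) / 2 * r

/-- The action of `11 : n` on the affine line. -/
def affineHom (r : k) (N : ℕ) [NeZero N] (hN : Even N) : AffineGroup N hN →* GL (Fin 2) k :=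
  MonoidHom.mk' (fun g => Matrix.GeneralLinearGroup.mkOfDetNeZero
    !![1, 0; shift r g, sgn k N hN g.right] (by simp [Matrix.det_fin_two])) (by
    intro g h
    have h2 := two_ne (k := k)
    apply Units.ext
    ext i j
    fin_cases i <;> fin_cases j <;>
      simp [Matrix.GeneralLinearGroup.mkOfDetNeZero, shift, primeHom_inversion]
    field_simp
    ring)

theorem affineHom_apply (r : k) {N : ℕ} [NeZero N] {hN : Even N} (g : AffineGroup N hN) :
    (affineHom r N hN g).1 = !![1, 0; shift r g, sgn k N hN g.right] := rfl

/-- The factor (1 - s) / 2 is 0 for translations, where s = 1, and 1 for reflections, where s = -1.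
So the shift lies in 𝔽₁₁ or in r + 𝔽₁₁. -/
theorem shift_eq (r : k) {N : ℕ} [NeZero N] {hN : Even N} (g : AffineGroup N hN) :
    shift r g ^ 11 - shift r g = (1 - sgn k N hN g.right) / 2 * (r ^ 11 - r) := by
  have hs := sgn_eq (k := k) N hN g.right
  rw [shift, add_pow_eleven, primeHom_pow]
  have h2 := two_ne (k := k)
  rcases hs with h | h <;> rw [h]
  · simp
  · have : ((1 : k) - -1) / 2 = 1 := by field_simp; ring
    rw [this]; ring

/-- Put c = -3ε³. Translations by 𝔽₁₁ preserve t¹¹ - t, and a reflection replaces t¹¹ - t by c -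
(t¹¹ - t), so it exchanges the two sets where this function is 0 or c. The point ∞ is fixed. -/
theorem affineHom_mem_discriminantStabilizer {ε r : k} (hr : r ^ 11 - r = -3 * ε ^ 3) {N : ℕ}
    [NeZero N] {hN : Even N} (g : AffineGroup N hN) :
    moebius k (affineHom r N hN g) ∈ discriminantStabilizer ε := by
  refine moebius_mem_discriminantStabilizer _ (fun g p hp => ?_) g
  obtain ⟨v, rfl⟩ := (P1.coordinates k).surjective p
  rw [moebius_point, point_mem_discriminantLocus]
  replace hp := point_mem_discriminantLocus.1 hp
  have hsh := shift_eq r g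
  rw [hr] at hsh
  have h0 : (coneMap (affineHom r N hN g) v).1 0 = v.1 0 := by
    rw [coneMap_apply, affineHom_apply]; simp
  have h1 : (coneMap (affineHom r N hN g) v).1 1 =
      shift r g * v.1 0 + sgn k N hN g.right * v.1 1 := by
    rw [coneMap_apply, affineHom_apply]; simp
  have hs := sgn_eq (k := k) N hN g.right
  have h2 := two_ne (k := k)
  rw [hermForm, h0, h1, add_pow_eleven, mul_pow, mul_pow]
  rw [hermForm] at hp
  rcases hs with h | h <;> rw [h] at hsh ⊢
  · have e : shift r g ^ 11 = shift r g := by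
      rw [sub_self, zero_div, zero_mul] at hsh
      exact sub_eq_zero.1 hsh
    rw [e]
    refine hp.imp (fun hp => ?_) (fun hp => ?_) <;> linear_combination hp
  · have e : shift r g ^ 11 = shift r g + -3 * ε ^ 3 := by
      have : ((1 : k) - -1) / 2 = 1 := by field_simp; ring
      rw [this] at hsh
      linear_combination hsh
    rw [e]
    refine hp.symm.imp (fun hp => ?_) (fun hp => ?_) <;> linear_combination -hp

theorem affineHom_moebius_injective (r : k) :
    Function.Injective ((moebius k).comp (affineHom r 2 even_two)) := by
  rw [injective_iff_map_eq_one]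
  intro g hg
  obtain ⟨-, h1, h2⟩ := (moebius_eq_one_iff _).1 hg
  rw [affineHom_apply] at h1 h2
  simp at h1 h2
  have hr : g.right = 1 := by
    apply cycHom_injective (u := (-1 : kˣ)) (n := 2) ?_
    · rw [map_one]; exact Units.ext h2.symm
    · refine orderOf_eq_prime (by simp) fun h => ?_
      have := congrArg (fun u : kˣ => (u : k)) h
      simp only [Units.val_neg, Units.val_one] at this
      apply two_ne (k := k)
      linear_combination -this
  rw [shift, ← h2] at h1
  refine SemidirectProduct.ext ?_ hr
  apply Multiplicative.toAdd.injective
  apply (primeHom k).injective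
  simpa using h1

/-! ### The stabilizer of the discriminant locus -/

/-- A matrix that maps rational points to rational points and the translated points `t¹¹ - t = c`
to translated points is affine. -/
theorem affine_of_frobenius {c c' r : k} (hc : c ≠ 0) (hc' : c' ≠ 0) (hr : r ^ 11 - r = c)
    (A : GL (Fin 2) k) (h1 : ∀ t : k, t ^ 11 = t → hermForm (A.1.mulVec ![1, t]) = 0)
    (h2 : ∀ t : k, t ^ 11 - t = c → hermForm (A.1.mulVec ![1, t]) = 0 ∨
      hermForm (A.1.mulVec ![1, t]) = c' * (A.1.mulVec ![1, t]) 0 ^ 12) :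
    A.1 0 1 = 0 ∧ c * A.1 1 1 = c' * A.1 0 0 ∧ ∃ n, A.1 1 0 = primeHom k n * A.1 0 0 := by
  obtain ⟨l, hl, hA⟩ := exists_frobenius_eq_smul A h1
  have hdet : A.1 0 0 * A.1 1 1 - A.1 0 1 * A.1 1 0 ≠ 0 := by
    rw [← Matrix.det_fin_two]
    exact (Matrix.isUnits_det_units A).ne_zero
  -- Since Ā = lA, the form takes the nonzero value l c det A at the image of a translated point.
  -- Only the second alternative is possible, and it is a quadratic equation in t.
  have key : ∀ t : k, t ^ 11 - t = c → c * (A.1 0 0 * A.1 1 1 - A.1 0 1 * A.1 1 0) =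
      c' * ((A.1 0 0 + A.1 0 1 * t + A.1 0 1 * c) * (A.1 0 0 + A.1 0 1 * t)) := by
    intro t ht
    have ht' : t ^ 11 = t + c := by linear_combination ht
    have e := h2 t ht
    have e12 : (A.1 0 0 + A.1 0 1 * t) ^ 12 =
        l * (A.1 0 0 + A.1 0 1 * t + A.1 0 1 * c) * (A.1 0 0 + A.1 0 1 * t) := by
      rw [show 12 = 11 + 1 from rfl, pow_succ, add_pow_eleven, mul_pow, ht', hA, hA]; ring
    simp [hermForm] at e
    rw [e12, add_pow_eleven, add_pow_eleven, mul_pow, mul_pow, ht', hA, hA, hA, hA] at e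
    apply mul_left_cancel₀ hl
    rcases e with e | e
    · exfalso
      apply mul_ne_zero (mul_ne_zero hl hc) hdet
      linear_combination e
    · linear_combination e
  have k0 := key r hr
  have k1 := key (r + 1) (by rw [add_pow_eleven]; linear_combination hr)
  have k2 := key (r - 1) (by rw [sub_pow_eleven]; linear_combination hr)
  have hb : A.1 0 1 = 0 := by
    -- The second difference of the quadratic equation over r - 1, r, r + 1 isolates its leading
    -- coefficient.
    have : 2 * c' * A.1 0 1 ^ 2 = 0 := by linear_combination 2 * k0 - k1 - k2
    simpa [two_ne, hc'] using this
  rw [hb] at k0 hdet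
  simp only [zero_mul, sub_zero, add_zero] at k0 hdet
  have ha : A.1 0 0 ≠ 0 := fun h => hdet (by rw [h, zero_mul])
  refine ⟨hb, ?_, ?_⟩
  · apply mul_left_cancel₀ ha
    linear_combination k0
  · obtain ⟨n, hn⟩ := exists_primeHom (t := A.1 1 0 / A.1 0 0) (by
      rw [div_pow, hA, hA, mul_div_mul_left _ _ hl])
    exact ⟨n, by rw [hn, div_mul_cancel₀ _ ha]⟩

/-- Two quadratic polynomials whose product vanishes at all rational points. -/
theorem forall_eq_zero_or {P Q : Polynomial k} (hP : P.natDegree ≤ 2) (hQ : Q.natDegree ≤ 2)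
    (h : ∀ t, t ^ 11 = t → P.eval t * Q.eval t = 0) : P = 0 ∨ Q = 0 := by
  classical
  rw [← mul_eq_zero]
  refine Polynomial.eq_zero_of_natDegree_lt_card_of_eval_eq_zero' _
    (Finset.univ.image (primeHom k)) ?_ ?_
  · intro i hi
    obtain ⟨n, -, rfl⟩ := Finset.mem_image.1 hi
    rw [Polynomial.eval_mul, h _ (primeHom_pow n)]
  · rw [Finset.card_image_of_injective _ (primeHom k).injective, Finset.card_univ, ZMod.card]
    exact (Polynomial.natDegree_mul_le.trans (Nat.add_le_add hP hQ)).trans_lt (by norm_num)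

/-- The polynomial `f(a + b t, c + d t)` for rational `t`, where `f` is the form minus `e t₀¹²`. -/
def quadPoly (A : Matrix (Fin 2) (Fin 2) k) (e : k) : Polynomial k :=
  (Polynomial.C (A 1 0 ^ 11) + Polynomial.C (A 1 1 ^ 11) * Polynomial.X) *
      (Polynomial.C (A 0 0) + Polynomial.C (A 0 1) * Polynomial.X) -
    (Polynomial.C (A 0 0 ^ 11) + Polynomial.C (A 0 1 ^ 11) * Polynomial.X) *
      (Polynomial.C (A 1 0) + Polynomial.C (A 1 1) * Polynomial.X) -
    Polynomial.C e * ((Polynomial.C (A 0 0 ^ 11) + Polynomial.C (A 0 1 ^ 11) * Polynomial.X) *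
      (Polynomial.C (A 0 0) + Polynomial.C (A 0 1) * Polynomial.X))

omit [CharP k 11] in
theorem natDegree_quadPoly_le (A : Matrix (Fin 2) (Fin 2) k) (e : k) :
    (quadPoly A e).natDegree ≤ 2 := by
  unfold quadPoly
  compute_degree

theorem eval_quadPoly (A : Matrix (Fin 2) (Fin 2) k) (e : k) {t : k} (ht : t ^ 11 = t) :
    (quadPoly A e).eval t =
      hermForm (A.mulVec ![1, t]) - e * ((A.mulVec ![1, t]) 0) ^ (11 + 1) := by
  simp [quadPoly, hermForm]
  rw [pow_succ _ 11, add_pow_eleven, add_pow_eleven, mul_pow, mul_pow, ht]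

variable [IsAlgClosed k]

/-- A symmetry maps 𝔽₁₁ into the locus. The two conditions describing the locus become quadratic
polynomials on 𝔽₁₁, so one of them holds at all eleven points. Either A preserves rational points,
or it does so after a translation by -r; in both cases `affine_of_frobenius` shows that A is affine
with the right coefficients. -/
theorem range_affineHom {ε r : k} (hε : ε ≠ 0) (hr : r ^ 11 - r = -3 * ε ^ 3) {N : ℕ}
    [NeZero N] (hN : Even N) (h1 : 1 < N) :
    ((moebius k).comp (affineHom r N hN)).range = discriminantStabilizer ε := by
  have h3 : (3 : k) ≠ 0 := by
    exact_mod_cast natCast_ne_zero_of_lt (k := k) (n := 3) (by norm_num) (by norm_num)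
  have hc : -3 * ε ^ 3 ≠ 0 := mul_ne_zero (neg_ne_zero.2 h3) (pow_ne_zero _ hε)
  have h2 := two_ne (k := k)
  refine le_antisymm ?_ fun h hh => ?_
  · rintro _ ⟨g, rfl⟩
    exact affineHom_mem_discriminantStabilizer hr g
  obtain ⟨A, rfl⟩ := moebius_surjective h
  have hne : ∀ t : k, ![1, t] ≠ 0 := fun t h => one_ne_zero (congrFun h 0)
  have hA : ∀ t : k, hermForm ![1, t] = 0 ∨ hermForm ![1, t] = -3 * ε ^ 3 →
      hermForm (A.1.mulVec ![1, t]) = 0 ∨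
        hermForm (A.1.mulVec ![1, t]) = -3 * ε ^ 3 * (A.1.mulVec ![1, t]) 0 ^ 12 := by
    intro t ht
    have hmem : P1.point ⟨![1, t], hne t⟩ ∈ discriminantLocus ε :=
      point_mem_discriminantLocus.2 (by simpa using ht)
    have := Set.mem_image_of_mem (moebius k A).1 hmem
    change P1.point (coneMap A ⟨![1, t], hne t⟩) ∈ _ at this
    rw [show (moebius k A).1 '' discriminantLocus ε = discriminantLocus ε from hh] at this
    exact point_mem_discriminantLocus.1 this
  have hA1 : ∀ t : k, t ^ 11 = t → hermForm (A.1.mulVec ![1, t]) = 0 ∨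
      hermForm (A.1.mulVec ![1, t]) = -3 * ε ^ 3 * (A.1.mulVec ![1, t]) 0 ^ 12 :=
    fun t ht => hA t (Or.inl (by simp [hermForm, ht]))
  have hA2 : ∀ t : k, t ^ 11 - t = -3 * ε ^ 3 → hermForm (A.1.mulVec ![1, t]) = 0 ∨
      hermForm (A.1.mulVec ![1, t]) = -3 * ε ^ 3 * (A.1.mulVec ![1, t]) 0 ^ 12 :=
    fun t ht => hA t (Or.inr (by simp [hermForm, ← ht]))
  -- The product has degree at most 4 and eleven zeros.
  have hprod : quadPoly A.1 0 = 0 ∨ quadPoly A.1 (-3 * ε ^ 3) = 0 := by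
    refine forall_eq_zero_or (natDegree_quadPoly_le _ _) (natDegree_quadPoly_le _ _) fun t ht => ?_
    rw [eval_quadPoly _ _ ht, eval_quadPoly _ _ ht]
    rcases hA1 t ht with h | h <;> rw [h] <;> ring
  obtain ⟨c, n, hA01, hA11, hA10⟩ : ∃ (c : Cyc N) (n : ZMod 11), A.1 0 1 = 0 ∧
      A.1 1 1 = sgn k N hN c * A.1 0 0 ∧
      A.1 1 0 = (primeHom k n + (1 - sgn k N hN c) / 2 * r) * A.1 0 0 := by
    rcases hprod with h0 | h0
    · obtain ⟨hb, hd, n, hn⟩ := affine_of_frobenius hc hc hr A (fun t ht => by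
        have := eval_quadPoly A.1 0 ht
        rw [h0] at this
        simpa using this.symm) hA2
      refine ⟨1, n, hb, ?_, ?_⟩
      · simpa using mul_left_cancel₀ hc hd
      · simpa using hn
    · have hdetT : (!![1, 0; -r, 1] : Matrix (Fin 2) (Fin 2) k).det ≠ 0 := by
        simp [Matrix.det_fin_two]
      set T := Matrix.GeneralLinearGroup.mkOfDetNeZero _ hdetT with hT
      have hTA : ∀ v, (T * A).1.mulVec v =
          ![(A.1.mulVec v) 0, (A.1.mulVec v) 1 - r * (A.1.mulVec v) 0] := by
        intro v
        rw [Units.val_mul, ← Matrix.mulVec_mulVec]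
        generalize A.1.mulVec v = w
        funext i
        fin_cases i
        · simp [hT, Matrix.GeneralLinearGroup.mkOfDetNeZero, Matrix.vecHead]
        · simp [hT, Matrix.GeneralLinearGroup.mkOfDetNeZero, Matrix.vecHead, Matrix.vecTail]; ring
      have hherm : ∀ v, hermForm ((T * A).1.mulVec v) =
          hermForm (A.1.mulVec v) - -3 * ε ^ 3 * (A.1.mulVec v) 0 ^ 12 := by
        intro v
        rw [hTA, hermForm, hermForm]
        simp only [Matrix.cons_val_zero, Matrix.cons_val_one]
        rw [sub_pow_eleven, mul_pow]
        linear_combination -(A.1.mulVec v) 0 ^ 12 * hr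
      obtain ⟨hb, hd, n, hn⟩ := affine_of_frobenius hc (neg_ne_zero.2 hc) hr (T * A)
        (fun t ht => by
          rw [hherm, ← eval_quadPoly A.1 _ ht, h0, Polynomial.eval_zero])
        (fun t ht => by
          rw [hherm, hTA]
          rcases hA2 t ht with h | h
          · right; rw [h]; simp
          · left; rw [h]; simp)
      have e : ∀ j, (T * A).1 0 j = A.1 0 j ∧ (T * A).1 1 j = A.1 1 j - r * A.1 0 j := by
        intro j
        constructor
        · rw [Units.val_mul, Matrix.mul_apply, Fin.sum_univ_two]
          simp [hT, Matrix.GeneralLinearGroup.mkOfDetNeZero]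
        · rw [Units.val_mul, Matrix.mul_apply, Fin.sum_univ_two]
          simp [hT, Matrix.GeneralLinearGroup.mkOfDetNeZero]; ring
      rw [(e 1).1] at hb
      rw [(e 1).2, (e 0).1, hb] at hd
      rw [(e 0).2, (e 0).1] at hn
      have : Fact (1 < N) := ⟨h1⟩
      have hs : (sgn k N hN (Multiplicative.ofAdd 1) : k) = -1 := by
        simp [sgn, cycHom, ZMod.val_one]
      refine ⟨Multiplicative.ofAdd 1, n, hb, ?_, ?_⟩
      · rw [hs]
        apply mul_left_cancel₀ hc
        linear_combination hd
      · rw [hs]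
        have : ((1 : k) - -1) / 2 = 1 := by field_simp; ring
        rw [this]
        linear_combination hn
  have ha : A.1 0 0 ≠ 0 := by
    intro h
    have hdet := (Matrix.isUnits_det_units A).ne_zero
    rw [Matrix.det_fin_two, h, hA01] at hdet
    simp at hdet
  refine ⟨⟨Multiplicative.ofAdd n, c⟩, ?_⟩
  obtain ⟨B, hB, hBA⟩ := exists_smul_moebius_eq
    (affineHom r N hN ⟨Multiplicative.ofAdd n, c⟩) ha
  rw [MonoidHom.comp_apply, ← hB]
  congr 1
  apply Units.ext
  ext i j
  rw [hBA, affineHom_apply]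
  fin_cases i <;> fin_cases j <;> simp [hA01, hA11, hA10, shift] <;> ring

end Dihedral

/-! ## The action of `11 : 4` on the surface -/

section QuarticAction

variable {k : Type*} [Field k] [CharP k 11] {ε r : k} {u : kˣ}

theorem even_four : Even 4 := ⟨2, rfl⟩

omit [CharP k 11] in
theorem pow_four_of_sq {u : kˣ} (hu : u ^ 2 = -1) : u ^ 4 = 1 := by
  rw [show 4 = 2 * 2 from rfl, pow_mul, hu]; simp

omit [CharP k 11] in
theorem cycHom_sq (hu : u ^ 2 = -1) (c : Cyc 4) :
    (cycHom 4 u (pow_four_of_sq hu) c : k) ^ 2 = sgn k 4 even_four c := by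
  rw [← Units.val_pow_eq_pow_val]
  congr 1
  change (u ^ _) ^ 2 = (-1) ^ _
  rw [← pow_mul, mul_comm, pow_mul, hu]

/-- The action of `11 : 4` on the surface by `t₁ ↦ t₁ + t₀` and
`(t₁, x, y) ↦ (r t₀ - t₁, 3 ε t₀⁴ z - x, u y)` where `u² = -1`. -/
def quarticAction (hr : r ^ 11 - r = -3 * ε ^ 3) (hu : u ^ 2 = -1) :
    FibredAction ε (AffineGroup 4 even_four) where
  base := affineHom r 4 even_four
  α g := sgn k 4 even_four g.right
  β g := (1 - sgn k 4 even_four g.right) / 2 * (3 * ε)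
  γ g := cycHom 4 u (pow_four_of_sq hu) g.right
  mem := by
    rintro g v ⟨h1, h2, h3⟩
    have hsh := shift_eq r g
    rw [hr] at hsh
    have hγ := cycHom_sq hu g.right
    set γ : k := (cycHom 4 u (pow_four_of_sq hu) g.right : k)
    have hs := sgn_eq (k := k) 4 even_four g.right
    set s : k := (sgn k 4 even_four g.right : k) with hsdef
    have hs0 : s ≠ 0 := by rcases hs with h | h <;> simp [h]
    have hγ0 : γ ≠ 0 := fun h => hs0 (by rw [← hγ, h]; ring)
    have e : fibredMap (affineHom r 4 even_four g) s ((1 - s) / 2 * (3 * ε)) γ v =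
        ![v 0, shift r g * v 0 + s * v 1, s * v 2 + (1 - s) / 2 * (3 * ε) * (v 0 ^ 4 * v 4),
          γ * v 3, v 4] := by
      funext i
      fin_cases i <;> simp [fibredMap, affineHom_apply, hsdef]
    rw [e]
    refine ⟨?_, ?_, ?_⟩
    · by_cases h0 : v 0 = 0
      · right
        simpa [h0, hs0] using h1
      · exact Or.inl h0
    · by_cases h4 : v 4 = 0
      · simpa [h4, hs0, hγ0] using h2
      · exact Or.inr (Or.inr h4)
    · simp only [Matrix.cons_val]
      rw [mul_pow γ, hγ, add_pow_eleven, mul_pow, mul_pow]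
      have h2 := two_ne (k := k)
      rcases hs with h | h <;> rw [h] at hsh ⊢
      · have e : shift r g ^ 11 = shift r g := by
          rw [sub_self, zero_div, zero_mul] at hsh
          exact sub_eq_zero.1 hsh
        rw [e, sub_self, zero_div]
        linear_combination h3
      · have e1 : ((1 : k) - -1) / 2 = 1 := by field_simp; ring
        rw [e1] at hsh ⊢
        have e : shift r g ^ 11 = shift r g + -3 * ε ^ 3 := by linear_combination hsh
        rw [e]
        -- Modulo 11, replacing x by 3εt₀⁴z - x turns x³ + εx²t₀⁴z into its negative plus 3ε³t₀¹²z³.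
        -- This cancels the term -3ε³t₀¹²z³ coming from the reflected binary form; the correction
        -- collects the multiples 11, -33 and 33.
        linear_combination -h3 + (ε * v 2 ^ 2 * v 4 * v 0 ^ 4 -
          3 * ε ^ 2 * v 2 * v 0 ^ 8 * v 4 ^ 2 + 3 * ε ^ 3 * v 0 ^ 12 * v 4 ^ 3) * eleven_eq (k := k)
  one_apply v := by
    funext i
    fin_cases i <;> simp [fibredMap]
  mul_apply g h v := by
    have h2 := two_ne (k := k)
    have hg := cycHom_sq hu g.right
    rw [map_mul]
    funext i
    fin_cases i
    · simp [fibredMap, affineHom_apply]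
    · simp [fibredMap, affineHom_apply]; ring
    · simp [fibredMap, affineHom_apply]; field_simp; ring
    · simp [fibredMap]; ring
    · simp [fibredMap]

variable (hr : r ^ 11 - r = -3 * ε ^ 3) (hu : u ^ 2 = -1)

include hu in
theorem orderOf_eq_four : orderOf u = 4 := by
  refine orderOf_eq_prime_pow (p := 2) (n := 1) (fun h => ?_) (pow_four_of_sq hu)
  rw [pow_one, hu] at h
  have := congrArg (fun u : kˣ => (u : k)) h
  simp only [Units.val_neg, Units.val_one] at this
  apply two_ne (k := k)
  linear_combination -this

variable [IsAlgClosed k]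

/-- The multiplier is αγ = γ³ because α = γ², and γ³ = 1 together with γ⁴ = 1 gives γ = 1. -/
theorem isSymplectic_quarticAction_iff (g : AffineGroup 4 even_four) :
    IsSymplectic ((quarticAction hr hu).toAut g) ↔ g.right = 1 := by
  have hb : ((quarticAction hr hu).base g).1 = !![1, 0; shift r g, sgn k 4 even_four g.right] :=
    affineHom_apply r g
  rw [(quarticAction hr hu).isSymplectic_toAut_iff g (t := 0) (by simp) (by rw [hb]; simp), hb]
  change (sgn k 4 even_four g.right : k) * (cycHom 4 u (pow_four_of_sq hu) g.right : k) = _ ↔ _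
  rw [← cycHom_sq hu, ← cycHom_injective (orderOf_eq_four hu) |>.eq_iff, map_one]
  have h4 : (cycHom 4 u (pow_four_of_sq hu) g.right) ^ 4 = 1 := by
    change (u ^ _) ^ 4 = 1
    rw [← pow_mul, mul_comm, pow_mul, pow_four_of_sq hu, one_pow]
  generalize cycHom 4 u (pow_four_of_sq hu) g.right = w at h4 ⊢
  have h4' := congrArg Units.val h4
  simp at h4' ⊢
  refine ⟨fun h => ?_, fun h => by rw [h]; simp⟩
  apply Units.ext
  rw [Units.val_one]
  linear_combination h4' - w * h

/-- An element acting trivially is symplectic, hence a translation, and a translation acting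
trivially on the base is zero. -/
theorem quarticAction_injective : Function.Injective (quarticAction hr hu).toAut := by
  rw [injective_iff_map_eq_one]
  intro g hg
  have hright : g.right = 1 := by
    rw [← isSymplectic_quarticAction_iff hr hu, hg, ← map_one (quarticAction hr hu).toAut,
      isSymplectic_quarticAction_iff]
    rfl
  have h1 := ((quarticAction hr hu).induces_iff 1 _).2 rfl
  rw [map_one, ← hg, (quarticAction hr hu).induces_iff, map_one, map_one] at h1
  obtain ⟨-, h2, -⟩ := (moebius_eq_one_iff _).1 h1
  have hb : ((quarticAction hr hu).base g).1 = !![1, 0; shift r g, sgn k 4 even_four g.right] :=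
    affineHom_apply r g
  rw [hb, shift, hright] at h2
  refine SemidirectProduct.ext ?_ hright
  apply Multiplicative.toAdd.injective
  apply (primeHom k).injective
  simpa using h2

omit [CharP k 11] in
theorem exists_root_artinSchreier (c : k) : ∃ r : k, r ^ 11 - r = c := by
  obtain ⟨r, h⟩ := IsAlgClosed.exists_root
    (Polynomial.X ^ 11 - Polynomial.X - Polynomial.C c : Polynomial k) (by
      have : (Polynomial.X ^ 11 - Polynomial.X - Polynomial.C c : Polynomial k).degree = 11 := by
        compute_degree!
      rw [this]; norm_num)
  exact ⟨r, sub_eq_zero.1 (by simpa using h)⟩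

/-- The finite group of automorphisms of the surface with parameter `ε ≠ 0`. -/
theorem exists_group_of_ne_zero (hε : ε ≠ 0) :
    ∃ K : Subgroup (VarietyAut k (Surface ε)), Finite K ∧
      (∀ g ∈ K, (∃ h : VarietyAut k (P1 k), Induces g h) ∧
        g.1 '' zeroSection ε = zeroSection ε) ∧
      (∃ (φ : Cyc 4 →* MulAut (Cyc 11)) (e : Cyc 11 ⋊[φ] Cyc 4 ≃* K), φ ≠ 1 ∧
        (∀ a : Cyc 11, IsSymplectic (e (SemidirectProduct.inl a)).1) ∧
        (∀ c : Cyc 4, c ≠ 1 → ¬ IsSymplectic (e (SemidirectProduct.inr c)).1)) ∧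
      {h : VarietyAut k (P1 k) | ∃ g ∈ K, Induces g h} = discriminantStabilizer ε ∧
      (∃ φ : Cyc 2 →* MulAut (Cyc 11), φ ≠ 1 ∧
        Nonempty (discriminantStabilizer ε ≃* Cyc 11 ⋊[φ] Cyc 2)) := by
  obtain ⟨r, hr⟩ := exists_root_artinSchreier (-3 * ε ^ 3)
  obtain ⟨i, hi⟩ := IsAlgClosed.exists_pow_nat_eq (-1 : k) two_pos
  have hi0 : i ≠ 0 := by rintro rfl; simp at hi
  obtain ⟨u, hu⟩ : ∃ u : kˣ, u ^ 2 = -1 := ⟨Units.mk0 i hi0, Units.ext (by simpa using hi)⟩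
  have hinj := quarticAction_injective hr hu
  refine ⟨(quarticAction hr hu).toAut.range, ?_, ?_,
    ⟨inversion 4 even_four, MonoidHom.ofInjective hinj, inversion_ne_one _ _ (by norm_num),
      fun a => ?_, fun c hc => ?_⟩, ?_, ⟨inversion 2 even_two, inversion_ne_one _ _ (by norm_num),
      ⟨?_⟩⟩⟩
  · have : Finite (AffineGroup 4 even_four) := Finite.of_equiv _ SemidirectProduct.equivProd.symm
    exact Finite.of_equiv _ (MonoidHom.ofInjective hinj).toEquiv
  · rintro _ ⟨g, rfl⟩
    exact ⟨⟨_, (quarticAction hr hu).induces g⟩, (quarticAction hr hu).image_zeroSection g⟩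
  · exact (isSymplectic_quarticAction_iff hr hu _).2 rfl
  · exact fun h => hc ((isSymplectic_quarticAction_iff hr hu (SemidirectProduct.inr c)).1 h)
  · rw [← range_affineHom hε hr even_four (by norm_num)]
    ext h
    constructor
    · rintro ⟨_, ⟨g, rfl⟩, hg⟩
      exact ⟨g, ((quarticAction hr hu).induces_iff g h).1 hg⟩
    · rintro ⟨g, hg⟩
      exact ⟨_, ⟨g, rfl⟩, ((quarticAction hr hu).induces_iff g h).2 hg⟩
  · exact (MulEquiv.subgroupCongr (range_affineHom hε hr even_two (by norm_num)).symm).trans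
      (MonoidHom.ofInjective (affineHom_moebius_injective r)).symm

end QuarticAction

/-! ## The unitary group acting on the surface with `ε = 0` -/

section HermGroup

variable {k : Type*} [Field k] [CharP k 11]

variable (k) in
/-- The matrices with `det A • Ā = A`, which preserve the form `t₁¹¹ t₀ - t₀¹¹ t₁`. -/
def hermGroup : Subgroup (GL (Fin 2) k) where
  carrier := {A | A.1.det • A.1.map (frobenius k 11) = A.1}
  mul_mem' := by
    intro A B hA hB
    simp only [Set.mem_ofPred_eq] at hA hB ⊢
    rw [Units.val_mul, Matrix.det_mul, Matrix.map_mul]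
    conv_rhs => rw [← hA, ← hB]
    rw [Matrix.smul_mul, Matrix.mul_smul, smul_smul]
  one_mem' := by simp
  inv_mem' := by
    intro A hA
    simp only [Set.mem_ofPred_eq] at hA ⊢
    have h1 : (A⁻¹).1 * A.1 = 1 := by rw [← Units.val_mul, inv_mul_cancel, Units.val_one]
    have h2 : A.1 * (A⁻¹).1 = 1 := by rw [← Units.val_mul, mul_inv_cancel, Units.val_one]
    have h3 : ((A⁻¹).1.det • (A⁻¹).1.map (frobenius k 11)) * A.1 = 1 := by
      conv_lhs => rw [← hA]
      rw [Matrix.smul_mul, Matrix.mul_smul, smul_smul, ← Matrix.det_mul, ← Matrix.map_mul, h1]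
      simp
    calc _ = ((A⁻¹).1.det • (A⁻¹).1.map (frobenius k 11)) * (A.1 * (A⁻¹).1) := by
          rw [h2, Matrix.mul_one]
      _ = _ := by rw [← Matrix.mul_assoc, h3, Matrix.one_mul]

theorem mem_hermGroup {A : GL (Fin 2) k} :
    A ∈ hermGroup k ↔ ∀ i j, A.1.det * A.1 i j ^ 11 = A.1 i j := by
  change A.1.det • A.1.map (frobenius k 11) = A.1 ↔ _
  rw [← Matrix.ext_iff]
  simp [frobenius_def]

omit [CharP k 11] in
theorem det_ne (A : GL (Fin 2) k) : A.1.det ≠ 0 := (Matrix.isUnits_det_units A).ne_zero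

/-- The form is det(v, v̄). Since Ā = (det A)⁻¹A, the conjugate of Av is (det A)⁻¹A v̄, and the two
factors det A cancel. -/
theorem hermForm_mulVec {A : GL (Fin 2) k} (hA : A ∈ hermGroup k) (v : Fin 2 → k) :
    hermForm (A.1.mulVec v) = hermForm v := by
  rw [mem_hermGroup] at hA
  apply mul_left_cancel₀ (det_ne A)
  simp only [hermForm, mulVec_fin_two]
  rw [add_pow_eleven, add_pow_eleven, mul_pow, mul_pow, mul_pow, mul_pow]
  have e := Matrix.det_fin_two A.1
  linear_combination (v 0 ^ 11 * (A.1 0 0 * v 0 + A.1 0 1 * v 1)) * hA 1 0 +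
    (v 1 ^ 11 * (A.1 0 0 * v 0 + A.1 0 1 * v 1)) * hA 1 1 -
    (v 0 ^ 11 * (A.1 1 0 * v 0 + A.1 1 1 * v 1)) * hA 0 0 -
    (v 1 ^ 11 * (A.1 1 0 * v 0 + A.1 1 1 * v 1)) * hA 0 1 -
    (v 1 ^ 11 * v 0 - v 0 ^ 11 * v 1) * e

variable (k) in
/-- The linear action on the surface with `ε = 0`. -/
def hermAction : FibredAction (0 : k) (hermGroup k) where
  base := (hermGroup k).subtype
  α _ := 1
  β _ := 0
  γ _ := 1
  mem := by
    rintro ⟨A, hA⟩ v ⟨h1, h2, h3⟩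
    have e : fibredMap A 1 0 1 v =
        ![A.1.mulVec ![v 0, v 1] 0, A.1.mulVec ![v 0, v 1] 1, v 2, v 3, v 4] := by
      funext i
      fin_cases i <;> simp [fibredMap]
    have hherm := hermForm_mulVec hA ![v 0, v 1]
    have hne := mulVec_ne_zero A (v := ![v 0, v 1]) (fun h =>
      h1.elim (fun h' => h' (congrFun h 0)) (fun h' => h' (congrFun h 1)))
    change fibredMap A 1 0 1 v ∈ _
    rw [e]
    generalize A.1.mulVec ![v 0, v 1] = w at hherm hne ⊢
    simp only [hermForm, Matrix.cons_val_zero, Matrix.cons_val_one] at hherm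
    refine ⟨?_, h2, ?_⟩
    · by_contra! h
      exact hne (funext fun i => by fin_cases i; exacts [h.1, h.2])
    · simp only [Matrix.cons_val]
      rw [hherm]
      linear_combination h3
  one_apply v := by
    funext i
    fin_cases i <;> simp [fibredMap]
  mul_apply g h v := by
    funext i
    fin_cases i <;> simp [fibredMap, Matrix.mul_apply] <;> ring

-- Provides a test point whose image has t₀ ≠ 0: the first row of an invertible matrix does not
-- vanish at both t = 0 and t = 1.
omit [CharP k 11] in
theorem row_ne_zero (A : GL (Fin 2) k) : ∃ t : k, t ^ 11 = t ∧ A.1 0 0 + A.1 0 1 * t ≠ 0 := by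
  by_cases h : A.1 0 0 = 0
  · refine ⟨1, one_pow _, fun h1 => det_ne A ?_⟩
    rw [Matrix.det_fin_two, h, show A.1 0 1 = 0 by linear_combination h1 - h]
    ring
  · exact ⟨0, by simp, by simpa using h⟩

/-- For rational t the value L of the first row satisfies det A · L¹¹ = L, so the multiplier L⁻¹⁰ of
dx ∧ dy equals det A. -/
theorem isSymplectic_hermAction_iff [IsAlgClosed k] (A : hermGroup k) :
    IsSymplectic ((hermAction k).toAut A) ↔ A.1.1.det = 1 := by
  obtain ⟨t, ht, hL⟩ := row_ne_zero A.1
  rw [(hermAction k).isSymplectic_toAut_iff A ht hL]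
  have hA := mem_hermGroup.1 A.2
  have e : A.1.1.det * (A.1.1 0 0 + A.1.1 0 1 * t) ^ 11 = A.1.1 0 0 + A.1.1 0 1 * t := by
    rw [add_pow_eleven, mul_pow, ht]
    linear_combination hA 0 0 + t * hA 0 1
  have e' : A.1.1.det * (A.1.1 0 0 + A.1.1 0 1 * t) ^ 10 = 1 := by
    apply mul_right_cancel₀ hL
    linear_combination e
  change (1 : k) * 1 = (A.1.1 0 0 + A.1.1 0 1 * t) ^ 10 ↔ _
  constructor
  · intro h
    rw [← h] at e'
    simpa using e'
  · intro h
    rw [h] at e'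
    linear_combination -e'

omit [CharP k 11] in
/-- The scalar matrices. -/
def IsScalar (A : GL (Fin 2) k) : Prop := A.1 0 1 = 0 ∧ A.1 1 0 = 0 ∧ A.1 0 0 = A.1 1 1

omit [CharP k 11] in
theorem IsScalar.det {A : GL (Fin 2) k} (h : IsScalar A) : A.1.det = A.1 0 0 ^ 2 := by
  rw [Matrix.det_fin_two, h.1, ← h.2.2]; ring

omit [CharP k 11] in
theorem IsScalar.ne_zero {A : GL (Fin 2) k} (h : IsScalar A) : A.1 0 0 ≠ 0 := by
  have := det_ne A
  rw [h.det] at this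
  exact fun h0 => this (by rw [h0]; ring)

theorem IsScalar.pow_twelve {A : GL (Fin 2) k} (h : IsScalar A) (hA : A ∈ hermGroup k) :
    A.1 0 0 ^ 12 = 1 := by
  have := mem_hermGroup.1 hA 0 0
  rw [h.det] at this
  apply mul_right_cancel₀ h.ne_zero
  linear_combination this

/-- A matrix acting trivially is a scalar a, and being symplectic it has a² = det A = 1. Conversely
±1 acts like the torus element (±1, 1), because the weights 4 and 6 of x and y are even. -/
theorem hermAction_eq_one_iff [IsAlgClosed k] (A : hermGroup k) :
    (hermAction k).toAut A = 1 ↔ IsScalar A.1 ∧ A.1.1 0 0 ^ 2 = 1 := by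
  constructor
  · intro h
    have h1 := ((hermAction k).induces_iff 1 _).2 rfl
    rw [map_one, ← h, (hermAction k).induces_iff, map_one, map_one] at h1
    have hs : IsScalar A.1 := (moebius_eq_one_iff _).1 h1
    refine ⟨hs, ?_⟩
    rw [← hs.det, ← isSymplectic_hermAction_iff, h, ← map_one (hermAction k).toAut,
      isSymplectic_hermAction_iff]
    simp
  · rintro ⟨⟨h1, h2, h3⟩, h4⟩
    apply Subtype.ext
    apply Equiv.ext
    intro x
    obtain ⟨v, rfl⟩ := Surface.exists_point x
    change Surface.point ((hermAction k).act A v) = Surface.point v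
    have h0 : A.1.1 0 0 ≠ 0 := fun h => by rw [h] at h4; simp at h4
    have h6 : A.1.1 0 0 ^ 4 = 1 ∧ A.1.1 0 0 ^ 6 = 1 := by
      rw [show 4 = 2 * 2 from rfl, show 6 = 2 * 3 from rfl, pow_mul, pow_mul, h4]; simp
    refine point_eq_iff.2 ⟨Units.mk0 _ h0, 1, fun i => ?_⟩
    fin_cases i <;>
      simp [FibredAction.act, fibredMap, hermAction, weight₁, weight₂, h1, h2, ← h3, h6]

/-! ### The prime field subgroup and a complement -/

variable (k) in
/-- The special linear group over the prime field. -/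
def slHom : Matrix.SpecialLinearGroup (Fin 2) (ZMod 11) →* hermGroup k :=
  (Matrix.SpecialLinearGroup.toGL.comp (Matrix.SpecialLinearGroup.map (primeHom k))).codRestrict
    (hermGroup k) (fun x => by
      rw [mem_hermGroup]
      intro i j
      have hdet : (x.1.map (primeHom k)).det = 1 := by
        rw [← RingHom.mapMatrix_apply, ← RingHom.map_det, x.2, map_one]
      simp [primeHom_pow, hdet])

theorem slHom_apply (x : Matrix.SpecialLinearGroup (Fin 2) (ZMod 11)) (i j : Fin 2) :
    (slHom k x).1.1 i j = primeHom k (x.1 i j) := rfl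

theorem det_slHom (x : Matrix.SpecialLinearGroup (Fin 2) (ZMod 11)) : (slHom k x).1.1.det = 1 := by
  rw [Matrix.det_fin_two]
  simp only [slHom_apply, ← map_mul, ← map_sub]
  rw [← Matrix.det_fin_two, x.2, map_one]

/-- With determinant 1 the defining relation says that every entry is fixed by Frobenius. -/
theorem exists_slHom {A : hermGroup k} (hA : A.1.1.det = 1) : ∃ x, slHom k x = A := by
  have h := mem_hermGroup.1 A.2
  rw [hA] at h
  choose n hn using fun i j => exists_primeHom (k := k) (t := A.1.1 i j) (by simpa using h i j)
  refine ⟨⟨Matrix.of n, (primeHom k).injective ?_⟩, ?_⟩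
  · rw [Matrix.det_fin_two]
    simp [hn]
    rw [← Matrix.det_fin_two, hA]
  · apply Subtype.ext
    apply Units.ext
    ext i j
    exact hn i j

theorem isScalar_slHom_iff {x : Matrix.SpecialLinearGroup (Fin 2) (ZMod 11)} :
    IsScalar (slHom k x).1 ↔ x ∈ Subgroup.center (Matrix.SpecialLinearGroup (Fin 2) (ZMod 11)) := by
  rw [Matrix.SpecialLinearGroup.mem_center_iff, IsScalar]
  simp only [slHom_apply, map_eq_zero, (primeHom k).injective.eq_iff]
  constructor
  · rintro ⟨h1, h2, h3⟩
    have hdet := x.2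
    rw [Matrix.det_fin_two, h1, ← h3] at hdet
    refine ⟨x.1 0 0, by simpa [pow_two] using hdet, ?_⟩
    ext i j
    fin_cases i <;> fin_cases j <;> simp [h1, h2, h3]
  · rintro ⟨r, -, hr⟩
    rw [← hr]
    simp

/-- A diagonalizable torus in the unitary group, with determinant as parameter. -/
def torus {i : k} (hi : i ^ 2 = -1) : kˣ →* GL (Fin 2) k :=
  -- This matrix has eigenvalue 1 on (1, i) and z on (1, -i), two vectors that are orthogonal for
  -- the form det(v, w̄).
  MonoidHom.mk' (fun z => Matrix.GeneralLinearGroup.mkOfDetNeZero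
    !![(1 + (z : k)) / 2, -i * (1 - z) / 2; i * (1 - z) / 2, (1 + z) / 2] (by
      have h2 := two_ne (k := k)
      have : (1 + (z : k)) / 2 * ((1 + z) / 2) - -i * (1 - z) / 2 * (i * (1 - z) / 2) = z := by
        field_simp
        linear_combination (1 - (z : k)) ^ 2 * hi
      rw [Matrix.det_fin_two_of, this]
      exact z.ne_zero)) (by
    intro z w
    have h2 := two_ne (k := k)
    apply Units.ext
    ext a b
    fin_cases a <;> fin_cases b <;>
      simp [Matrix.GeneralLinearGroup.mkOfDetNeZero] <;> field_simp
    · linear_combination (1 - (z : k)) * (1 - w) * hi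
    · ring
    · ring
    · linear_combination (1 - (z : k)) * (1 - w) * hi)

theorem torus_apply {i : k} (hi : i ^ 2 = -1) (z : kˣ) : (torus hi z).1 =
    !![(1 + (z : k)) / 2, -i * (1 - z) / 2; i * (1 - z) / 2, (1 + z) / 2] := rfl

theorem det_torus {i : k} (hi : i ^ 2 = -1) (z : kˣ) : (torus hi z).1.det = z := by
  have h2 := two_ne (k := k)
  rw [torus_apply, Matrix.det_fin_two_of]
  field_simp
  linear_combination (1 - (z : k)) ^ 2 * hi

/-- Frobenius maps i to -i and, as z¹² = 1, z to z⁻¹; multiplying the conjugate by det = z restores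
the matrix. -/
theorem torus_mem {i : k} (hi : i ^ 2 = -1) {z : kˣ} (hz : z ^ 12 = 1) :
    torus hi z ∈ hermGroup k := by
  have h2 := two_ne (k := k)
  have hz' : (z : k) * (z : k) ^ 11 = 1 := by
    have := congrArg Units.val hz
    simp at this
    linear_combination this
  have h2' : (2 : k) ^ 11 = 2 := by linear_combination 186 * eleven_eq (k := k)
  have hi' : i ^ 11 = -i := by
    linear_combination (i ^ 9 - i ^ 7 + i ^ 5 - i ^ 3 + i) * hi
  rw [mem_hermGroup]
  intro a b
  rw [det_torus, torus_apply]
  fin_cases a <;> fin_cases b <;>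
    simp [div_pow, mul_pow, add_pow_eleven, sub_pow_eleven, h2', hi',
        Odd.neg_pow (by decide : Odd 11)] <;>
      field_simp
  · linear_combination hz'
  · linear_combination -i * hz'
  · linear_combination i * hz'
  · linear_combination hz'

end HermGroup

/-! ## The unitary group over the field with `121` elements -/

section Unitary

variable {k : Type*} [Field k] [CharP k 11]

/-- The conjugate transpose equation, entry by entry. -/
theorem transpose_mul_map_eq_one_iff {F : Type*} [Field F] (A : Matrix (Fin 2) (Fin 2) F)
    (f : F → F) :
    A.transpose * A.map f = 1 ↔
      A 0 0 * f (A 0 0) + A 1 0 * f (A 1 0) = 1 ∧ A 0 0 * f (A 0 1) + A 1 0 * f (A 1 1) = 0 ∧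
      A 0 1 * f (A 0 0) + A 1 1 * f (A 1 0) = 0 ∧ A 0 1 * f (A 0 1) + A 1 1 * f (A 1 1) = 1 := by
  rw [← Matrix.ext_iff]
  simp [Fin.forall_fin_two, Matrix.mul_apply, Fin.sum_univ_two, and_assoc]

/-- For 2 × 2 matrices BᵗJB = det B · J, where J is the Gram matrix of det(v, w̄). Cancelling AᵗJ
turns the unitarity condition AᵗJĀ = J into det A · Ā = A. -/
theorem mem_hermGroup_iff {A : GL (Fin 2) k} : A ∈ hermGroup k ↔
    A.1.transpose * !![0, 1; -1, 0] * A.1.map (frobenius k 11) = !![0, 1; -1, 0] := by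
  have hJ : ∀ B : Matrix (Fin 2) (Fin 2) k,
      B.transpose * !![0, 1; -1, 0] * B = B.det • !![0, 1; -1, 0] := by
    intro B
    ext i j
    fin_cases i <;> fin_cases j <;>
      simp [Matrix.mul_apply, Fin.sum_univ_two, Matrix.det_fin_two] <;> ring
  have hd := det_ne A
  have hinv : IsUnit (A.1.transpose * !![0, 1; -1, 0]).det := by
    rw [Matrix.det_mul, Matrix.det_transpose]
    simpa using hd
  change A.1.det • A.1.map (frobenius k 11) = A.1 ↔ _
  constructor
  · intro h
    have := hJ A.1
    nth_rewrite 2 [← h] at this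
    rw [Matrix.mul_smul] at this
    exact smul_right_injective _ hd this
  · intro h
    apply (Matrix.isUnit_iff_isUnit_det _).2 hinv |>.mul_left_cancel
    rw [Matrix.mul_smul, h, hJ]

/-- The change of basis between the two hermitian forms. -/
theorem conj_mem_hermGroup_iff {P : GL (Fin 2) k} {c : k} (hc : c ≠ 0)
    (hP : P.1.transpose * !![0, 1; -1, 0] * P.1.map (frobenius k 11) =
      c • (1 : Matrix (Fin 2) (Fin 2) k)) (A : GL (Fin 2) k) :
    P * A * P⁻¹ ∈ hermGroup k ↔ A.1.transpose * A.1.map (frobenius k 11) = 1 := by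
  rw [mem_hermGroup_iff]
  set J : Matrix (Fin 2) (Fin 2) k := !![0, 1; -1, 0]
  set F := frobenius k 11
  set B := P * A * P⁻¹ with hB
  have h1 : B.1 * P.1 = P.1 * A.1 := by
    rw [← Units.val_mul, ← Units.val_mul, hB, inv_mul_cancel_right]
  have h2 : B.1.map F * P.1.map F = P.1.map F * A.1.map F := by
    rw [← Matrix.map_mul, h1, Matrix.map_mul]
  have h3 : P.1.transpose * B.1.transpose = A.1.transpose * P.1.transpose := by
    rw [← Matrix.transpose_mul, h1, Matrix.transpose_mul]
  have key : P.1.transpose * (B.1.transpose * J * B.1.map F) * P.1.map F =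
      c • (A.1.transpose * A.1.map F) := by
    calc _ = (P.1.transpose * B.1.transpose) * J * (B.1.map F * P.1.map F) := by
          simp only [Matrix.mul_assoc]
      _ = A.1.transpose * (P.1.transpose * J * P.1.map F) * A.1.map F := by
          rw [h2, h3]; simp only [Matrix.mul_assoc]
      _ = _ := by rw [hP, Matrix.mul_smul, Matrix.mul_one, Matrix.smul_mul]
  have hu1 : IsUnit P.1.transpose := by
    rw [Matrix.isUnit_iff_isUnit_det, Matrix.det_transpose]
    exact (det_ne P).isUnit
  have hu2 : IsUnit (P.1.map F) := by
    rw [Matrix.isUnit_iff_isUnit_det, ← RingHom.mapMatrix_apply, ← RingHom.map_det]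
    exact (det_ne P).isUnit.map F
  constructor
  · intro h
    rw [h, hP] at key
    exact (smul_right_injective _ hc key).symm
  · intro h
    rw [h, ← hP] at key
    exact hu1.mul_left_cancel (hu2.mul_right_cancel key)

/-- A matrix unitary with respect to the Frobenius conjugation has entries in the field with `121`
elements. -/
theorem pow_card_of_unitary {A : GL (Fin 2) k} (hA : A.1.transpose * A.1.map (frobenius k 11) = 1)
    (i j : Fin 2) : A.1 i j ^ 121 = A.1 i j := by
  set F := frobenius k 11
  have h1 : A.1.map F * A.1.transpose = 1 := mul_eq_one_comm.1 hA
  have h2 : (A.1.map F).map F * (A.1.map F).transpose = 1 := by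
    rw [← Matrix.transpose_map, ← Matrix.map_mul, h1]
    simp
  have h3 : (A.1.map F).transpose * A.1 = 1 := by
    rw [← Matrix.transpose_transpose A.1, ← Matrix.transpose_mul, Matrix.transpose_transpose, hA,
      Matrix.transpose_one]
  -- Both matrices are inverse to the transpose of Ā.
  have h4 : (A.1.map F).map F = A.1 := by
    rw [← Matrix.mul_one ((A.1.map F).map F), ← h3, ← Matrix.mul_assoc, h2, Matrix.one_mul]
  have := congrFun (congrFun h4 i) j
  simp only [Matrix.map_apply] at this
  rw [show F = frobenius k 11 from rfl, frobenius_def, frobenius_def, ← pow_mul] at this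
  exact this

variable [IsAlgClosed k]

variable (k) in
theorem exists_embedding : Nonempty (GaloisField 11 2 →+* k) := by
  let : Algebra (ZMod 11) k := ZMod.algebra k 11
  exact ⟨(IsAlgClosed.lift (R := ZMod 11) (M := k) (S := GaloisField 11 2)).toRingHom⟩

variable (k) in
/-- The unitary group is isomorphic to the group preserving the form. -/
theorem exists_unitaryEquiv : ∃ e : GU2 ≃* hermGroup k, ∀ A : GU2,
    (A.1 = 1 ∨ A.1 = -1) ↔ IsScalar (e A).1 ∧ (e A).1.1 0 0 ^ 2 = 1 := by
  obtain ⟨f⟩ := exists_embedding k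
  have h2 := two_ne (k := k)
  obtain ⟨i, hi⟩ := IsAlgClosed.exists_pow_nat_eq (-1 : k) two_pos
  -- The columns (1, i) and s(1, -i) of the matrix P below are orthogonal for J, with norms -2i and
  -- 2i s¹². The choice s¹² = -1 makes the norms equal, so P carries the standard form to J up to a
  -- scalar.
  obtain ⟨s, hs⟩ := IsAlgClosed.exists_pow_nat_eq (-1 : k) (n := 12) (by norm_num)
  have hi0 : i ≠ 0 := by rintro rfl; simp at hi
  have hs0 : s ≠ 0 := by rintro rfl; simp at hs
  have hdet : (!![1, s; i, -(i * s)] : Matrix (Fin 2) (Fin 2) k).det ≠ 0 := by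
    rw [Matrix.det_fin_two_of, show 1 * -(i * s) - s * i = -(2 * i * s) by ring]
    simp [h2, hi0, hs0]
  set P := Matrix.GeneralLinearGroup.mkOfDetNeZero _ hdet with hPdef
  have hi' : i ^ 11 = -i := by
    linear_combination (i ^ 9 - i ^ 7 + i ^ 5 - i ^ 3 + i) * hi
  have hc : -(2 * i) ≠ 0 := by simp [h2, hi0]
  have hP : P.1.transpose * !![0, 1; -1, 0] * P.1.map (frobenius k 11) =
      (-(2 * i)) • (1 : Matrix (Fin 2) (Fin 2) k) := by
    ext a b
    fin_cases a <;> fin_cases b <;>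
      simp [hPdef, Matrix.GeneralLinearGroup.mkOfDetNeZero, Matrix.mul_apply, Fin.sum_univ_two,
        frobenius_def, hi', mul_pow, Odd.neg_pow (by decide : Odd 11)]
    · ring
    · ring
    · linear_combination (2 * i) * hs
  set E : GU2 →* GL (Fin 2) k := (MulAut.conj P).toMonoidHom.comp
    ((Matrix.GeneralLinearGroup.map f).comp GU2.subtype) with hE
  have hEapp : ∀ A : GU2, E A = P * Matrix.GeneralLinearGroup.map f A.1 * P⁻¹ := fun _ => rfl
  have hmapinj : Function.Injective (Matrix.GeneralLinearGroup.map (n := Fin 2) f) := by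
    intro A B h
    apply Units.ext
    ext a b
    apply f.injective
    exact congrArg (fun C : GL (Fin 2) k => C.1 a b) h
  have hinj : Function.Injective E :=
    (MulAut.conj P).injective.comp (hmapinj.comp Subtype.val_injective)
  have hrange : E.range = hermGroup k := by
    ext B
    constructor
    · rintro ⟨A, rfl⟩
      rw [hEapp, conj_mem_hermGroup_iff hc hP]
      have hA : A.1.1.transpose * A.1.1.map conj = 1 := A.2
      rw [transpose_mul_map_eq_one_iff] at hA
      obtain ⟨e1, e2, e3, e4⟩ := hA
      simp only [frobenius_def] at e1 e2 e3 e4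
      rw [transpose_mul_map_eq_one_iff]
      simp only [Matrix.GeneralLinearGroup.map_apply, frobenius_def, ← map_pow, ← map_mul,
        ← map_add]
      rw [e1, e2, e3, e4]
      simp
    · intro hB
      set A := P⁻¹ * B * P with hA
      have hBA : B = P * A * P⁻¹ := by rw [hA]; group
      rw [hBA, conj_mem_hermGroup_iff hc hP] at hB
      have : Fintype (GaloisField 11 2) := Fintype.ofFinite _
      have hcard : Fintype.card (GaloisField 11 2) = 121 := by
        rw [← Nat.card_eq_fintype_card, GaloisField.card 11 2 two_ne_zero]
        norm_num
      -- The entries of a unitary matrix over k are fixed by the 121st power map, so they come from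
      -- the field with 121 elements.
      choose n hn using fun a b => exists_of_pow_card f (t := A.1 a b) (by
        rw [hcard]; exact pow_card_of_unitary hB a b)
      have hN : (Matrix.of n).det ≠ 0 := by
        intro h
        apply det_ne A
        rw [Matrix.det_fin_two] at h ⊢
        have := congrArg f h
        simpa [hn] using this
      have hmap : Matrix.GeneralLinearGroup.map f
          (Matrix.GeneralLinearGroup.mkOfDetNeZero _ hN) = A := by
        apply Units.ext
        ext a b
        exact hn a b
      refine ⟨⟨Matrix.GeneralLinearGroup.mkOfDetNeZero _ hN, ?_⟩, ?_⟩
      · change (Matrix.of n).transpose * (Matrix.of n).map conj = 1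
        rw [transpose_mul_map_eq_one_iff] at hB ⊢
        simp only [← hn, Matrix.of_apply, frobenius_def, ← map_pow, ← map_mul, ← map_add] at hB ⊢
        obtain ⟨e1, e2, e3, e4⟩ := hB
        exact ⟨f.injective (by rw [e1, map_one]), f.injective (by rw [e2, map_zero]),
          f.injective (by rw [e3, map_zero]), f.injective (by rw [e4, map_one])⟩
      · rw [hEapp, hBA]
        rw [hmap]
  refine ⟨(MonoidHom.ofInjective hinj).trans (MulEquiv.subgroupCongr hrange), fun A => ?_⟩
  change _ ↔ IsScalar (E A) ∧ (E A).1 0 0 ^ 2 = 1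
  have hone : A.1 = 1 ↔ E A = 1 := by
    rw [← map_one E, hinj.eq_iff]
    exact Subtype.coe_inj (b := (1 : GU2))
  have hneg : A.1 = -1 ↔ E A = -1 := by
    have : Matrix.GeneralLinearGroup.map f (-1 : GL (Fin 2) (GaloisField 11 2)) = -1 := by
      apply Units.ext
      ext a b
      fin_cases a <;> fin_cases b <;> simp [Matrix.GeneralLinearGroup.map_apply]
    rw [← hmapinj.eq_iff, this, hEapp]
    constructor
    · intro h; rw [h]; simp
    · intro h
      rw [mul_inv_eq_iff_eq_mul, neg_one_mul] at h
      apply mul_left_cancel (a := P)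
      rw [h]; simp
  rw [hone, hneg]
  constructor
  · rintro (h | h) <;> rw [h] <;> simp [IsScalar]
  · rintro ⟨⟨h1, h2, h3⟩, h4⟩
    refine (mul_self_eq_one_iff.1 ((pow_two _).symm.trans h4)).imp (fun h => ?_) (fun h => ?_) <;>
    · apply Units.ext
      ext a b
      fin_cases a <;> fin_cases b <;> simp [h1, h2, ← h3, h]

end Unitary

/-! ## The groups for `ε = 0` -/

section ZeroParameter

variable {k : Type*} [Field k] [CharP k 11]

/-- Taking determinants in det A · Ā = A gives d²d¹¹ = d for d = det A. -/
theorem pow_twelve_det (A : hermGroup k) : A.1.1.det ^ 12 = 1 := by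
  have h := mem_hermGroup.1 A.2
  have hd := det_ne A.1
  have e := Matrix.det_fin_two A.1.1
  have e11 : A.1.1.det ^ 11 =
      A.1.1 0 0 ^ 11 * A.1.1 1 1 ^ 11 - A.1.1 0 1 ^ 11 * A.1.1 1 0 ^ 11 := by
    rw [e, sub_pow_eleven, mul_pow, mul_pow]
  apply mul_right_cancel₀ hd
  have : A.1.1.det ^ 2 * A.1.1.det ^ 11 = A.1.1.det := by
    rw [e11]
    linear_combination (A.1.1.det * A.1.1 1 1 ^ 11) * h 0 0 + A.1.1 0 0 * h 1 1 -
      (A.1.1.det * A.1.1 1 0 ^ 11) * h 0 1 - A.1.1 0 1 * h 1 0 - e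
  linear_combination this

/-- A homomorphism from `SL₂` whose kernel is the centre factors through `L₂(11)`. -/
theorem exists_lift_projective {G : Type*} [Group G]
    (F : Matrix.SpecialLinearGroup (Fin 2) (ZMod 11) →* G)
    (hF : F.ker = Subgroup.center (Matrix.SpecialLinearGroup (Fin 2) (ZMod 11))) :
    ∃ f : L2 →* G, Function.Injective f ∧ ∀ x, f (QuotientGroup.mk x) = F x := by
  refine ⟨(QuotientGroup.kerLift F).comp (QuotientGroup.quotientMulEquivOfEq hF.symm).toMonoidHom,
    (QuotientGroup.kerLift_injective F).comp (MulEquiv.injective _), fun x => rfl⟩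

variable (k) in
/-- The scalar matrices form the centre. -/
theorem mem_center_hermGroup_iff (A : hermGroup k) :
    A ∈ Subgroup.center (hermGroup k) ↔ IsScalar A.1 := by
  rw [Subgroup.mem_center_iff]
  constructor
  · intro h
    -- Commuting with the two elementary matrices over the prime field already forces a scalar
    -- matrix.
    obtain ⟨x, hx⟩ : ∃ x : Matrix.SpecialLinearGroup (Fin 2) (ZMod 11), x.1 = !![1, 1; 0, 1] :=
      ⟨⟨!![1, 1; 0, 1], by simp [Matrix.det_fin_two]⟩, rfl⟩
    obtain ⟨y, hy⟩ : ∃ x : Matrix.SpecialLinearGroup (Fin 2) (ZMod 11), x.1 = !![1, 0; 1, 1] :=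
      ⟨⟨!![1, 0; 1, 1], by simp [Matrix.det_fin_two]⟩, rfl⟩
    have hu := h (slHom k x)
    have hl := h (slHom k y)
    have hu' := fun i j => congrArg (fun C : hermGroup k => C.1.1 i j) hu
    have hl' := fun i j => congrArg (fun C : hermGroup k => C.1.1 i j) hl
    have u00 := hu' 0 0
    have u01 := hu' 0 1
    have l00 := hl' 0 0
    simp [Matrix.mul_apply, Fin.sum_univ_two, slHom_apply, hx, hy] at u00 u01 l00
    refine ⟨l00, u00, ?_⟩
    linear_combination -u01
  · rintro ⟨h1, h2, h3⟩ B
    apply Subtype.ext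
    apply Units.ext
    ext i j
    fin_cases i <;> fin_cases j <;>
      simp [Matrix.mul_apply, Fin.sum_univ_two, h1, h2, ← h3, mul_comm]

variable [IsAlgClosed k]

-- A stabilising matrix satisfies Ā = cA. The multiple sA lies in `hermGroup` when s¹³ c det A = s,
-- which explains the choice s¹² = (c det A)⁻¹.
variable (k) in
theorem range_hermGroup :
    ((moebius k).comp (hermGroup k).subtype).range = discriminantStabilizer 0 := by
  refine le_antisymm ?_ fun h hh => ?_
  · rintro _ ⟨A, rfl⟩
    refine moebius_mem_discriminantStabilizer (hermGroup k).subtype (fun A p hp => ?_) A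
    obtain ⟨v, rfl⟩ := (P1.coordinates k).surjective p
    rw [moebius_point, point_mem_discriminantLocus]
    replace hp := point_mem_discriminantLocus.1 hp
    left
    refine (hermForm_mulVec A.2 v.1).trans ?_
    simpa using hp
  · obtain ⟨A, rfl⟩ := moebius_surjective h
    have hne : ∀ t : k, ![1, t] ≠ 0 := fun t h => one_ne_zero (congrFun h 0)
    obtain ⟨c, hc, hcA⟩ := exists_frobenius_eq_smul A (fun t ht => by
      have hmem : P1.point ⟨![1, t], hne t⟩ ∈ discriminantLocus (0 : k) :=
        point_mem_discriminantLocus.2 (Or.inl (by simp [hermForm, ht]))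
      have := Set.mem_image_of_mem (moebius k A).1 hmem
      change P1.point (coneMap A ⟨![1, t], hne t⟩) ∈ _ at this
      rw [show (moebius k A).1 '' discriminantLocus 0 = discriminantLocus 0 from hh] at this
      refine (point_mem_discriminantLocus.1 this).elim id fun h => ?_
      refine Eq.trans h ?_
      ring)
    have hcd : c * A.1.det ≠ 0 := mul_ne_zero hc (det_ne A)
    obtain ⟨s, hs⟩ := IsAlgClosed.exists_pow_nat_eq (c * A.1.det)⁻¹ (n := 12) (by norm_num)
    have hs0 : s ≠ 0 := by
      rintro rfl
      rw [zero_pow (by norm_num)] at hs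
      exact inv_ne_zero hcd hs.symm
    obtain ⟨B, hB, hBA⟩ := exists_smul_moebius_eq A hs0
    refine ⟨⟨B, ?_⟩, hB⟩
    rw [mem_hermGroup]
    intro i j
    have hs' : s ^ 12 * (c * A.1.det) = 1 := by rw [hs, inv_mul_cancel₀ hcd]
    have hdet : B.1.det = s ^ 2 * A.1.det := by
      rw [Matrix.det_fin_two, Matrix.det_fin_two, hBA, hBA, hBA, hBA]; ring
    rw [hdet, hBA, mul_pow, hcA]
    linear_combination s * A.1 i j * hs'

-- The kernel of the action on the line consists of the scalar matrices, which form the centre.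
variable (k) in
theorem nonempty_stabilizer_equiv : Nonempty (discriminantStabilizer (0 : k) ≃* PGU2) := by
  obtain ⟨e, -⟩ := exists_unitaryEquiv k
  set m := ((moebius k).comp (hermGroup k).subtype).comp e.toMonoidHom with hm
  have hrange : m.range = discriminantStabilizer 0 := by
    rw [← range_hermGroup k, hm, MonoidHom.range_comp, MonoidHom.range_eq_top.2 e.surjective,
      MonoidHom.range_eq_map]
  have hker : m.ker = Subgroup.center GU2 := by
    ext A
    have h1 : A ∈ m.ker ↔ IsScalar (e A).1 := moebius_eq_one_iff _
    rw [h1, ← mem_center_hermGroup_iff, Subgroup.mem_center_iff, Subgroup.mem_center_iff]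
    constructor
    · intro h B
      apply e.injective
      rw [map_mul, map_mul, h]
    · intro h B
      rw [← e.apply_symm_apply B, ← map_mul, ← map_mul, h]
  exact ⟨((QuotientGroup.quotientMulEquivOfEq hker.symm).trans
    ((QuotientGroup.quotientKerEquivRange m).trans (MulEquiv.subgroupCongr hrange))).symm⟩

theorem exists_orderOf_eq_twelve : ∃ z : kˣ, orderOf z = 12 := by
  have h12 : NeZero ((12 : ℕ) : k) := ⟨by
    rw [Ne, CharP.cast_eq_zero_iff k 11]; norm_num⟩
  obtain ⟨z, hz⟩ := HasEnoughRootsOfUnity.exists_primitiveRoot k 12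
  obtain ⟨u, hu⟩ := hz.isUnit (by norm_num)
  refine ⟨u, ?_⟩
  rw [← orderOf_units, hu, ← hz.eq_orderOf]

theorem slHom_scalar_iff_hermAction {x : Matrix.SpecialLinearGroup (Fin 2) (ZMod 11)} :
    (hermAction k).toAut (slHom k x) = 1 ↔
      x ∈ Subgroup.center (Matrix.SpecialLinearGroup (Fin 2) (ZMod 11)) := by
  rw [hermAction_eq_one_iff, ← isScalar_slHom_iff (k := k)]
  exact and_iff_left_of_imp fun h => by rw [← h.det, det_slHom]

variable (k) in
/-- The stabilizer has a subgroup of index two isomorphic to `L₂(11)`. -/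
theorem exists_index_two : ∃ N : Subgroup (discriminantStabilizer (0 : k)),
    N.Normal ∧ N.index = 2 ∧ Nonempty (N ≃* L2) := by
  set m : hermGroup k →* discriminantStabilizer (0 : k) :=
    ((moebius k).comp (hermGroup k).subtype).codRestrict _ (fun A => by
      rw [← range_hermGroup k]; exact ⟨A, rfl⟩) with hm
  have hmsurj : Function.Surjective m := by
    rintro ⟨h, hh⟩
    rw [← range_hermGroup k] at hh
    obtain ⟨A, hA⟩ := hh
    exact ⟨A, Subtype.ext hA⟩
  have hm1 : ∀ A, m A = 1 ↔ IsScalar A.1 := fun A =>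
    Subtype.ext_iff.trans (moebius_eq_one_iff _)
  set N := (m.comp (slHom k)).range with hN
  -- Up to scalars A can be moved into SL₂(𝔽₁₁) by dividing by s with s² = det A. Such a scalar
  -- belongs to the group when s¹² = 1, that is (det A)⁶ = 1.
  have hmem : ∀ A, m A ∈ N ↔ A.1.1.det ^ 6 = 1 := by
    intro A
    constructor
    · rintro ⟨x, hx⟩
      have h1 : m (A * (slHom k x)⁻¹) = 1 := by
        rw [map_mul, map_inv, ← hx]; exact mul_inv_cancel _
      have h2 := (hm1 _).1 h1
      have h3 := h2.pow_twelve (A * (slHom k x)⁻¹).2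
      have h4 := h2.det
      have h5 : A.1.1.det = (A * (slHom k x)⁻¹).1.1.det := by
        have : A = (A * (slHom k x)⁻¹) * slHom k x := by group
        conv_lhs => rw [this]
        rw [Subgroup.coe_mul, Units.val_mul, Matrix.det_mul, det_slHom, mul_one]
      rw [h5, h4, ← pow_mul]
      exact h3
    · intro hA
      obtain ⟨s, hs⟩ := IsAlgClosed.exists_pow_nat_eq A.1.1.det two_pos
      have hs0 : s ≠ 0 := by
        rintro rfl
        exact det_ne A.1 (by rw [← hs]; ring)
      obtain ⟨B, hB, hBA⟩ := exists_smul_moebius_eq A.1 (inv_ne_zero hs0)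
      have hdet : B.1.det = 1 := by
        have := Matrix.det_fin_two A.1.1
        rw [Matrix.det_fin_two, hBA, hBA, hBA, hBA]
        field_simp
        rw [← this, hs]
      have hs12 : s ^ 12 = 1 := by rw [show 12 = 2 * 6 from rfl, pow_mul, hs, hA]
      have hBmem : B ∈ hermGroup k := by
        rw [mem_hermGroup, hdet]
        intro i j
        have h := mem_hermGroup.1 A.2 i j
        rw [hBA, mul_pow, inv_pow]
        rw [← hs] at h
        have h11 : (s ^ 11)⁻¹ = s := by
          rw [inv_eq_iff_eq_inv, ← mul_eq_one_iff_eq_inv₀ hs0, ← pow_succ, hs12]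
        rw [h11]
        field_simp
        linear_combination h
      obtain ⟨x, hx⟩ := exists_slHom (A := ⟨B, hBmem⟩) hdet
      refine ⟨x, ?_⟩
      rw [MonoidHom.comp_apply, hx]
      exact Subtype.ext hB
  obtain ⟨z, hz⟩ := exists_orderOf_eq_twelve (k := k)
  obtain ⟨i, hi⟩ := IsAlgClosed.exists_pow_nat_eq (-1 : k) two_pos
  have hz12 : z ^ 12 = 1 := hz ▸ pow_orderOf_eq_one z
  have hz6 : (z : k) ^ 6 = -1 := by
    have h1 : ((z : k) ^ 6) * ((z : k) ^ 6) = 1 := by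
      rw [← pow_add, ← Units.val_pow_eq_pow_val, hz12, Units.val_one]
    refine (mul_self_eq_one_iff.1 h1).resolve_left fun h => ?_
    have h6 : z ^ 6 = 1 := Units.ext (by simpa using h)
    have := orderOf_dvd_of_pow_eq_one h6
    rw [hz] at this
    norm_num at this
  have hindex : N.index = 2 := by
    rw [Subgroup.index_eq_two_iff]
    -- Since z has order 12, z⁶ = -1, so this torus element exchanges the two possible values ±1 of
    -- (det A)⁶.
    refine ⟨m ⟨_, torus_mem hi hz12⟩, fun b => ?_⟩
    obtain ⟨A, rfl⟩ := hmsurj b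
    rw [← map_mul, hmem, hmem, Subgroup.coe_mul, Units.val_mul, Matrix.det_mul, det_torus, mul_pow,
      hz6]
    have h1 : A.1.1.det ^ 6 * A.1.1.det ^ 6 = 1 := by rw [← pow_add, pow_twelve_det]
    have h2 := two_ne (k := k)
    have h3 : (-1 : k) ≠ 1 := fun h => h2 (by linear_combination -h)
    rcases mul_self_eq_one_iff.1 h1 with h | h <;> rw [h] <;> simp [Xor, h3]
  refine ⟨N, Subgroup.normal_of_index_eq_two hindex, hindex, ⟨?_⟩⟩
  have hker : (m.comp (slHom k)).ker =
      Subgroup.center (Matrix.SpecialLinearGroup (Fin 2) (ZMod 11)) := by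
    ext x
    rw [← isScalar_slHom_iff (k := k), ← hm1]
    rfl
  exact ((QuotientGroup.quotientMulEquivOfEq hker.symm).trans
    (QuotientGroup.quotientKerEquivRange _)).symm

variable (k) in
/-- The finite group of automorphisms of the surface with `ε = 0`. -/
theorem exists_group_zero :
    ∃ K : Subgroup (VarietyAut k (Surface (0 : k))), Finite K ∧
      (∀ g ∈ K, (∃ h : VarietyAut k (P1 k), Induces g h) ∧
        g.1 '' zeroSection 0 = zeroSection 0) ∧
      (Nonempty (K ≃* GU2 ⧸ plusMinusOne) ∧
        ∃ (φ : Cyc 12 →* MulAut L2) (e : L2 ⋊[φ] Cyc 12 ≃* K),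
          (∀ a : L2, IsSymplectic (e (SemidirectProduct.inl a)).1) ∧
          (∀ c : Cyc 12, c ≠ 1 → ¬ IsSymplectic (e (SemidirectProduct.inr c)).1)) ∧
      {h : VarietyAut k (P1 k) | ∃ g ∈ K, Induces g h} = discriminantStabilizer (0 : k) := by
  set T := (hermAction k).toAut with hT
  have hequiv : Nonempty (T.range ≃* GU2 ⧸ plusMinusOne) := by
    obtain ⟨e, he⟩ := exists_unitaryEquiv k
    have hrange : (T.comp e.toMonoidHom).range = T.range := by
      rw [MonoidHom.range_comp, MonoidHom.range_eq_top.2 e.surjective, MonoidHom.range_eq_map]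
    have hker : (T.comp e.toMonoidHom).ker = plusMinusOne := by
      ext A
      exact (hermAction_eq_one_iff (e A)).trans (he A).symm
    exact ⟨((QuotientGroup.quotientMulEquivOfEq hker.symm).trans
      ((QuotientGroup.quotientKerEquivRange _).trans (MulEquiv.subgroupCongr hrange))).symm⟩
  refine ⟨T.range, ?_, ?_, ⟨hequiv, ?_⟩, ?_⟩
  · obtain ⟨e⟩ := hequiv
    exact Finite.of_equiv _ e.symm.toEquiv
  · rintro _ ⟨g, rfl⟩
    exact ⟨⟨_, (hermAction k).induces g⟩, (hermAction k).image_zeroSection g⟩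
  · obtain ⟨z, hz⟩ := exists_orderOf_eq_twelve (k := k)
    obtain ⟨i, hi⟩ := IsAlgClosed.exists_pow_nat_eq (-1 : k) two_pos
    have hz12 : z ^ 12 = 1 := hz ▸ pow_orderOf_eq_one z
    set χ : Cyc 12 →* kˣ := cycHom 12 z hz12 with hχ
    have hχ12 : ∀ c, χ c ^ 12 = 1 := fun c => by
      change (z ^ _) ^ 12 = 1
      rw [← pow_mul, mul_comm, pow_mul, hz12, one_pow]
    have hχinj : Function.Injective χ := cycHom_injective hz
    set t : Cyc 12 →* hermGroup k := ((torus hi).comp χ).codRestrict _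
      (fun c => torus_mem hi (hχ12 c)) with ht
    have hdett : ∀ c, (t c).1.1.det = χ c := fun c => det_torus hi _
    -- The kernel ±1 of the action has determinant 1, so the determinant is well defined on the
    -- image; it will separate the complement from L₂(11).
    have hTdet : ∀ A B : hermGroup k, T A = T B → A.1.1.det = B.1.1.det := by
      intro A B h
      have h1 : T (A * B⁻¹) = 1 := by rw [map_mul, map_inv, h, mul_inv_cancel]
      obtain ⟨h2, h3⟩ := (hermAction_eq_one_iff _).1 h1
      have h4 : A = (A * B⁻¹) * B := by group
      conv_lhs => rw [h4]
      rw [Subgroup.coe_mul, Units.val_mul, Matrix.det_mul, h2.det, h3, one_mul]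
    obtain ⟨f, hf, hfx⟩ := exists_lift_projective (T.rangeRestrict.comp (slHom k)) (by
      ext x
      rw [← slHom_scalar_iff_hermAction (k := k)]
      exact Subtype.ext_iff)
    have hfrange : ∀ A : hermGroup k, T.rangeRestrict A ∈ f.range ↔ A.1.1.det = 1 := by
      intro A
      constructor
      · rintro ⟨x, hx⟩
        obtain ⟨x, rfl⟩ := QuotientGroup.mk_surjective x
        rw [hfx] at hx
        rw [← hTdet _ _ (congrArg Subtype.val hx), det_slHom]
      · intro h
        obtain ⟨x, hx⟩ := exists_slHom h
        exact ⟨QuotientGroup.mk x, by rw [hfx, MonoidHom.comp_apply, hx]⟩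
    obtain ⟨φ, e, he1, he2⟩ := exists_semidirectProduct f (T.rangeRestrict.comp t) hf
      ⟨fun y hy g => by
        obtain ⟨A, rfl⟩ := T.rangeRestrict_surjective y
        obtain ⟨B, rfl⟩ := T.rangeRestrict_surjective g
        rw [hfrange] at hy
        rw [← map_mul, ← map_inv, ← map_mul, hfrange]
        rw [Subgroup.coe_mul, Subgroup.coe_mul, Units.val_mul, Units.val_mul, Matrix.det_mul,
          Matrix.det_mul, hy, mul_one, ← Matrix.det_mul, ← Units.val_mul, ← Subgroup.coe_mul,
          mul_inv_cancel]
        simp⟩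
      (fun n c h => by
        have h1 : T.rangeRestrict (t c) ∈ f.range := ⟨n, h⟩
        rw [hfrange, hdett] at h1
        apply hχinj
        rw [map_one]
        exact Units.ext h1)
      (fun y => by
        obtain ⟨A, rfl⟩ := T.rangeRestrict_surjective y
        -- The determinant is a 12th root of unity, hence the determinant of a torus element; the
        -- quotient by that element has determinant 1.
        obtain ⟨c, hc⟩ : ∃ c, (χ c : k) = A.1.1.det := by
          have hprim : IsPrimitiveRoot (z : k) 12 := by
            rw [← hz, ← orderOf_units]
            exact IsPrimitiveRoot.orderOf _
          obtain ⟨n, -, hn⟩ := hprim.eq_pow_of_pow_eq_one (pow_twelve_det A)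
          obtain ⟨c, hc⟩ := cycHom_surjective hz12 (x := z ^ n) ⟨n, rfl⟩
          exact ⟨c, by rw [hχ, hc, Units.val_pow_eq_pow_val, hn]⟩
        have h1 : T.rangeRestrict (A * (t c)⁻¹) ∈ f.range := by
          rw [hfrange]
          have h2 : (A * (t c)⁻¹).1.1.det * (t c).1.1.det = A.1.1.det := by
            rw [← Matrix.det_mul, ← Units.val_mul, ← Subgroup.coe_mul, inv_mul_cancel_right]
          rw [hdett, hc] at h2
          exact mul_right_cancel₀ (det_ne A.1) (h2.trans (one_mul _).symm)
        obtain ⟨n, hn⟩ := h1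
        refine ⟨n, c, ?_⟩
        rw [hn, MonoidHom.comp_apply, ← map_mul, inv_mul_cancel_right])
    refine ⟨φ, e, fun a => ?_, fun c hc => ?_⟩
    · obtain ⟨x, rfl⟩ := QuotientGroup.mk_surjective a
      rw [he1, hfx]
      exact (isSymplectic_hermAction_iff _).2 (det_slHom x)
    · rw [he2]
      intro h
      have h1 := (isSymplectic_hermAction_iff (t c)).1 h
      rw [hdett] at h1
      apply hc
      apply hχinj
      rw [map_one]
      exact Units.ext h1
  · rw [← range_hermGroup k]
    ext h
    constructor
    · rintro ⟨_, ⟨g, rfl⟩, hg⟩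
      exact ⟨g, ((hermAction k).induces_iff g h).1 hg⟩
    · rintro ⟨g, hg⟩
      exact ⟨_, ⟨g, rfl⟩, ((hermAction k).induces_iff g h).2 hg⟩

end ZeroParameter

end K3Eleven

end

open K3Eleven
theorem lemma2p5 (k : Type*) [Field k] [IsAlgClosed k] [CharP k 11] (ε : k) :
    -- a finite group of automorphisms of the surface
    ∃ K : Subgroup (VarietyAut k (Surface ε)), Finite K ∧
      -- it preserves the standard fibration and the zero section
      (∀ g ∈ K, (∃ h : VarietyAut k (P1 k), Induces g h) ∧
        g.1 '' zeroSection ε = zeroSection ε) ∧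
      -- its structure for `ε = 0`
      (ε = 0 →
        Nonempty (K ≃* GU2 ⧸ plusMinusOne) ∧
        ∃ (φ : Cyc 12 →* MulAut L2) (e : L2 ⋊[φ] Cyc 12 ≃* K),
          (∀ a : L2, IsSymplectic (e (SemidirectProduct.inl a)).1) ∧
          (∀ c : Cyc 12, c ≠ 1 → ¬ IsSymplectic (e (SemidirectProduct.inr c)).1)) ∧
      -- its structure for `ε ≠ 0`
      (ε ≠ 0 →
        ∃ (φ : Cyc 4 →* MulAut (Cyc 11)) (e : Cyc 11 ⋊[φ] Cyc 4 ≃* K),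
          φ ≠ 1 ∧
          (∀ a : Cyc 11, IsSymplectic (e (SemidirectProduct.inl a)).1) ∧
          (∀ c : Cyc 4, c ≠ 1 → ¬ IsSymplectic (e (SemidirectProduct.inr c)).1)) ∧
      -- its image in the automorphism group of the projective line
      {h : VarietyAut k (P1 k) | ∃ g ∈ K, Induces g h} = discriminantStabilizer ε ∧
      -- the structure of that image
      (ε = 0 →
        Nonempty (discriminantStabilizer ε ≃* PGU2) ∧
        ∃ N : Subgroup (discriminantStabilizer ε),
          N.Normal ∧ N.index = 2 ∧ Nonempty (N ≃* L2)) ∧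
      (ε ≠ 0 →
        ∃ φ : Cyc 2 →* MulAut (Cyc 11), φ ≠ 1 ∧
          Nonempty (discriminantStabilizer ε ≃* Cyc 11 ⋊[φ] Cyc 2)) := by
  by_cases hε : ε = 0
  · subst hε
    obtain ⟨K, h1, h2, h3, h4⟩ := exists_group_zero k
    exact ⟨K, h1, h2, fun _ => h3, fun h => absurd rfl h, h4,
      fun _ => ⟨nonempty_stabilizer_equiv k, exists_index_two k⟩, fun h => absurd rfl h⟩
  · obtain ⟨K, h1, h2, h3, h4, h5⟩ := exists_group_of_ne_zero hε
    exact ⟨K, h1, h2, fun h => absurd h hε, fun _ => h3, h4, fun h => absurd h hε, fun _ => h5⟩
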